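/- **Real Value Perception Manipulation (RVPM) under the $l_2$ norm.** An instance consists of $n\ge 1$ candidates $c_1,\dots,c_n\in\mathbb R^d$, $m$ voters $v_1,\dots,v_m\in\mathbb R^d$, a non-increasing scoring function $f:\{1,\dots,n\}\to\mathbb R$ and a budget $\epsilon>0$, such that no voter has a tie, i.e. $\|v_j-c_i\|_2\neq\|v_j-c_k\|_2$ for all $j$ and all $i\ne k$. The adversary replaces the position of $c_1$ by some $\tilde c_1\in\mathbb R^d$ with $\|\tilde c_1-c_1\|_2\le\epsilon$. Then each voter ranks the candidates by $l_2$ distance, the closest first, a candidate ranked $t$-th by a voter receives the score $f(t)$ from that voter, and scores are added over the voters. In the constructive variant the question is whether some admissible $\tilde c_1$ makes the target candidate win (its total score is at least that of every candidate), where in rankings the target candidate is placed ahead of a candidate at the same distance. In the destructive variant the question is whether some admissible $\tilde c_1$ makes it lose (some other candidate has a total score at least as large), where the target candidate is placed behind a candidate at the same distance. **Theorem.** For every constant number $m$ of voters, the constructive and the destructive variant of RVPM under the $l_2$ norm can be solved in polynomial time for arbitrary scoring rules. More precisely, for each $m$ and each of the two variants there is one program of a random access machine with the operations $+,-,\times,\div$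 and the comparison $\le$ on numbers such that 1. on all instances with real data it decides the question in $$O\bigl(nd+n^2+|f_{\rm uniq}|^m\,(d^3+n)\bigr)$$ steps at unit cost, where $|f_{\rm uniq}|\le n$ is the number of distinct values of $f$ and the implied constant depends only on $m$ (that is, $O(d^3)$ for each of the $|f_{\rm uniq}|^m$ scenarios of scores that the target candidate may receive from the voters, besides the $O(n)$ check of the election outcome per scenario and preprocessing); 2. on all instances with rational data it decides the question in time polynomial in the bit length of the instance, where every step is charged for the bits of the indices and numbers that it reads and writes. -/

import Mathlib

namespace RVPM

/-! ### Elections, perception manipulation -/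

/-- The two control goals: make the target candidate win, or make it lose. -/
inductive Goal where
  | constructive
  | destructive

/-- Raw data of an instance with `n` candidates, `d` issues and `m` voters and numbers in `K`:
positions of the candidates (candidate `0` is the target) and of the voters, the scoring rule
(`score t` is the score for being ranked in the place number `t + 1`), and the budget. -/
structure Instance (K : Type) (n d m : ℕ) where
  cand : Fin n → Fin d → K
  voter : Fin m → Fin d → K
  score : Fin n → K
  budget : K

/-- Change of the number type. -/
def Instance.map {K L : Type} {n d m : ℕ} (φ : K → L) (I : Instance K n d m) :
    Instance L n d m where
  cand i k := φ (I.cand i k)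
  voter j k := φ (I.voter j k)
  score t := φ (I.score t)
  budget := φ I.budget

/-- The `l_2` distance on `ℝ^d`. -/
noncomputable def l2dist {d : ℕ} (x y : Fin d → ℝ) : ℝ :=
  dist (WithLp.toLp 2 x : EuclideanSpace ℝ (Fin d)) (WithLp.toLp 2 y)

/-- Standing assumptions: the scoring rule is non-increasing, the budget is positive, and no voter
has a tie in the actual preference ranking. -/
structure Instance.Valid {n d m : ℕ} (I : Instance ℝ n d m) : Prop where
  antitone_score : Antitone I.score
  budget_pos : 0 < I.budget
  no_ties : ∀ j, Function.Injective fun i => l2dist (I.voter j) (I.cand i)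

/-- With perceived candidate positions `c`, a voter at `v` ranks `k` ahead of `i`: `k` is closer,
or they are equally close and the tie, which involves the target candidate `0`, is broken in the
favor of the adversary. -/
def Ahead {n d : ℕ} [NeZero n] (g : Goal) (c : Fin n → Fin d → ℝ) (v : Fin d → ℝ)
    (k i : Fin n) : Prop :=
  l2dist v (c k) < l2dist v (c i) ∨
    (l2dist v (c k) = l2dist v (c i) ∧
      match g with
      | .constructive => k = 0 ∧ i ≠ 0
      | .destructive => k ≠ 0 ∧ i = 0)

theorem not_ahead_self {n d : ℕ} [NeZero n] (g : Goal) (c : Fin n → Fin d → ℝ) (v : Fin d → ℝ)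
    (i : Fin n) : ¬ Ahead g c v i i := by
  cases g <;> simp [Ahead]

open Classical in
/-- The rank of candidate `i`, counted from `0`: the number of candidates ranked ahead of it. -/
noncomputable def rank {n d : ℕ} [NeZero n] (g : Goal) (c : Fin n → Fin d → ℝ) (v : Fin d → ℝ)
    (i : Fin n) : Fin n :=
  ⟨(Finset.univ.filter fun k => Ahead g c v k i).card, by
    have h := Finset.card_lt_card (Finset.filter_ssubset (p := fun k => Ahead g c v k i).2
      ⟨i, Finset.mem_univ i, not_ahead_self g c v i⟩)
    simpa using h⟩

/-- The candidate positions after the target candidate is perceived at `x`. -/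
def Instance.perceived {n d m : ℕ} [NeZero n] (I : Instance ℝ n d m) (x : Fin d → ℝ) :
    Fin n → Fin d → ℝ :=
  Function.update I.cand 0 x

/-- Total score of candidate `i` when the target candidate is perceived at `x`. -/
noncomputable def Instance.total {n d m : ℕ} [NeZero n] (I : Instance ℝ n d m) (g : Goal)
    (x : Fin d → ℝ) (i : Fin n) : ℝ :=
  ∑ j, I.score (rank g (I.perceived x) (I.voter j) i)

/-- The adversary reaches its goal by moving the target candidate to `x`; ties between total scores
are broken in the favor of the adversary. -/
def Instance.Succeeds {n d m : ℕ} [NeZero n] (I : Instance ℝ n d m) (g : Goal)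
    (x : Fin d → ℝ) : Prop :=
  match g with
  | .constructive => ∀ i, I.total .constructive x i ≤ I.total .constructive x 0
  | .destructive => ∃ i, i ≠ 0 ∧ I.total .destructive x 0 ≤ I.total .destructive x i

/-- The question of Real Value Perception Manipulation under the `l_2` norm. -/
def Instance.Manipulable {n d m : ℕ} [NeZero n] (I : Instance ℝ n d m) (g : Goal) : Prop :=
  ∃ x : Fin d → ℝ, l2dist x (I.cand 0) ≤ I.budget ∧ I.Succeeds g x

/-- The number of distinct values of the scoring rule. -/
noncomputable def Instance.numScores {K : Type} {n d m : ℕ} (I : Instance K n d m) : ℕ :=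
  (Set.range I.score).ncard

/-! ### Random access machines over an ordered field

A machine has index registers, holding natural numbers, and two-dimensional arrays of numbers.
A program is a fixed finite text that does not depend on the size of the input. -/

/-- The cell `arr[x, y]`, where `x` and `y` are the contents of the index registers `row`, `col`. -/
structure Cell where
  arr : ℕ
  row : ℕ
  col : ℕ

/-- The arithmetic operations. -/
inductive ArithOp where
  | add
  | sub
  | mul
  | div

/-- The value of an arithmetic operation (a division by zero returns zero). -/
def ArithOp.eval {K : Type} [Field K] : ArithOp → K → K → K
  | .add, x, y => x + y
  | .sub, x, y => x - y
  | .mul, x, y => x * y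
  | .div, x, y => x / y

/-- Programs. -/
inductive Prog where
  /-- do nothing -/
  | skip
  /-- index register `r` becomes `0` -/
  | clear (r : ℕ)
  /-- index register `r` is increased by `1` -/
  | incr (r : ℕ)
  /-- index register `r` becomes a copy of index register `r'` -/
  | copy (r r' : ℕ)
  /-- cell `a` becomes the integer constant `z` -/
  | const (a : Cell) (z : ℤ)
  /-- cell `a` becomes a copy of cell `b` -/
  | move (a b : Cell)
  /-- cell `a` becomes the result of an arithmetic operation on cells `b` and `c` -/
  | arith (op : ArithOp) (a b c : Cell)
  /-- first `p`, then `q` -/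
  | seq (p q : Prog)
  /-- if index register `r` is less than index register `r'` then `p` else `q` -/
  | ifIdx (r r' : ℕ) (p q : Prog)
  /-- if the number in cell `a` is at most the number in cell `b` then `p` else `q` -/
  | ifLe (a b : Cell) (p q : Prog)
  /-- while index register `r` is less than index register `r'` do `p` -/
  | while (r r' : ℕ) (p : Prog)

/-- Contents of the index registers and of the arrays. -/
structure Store (K : Type) where
  reg : ℕ → ℕ
  mem : ℕ → ℕ → ℕ → K

namespace Store

variable {K : Type}

def setReg (s : Store K) (r v : ℕ) : Store K :=
  { s with reg := Function.update s.reg r v }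

def get (s : Store K) (a : Cell) : K := s.mem a.arr (s.reg a.row) (s.reg a.col)

def set (s : Store K) (a : Cell) (x : K) : Store K :=
  { s with mem := fun k i j =>
      if k = a.arr ∧ i = s.reg a.row ∧ j = s.reg a.col then x else s.mem k i j }

end Store

/-- What is charged, on top of one time unit per instruction, for every index and every number that
an instruction reads or writes. -/
structure CostModel (K : Type) where
  idx : ℕ → ℕ
  num : K → ℕ

/-- Unit cost: the time is the number of executed instructions. -/
def unitCost (K : Type) : CostModel K where
  idx _ := 0
  num _ := 0

/-- The length of a rational number, in bits. -/
def ratBits (q : ℚ) : ℕ := Nat.size q.num.natAbs + Nat.size q.den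

/-- Logarithmic cost: an instruction is charged for the bits of all the indices (addresses
included) and rational numbers that it reads and writes. -/
def bitCost : CostModel ℚ where
  idx := Nat.size
  num := ratBits

/-- The charge for accessing cell `a`, where the number `x` is read or written. -/
def CostModel.access {K : Type} (κ : CostModel K) (s : Store K) (a : Cell) (x : K) : ℕ :=
  κ.idx (s.reg a.row) + κ.idx (s.reg a.col) + κ.num x

/-- `Exec κ p s s' t`: started in `s`, the program `p` halts in `s'` after time `t`. -/
inductive Exec {K : Type} [Field K] [LinearOrder K] (κ : CostModel K) :
    Prog → Store K → Store K → ℕ → Prop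
  | skip (s : Store K) : Exec κ .skip s s 1
  | clear (s : Store K) (r : ℕ) : Exec κ (.clear r) s (s.setReg r 0) (1 + κ.idx (s.reg r))
  | incr (s : Store K) (r : ℕ) :
      Exec κ (.incr r) s (s.setReg r (s.reg r + 1)) (1 + κ.idx (s.reg r) + κ.idx (s.reg r + 1))
  | copy (s : Store K) (r r' : ℕ) :
      Exec κ (.copy r r') s (s.setReg r (s.reg r')) (1 + κ.idx (s.reg r) + κ.idx (s.reg r'))
  | const (s : Store K) (a : Cell) (z : ℤ) :
      Exec κ (.const a z) s (s.set a (z : K)) (1 + κ.access s a (z : K))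
  | move (s : Store K) (a b : Cell) :
      Exec κ (.move a b) s (s.set a (s.get b))
        (1 + κ.access s b (s.get b) + κ.access s a (s.get b))
  | arith (s : Store K) (op : ArithOp) (a b c : Cell) :
      Exec κ (.arith op a b c) s (s.set a (op.eval (s.get b) (s.get c)))
        (1 + κ.access s b (s.get b) + κ.access s c (s.get c)
          + κ.access s a (op.eval (s.get b) (s.get c)))
  | seq {p q : Prog} {s s' s'' : Store K} {t t' : ℕ} :
      Exec κ p s s' t → Exec κ q s' s'' t' → Exec κ (.seq p q) s s'' (t + t')
  | ifIdx_pos {r r' : ℕ} {p q : Prog} {s s' : Store K} {t : ℕ} :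
      s.reg r < s.reg r' → Exec κ p s s' t →
      Exec κ (.ifIdx r r' p q) s s' (1 + κ.idx (s.reg r) + κ.idx (s.reg r') + t)
  | ifIdx_neg {r r' : ℕ} {p q : Prog} {s s' : Store K} {t : ℕ} :
      ¬ s.reg r < s.reg r' → Exec κ q s s' t →
      Exec κ (.ifIdx r r' p q) s s' (1 + κ.idx (s.reg r) + κ.idx (s.reg r') + t)
  | ifLe_pos {a b : Cell} {p q : Prog} {s s' : Store K} {t : ℕ} :
      s.get a ≤ s.get b → Exec κ p s s' t →
      Exec κ (.ifLe a b p q) s s' (1 + κ.access s a (s.get a) + κ.access s b (s.get b) + t)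
  | ifLe_neg {a b : Cell} {p q : Prog} {s s' : Store K} {t : ℕ} :
      ¬ s.get a ≤ s.get b → Exec κ q s s' t →
      Exec κ (.ifLe a b p q) s s' (1 + κ.access s a (s.get a) + κ.access s b (s.get b) + t)
  | while_pos {r r' : ℕ} {p : Prog} {s s' s'' : Store K} {t t' : ℕ} :
      s.reg r < s.reg r' → Exec κ p s s' t → Exec κ (.while r r' p) s' s'' t' →
      Exec κ (.while r r' p) s s'' (1 + κ.idx (s.reg r) + κ.idx (s.reg r') + t + t')
  | while_neg {r r' : ℕ} {p : Prog} {s : Store K} :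
      ¬ s.reg r < s.reg r' →
      Exec κ (.while r r' p) s s (1 + κ.idx (s.reg r) + κ.idx (s.reg r'))

/-- Started in `s`, the program `p` halts within time `T` with the correct answer to the question
`Q` in index register `0` (`1` for yes, `0` for no). -/
def DecidesWithin {K : Type} [Field K] [LinearOrder K] (κ : CostModel K) (p : Prog) (s : Store K)
    (Q : Prop) (T : ℕ) : Prop :=
  ∃ s' t, Exec κ p s s' t ∧ t ≤ T ∧ ((Q ∧ s'.reg 0 = 1) ∨ (¬ Q ∧ s'.reg 0 = 0))

/-- The input: `n`, `d`, `m` in the index registers `0`, `1`, `2`; candidate positions, voter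
positions, scores and the budget in the arrays `0`, `1`, `2`, `3`; zeros everywhere else. -/
def Instance.input {K : Type} [Zero K] {n d m : ℕ} (I : Instance K n d m) : Store K where
  reg r := match r with
    | 0 => n
    | 1 => d
    | 2 => m
    | _ => 0
  mem a i k := match a with
    | 0 => if h : i < n ∧ k < d then I.cand ⟨i, h.1⟩ ⟨k, h.2⟩ else 0
    | 1 => if h : i < m ∧ k < d then I.voter ⟨i, h.1⟩ ⟨k, h.2⟩ else 0
    | 2 => if h : i = 0 ∧ k < n then I.score ⟨k, h.2⟩ else 0
    | 3 => if i = 0 ∧ k = 0 then I.budget else 0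
    | _ => 0

/-- The bit length of a rational instance. -/
def Instance.bits {n d m : ℕ} (I : Instance ℚ n d m) : ℕ :=
  (∑ i, ∑ k, ratBits (I.cand i k)) + (∑ j, ∑ k, ratBits (I.voter j k))
    + (∑ t, ratBits (I.score t)) + ratBits I.budget

/-- The real instance given by a rational instance. -/
noncomputable def Instance.toReal {n d m : ℕ} (I : Instance ℚ n d m) : Instance ℝ n d m :=
  I.map fun q : ℚ => (q : ℝ)

end RVPM

/-! The proof separates a combinatorial guess from a geometric test whose size depends neither on
`n` nor on `d`.

Combinatorics. Fixing the target's rank for a voter fixes all scores given by that voter: the other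
candidates keep their order, and those behind the target shift by one place. Pushing the target
forward never lowers its own score and never raises another one. So it suffices to demand rank `e j`
or better (constructive) or `e j` or worse (destructive), and among ranks of equal score only the
weakest demand, the marked rank, has to be tried; this leaves at most |f_uniq| choices per voter.
Such a demand is one bound on the squared distance to the voter, given by the candidate that
delimits the rank (`Instance.Valid.rad_iff`). Hence `Instance.Valid.manipulable_iff`: the goal is
reachable iff some scenario of marked ranks reaches it and satisfies its distance bounds at one
point of the budget ball.

Geometry, constructive: do finitely many balls meet? At a common point take the ball with the
largest value of squared distance minus squared radius; subtracting its inequality makes all the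
others linear (`near_iff`). The solution of least norm lies in the span of the active normals, so it
is the Cramer solution of a Gram system on an independent set of constraints, and all sets can be
tried (`exists_le_iff_exists_coreAt`).

Geometry, destructive: lying outside balls is not convex. With a variable `s` in place of ‖x‖² the
constraints are linear in `(x, s)`, and it suffices to find one solution with ‖x‖² ≤ s = b and one
with ‖x‖² ≥ s, because the segment between them passes through equality (`exists_between`). The
first is a least-norm problem again. The second exists automatically for `d > m`, by moving far in a
direction orthogonal to all voters; for `d ≤ m` a convex function is to be nonnegative somewhere on
a polytope, and then it is so at a vertex (`exists_vertex`, `far_iff`).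

Feasibility is therefore one quantifier-free formula with integer constants in O(m²) parameters:
Gram entries, squared radii, squared budget, dimension and, for `d ≤ m`, coordinates
(`exists_formula`). After preprocessing, its evaluation takes constant time, and a scenario costs
O(n); the term d³ in the bound is slack.

Machine. The programs are verified once, over any ordered field and for an abstract `Meter`. The
height of a number is subadditive up to 1 under the operations, and the program only forms sums of
boundedly many small terms and values of terms of fixed size, so heights stay under control. Trivial
heights on ℝ give the unit cost bound, bit sizes on ℚ the polynomial one. Embeddings of ordered
fields preserve every test, so the rational computation answers the real question
(`manipulable_iff_exists`). -/

namespace RVPM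

/-! ### Timed Hoare logic -/

namespace Prog

/-- The program may write index register `x`. -/
def WR : Prog → ℕ → Prop
  | .clear r, x => x = r
  | .incr r, x => x = r
  | .copy r _, x => x = r
  | .seq p q, x => p.WR x ∨ q.WR x
  | .ifIdx _ _ p q, x => p.WR x ∨ q.WR x
  | .ifLe _ _ p q, x => p.WR x ∨ q.WR x
  | .while _ _ p, x => p.WR x
  | _, _ => False

/-- The program may write into array `x`. -/
def WA : Prog → ℕ → Prop
  | .const a _, x => x = a.arr
  | .move a _, x => x = a.arr
  | .arith _ a _ _, x => x = a.arr
  | .seq p q, x => p.WA x ∨ q.WA x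
  | .ifIdx _ _ p q, x => p.WA x ∨ q.WA x
  | .ifLe _ _ p q, x => p.WA x ∨ q.WA x
  | .while _ _ p, x => p.WA x
  | _, _ => False

/-- For `r` from `0` up to the content of `r'`, do `p`. -/
def forLoop (r r' : ℕ) (p : Prog) : Prog := .seq (.clear r) (.while r r' (.seq p (.incr r)))

/-- `p 0`, then `p 1`, and so on up to `p (k - 1)`. -/
def unroll (p : ℕ → Prog) : ℕ → Prog
  | 0 => .skip
  | k + 1 => .seq (unroll p k) (p k)

/-- Index register `r` becomes `k`. -/
def load (r k : ℕ) : Prog := .seq (.clear r) (unroll (fun _ => .incr r) k)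

@[simp] theorem WR_forLoop {r r' x : ℕ} {p : Prog} :
    (forLoop r r' p).WR x ↔ x = r ∨ p.WR x := by
  simp only [forLoop, WR]; tauto

@[simp] theorem WA_forLoop {r r' x : ℕ} {p : Prog} : (forLoop r r' p).WA x ↔ p.WA x := by
  simp [forLoop, WA]

@[simp] theorem WR_unroll {p : ℕ → Prog} {k x : ℕ} :
    (unroll p k).WR x ↔ ∃ j < k, (p j).WR x := by
  induction k with
  | zero => simp [unroll, WR]
  | succ k ih => simp only [unroll, WR, ih, Nat.lt_succ_iff_lt_or_eq, or_and_right, exists_or,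
      exists_eq_left]

@[simp] theorem WA_unroll {p : ℕ → Prog} {k x : ℕ} :
    (unroll p k).WA x ↔ ∃ j < k, (p j).WA x := by
  induction k with
  | zero => simp [unroll, WA]
  | succ k ih => simp only [unroll, WA, ih, Nat.lt_succ_iff_lt_or_eq, or_and_right, exists_or,
      exists_eq_left]

@[simp] theorem WR_load {r k x : ℕ} : (load r k).WR x ↔ x = r := by
  simp only [load, WR, WR_unroll]
  constructor
  · rintro (h | ⟨_, _, h⟩) <;> exact h
  · exact Or.inl

@[simp] theorem WA_load {r k x : ℕ} : ¬ (load r k).WA x := by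
  simp [load, WA]

end Prog

attribute [simp] Prog.WR Prog.WA

/-- The second store differs from the first one only where `p` may write. -/
def Same {K : Type} (p : Prog) (s s' : Store K) : Prop :=
  (∀ r, ¬ p.WR r → s'.reg r = s.reg r) ∧ ∀ a, ¬ p.WA a → s'.mem a = s.mem a

theorem Same.refl {K : Type} (p : Prog) (s : Store K) : Same p s s :=
  ⟨fun _ _ => rfl, fun _ _ => rfl⟩

theorem Same.trans {K : Type} {p : Prog} {s s' s'' : Store K} (h : Same p s s')
    (h' : Same p s' s'') : Same p s s'' :=
  ⟨fun r hr => (h'.1 r hr).trans (h.1 r hr), fun a ha => (h'.2 a ha).trans (h.2 a ha)⟩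

theorem Same.mono {K : Type} {p q : Prog} {s s' : Store K} (h : Same p s s')
    (hr : ∀ r, p.WR r → q.WR r) (ha : ∀ a, p.WA a → q.WA a) : Same q s s' :=
  ⟨fun r hq => h.1 r fun hp => hq (hr r hp), fun a hq => h.2 a fun hp => hq (ha a hp)⟩

section
variable {K : Type} [Field K] [LinearOrder K]

/-- Write sets are syntactic over-approximations, so this frame property lets later non-interference
claims be settled by computing `WR` and `WA` rather than by following executions. -/
theorem Exec.same {κ : CostModel K} {p : Prog} {s s' : Store K} {t : ℕ} (h : Exec κ p s s' t) :
    Same p s s' := by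
  induction h with
  | skip => exact Same.refl _ _
  | clear s r => exact ⟨fun x hx => by simp_all [Store.setReg], fun _ _ => rfl⟩
  | incr s r => exact ⟨fun x hx => by simp_all [Store.setReg], fun _ _ => rfl⟩
  | copy s r => exact ⟨fun x hx => by simp_all [Store.setReg], fun _ _ => rfl⟩
  | const s a => exact ⟨fun _ _ => rfl, fun x hx => by funext i k; simp_all [Store.set]⟩
  | move s a => exact ⟨fun _ _ => rfl, fun x hx => by funext i k; simp_all [Store.set]⟩
  | arith s op a => exact ⟨fun _ _ => rfl, fun x hx => by funext i k; simp_all [Store.set]⟩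
  | seq _ _ ih ih' =>
    exact (ih.mono (fun _ => Or.inl) fun _ => Or.inl).trans
      (ih'.mono (fun _ => Or.inr) fun _ => Or.inr)
  | ifIdx_pos _ _ ih => exact ih.mono (fun _ => Or.inl) fun _ => Or.inl
  | ifIdx_neg _ _ ih => exact ih.mono (fun _ => Or.inr) fun _ => Or.inr
  | ifLe_pos _ _ ih => exact ih.mono (fun _ => Or.inl) fun _ => Or.inl
  | ifLe_neg _ _ ih => exact ih.mono (fun _ => Or.inr) fun _ => Or.inr
  | while_pos _ _ _ ih ih' =>
    exact (ih.mono (fun _ h => h) fun _ h => h).trans ih'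
  | while_neg => exact Same.refl _ _

end

/-! ### Resource bounds common to both cost models -/

/-- A cost model with a measure `ht` of the size of numbers, bounds `R` on the index registers and
`H` on the sizes of numbers, and the resulting bound `w` on the charge for one access. -/
structure Meter (K : Type) [Field K] where
  cost : CostModel K
  ht : K → ℕ
  R : ℕ
  H : ℕ
  w : ℕ
  idx_le : ∀ i ≤ R, cost.idx i ≤ w
  num_le : ∀ x, ht x ≤ H → cost.num x ≤ w
  ht_op : ∀ o x y, ht (ArithOp.eval o x y) ≤ ht x + ht y + 1
  ht_int : ∀ z : ℤ, ht (z : K) ≤ z.natAbs + 1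

namespace Meter

variable {K : Type} [Field K] (M : Meter K)

/-- As long as this persists, every instruction costs at most one fixed amount, and timing reduces
to counting instructions. -/
def Ok (s : Store K) : Prop := (∀ r, s.reg r ≤ M.R) ∧ ∀ a i k, M.ht (s.mem a i k) ≤ M.H

/-- The time allowed for one instruction. -/
def unit : ℕ := 1 + 9 * M.w

variable {M}

theorem Ok.setReg {s : Store K} (h : M.Ok s) {r v : ℕ} (hv : v ≤ M.R) : M.Ok (s.setReg r v) := by
  refine ⟨fun x => ?_, h.2⟩
  by_cases hx : x = r
  · subst hx; simpa [Store.setReg] using hv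
  · simpa [Store.setReg, hx] using h.1 x

theorem Ok.set {s : Store K} (h : M.Ok s) {a : Cell} {x : K} (hx : M.ht x ≤ M.H) :
    M.Ok (s.set a x) := by
  refine ⟨h.1, fun b i k => ?_⟩
  simp only [Store.set]
  split_ifs
  · exact hx
  · exact h.2 b i k

theorem Ok.access_le {s : Store K} (h : M.Ok s) (a : Cell) {x : K} (hx : M.ht x ≤ M.H) :
    M.cost.access s a x ≤ 3 * M.w := by
  have h1 := M.idx_le _ (h.1 a.row)
  have h2 := M.idx_le _ (h.1 a.col)
  have h3 := M.num_le _ hx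
  simp only [CostModel.access]; omega

theorem Ok.get {s : Store K} (h : M.Ok s) (a : Cell) : M.ht (s.get a) ≤ M.H := h.2 _ _ _

end Meter

section
variable {K : Type} [Field K] [LinearOrder K]

/-! ### Rules of the timed logic -/

/-- Started in `s`, the program halts after at most `N` instructions within the bounds of the meter
and with the property `Q`. -/
def Runs (M : Meter K) (p : Prog) (N : ℕ) (s : Store K) (Q : Store K → Prop) : Prop :=
  M.Ok s → ∃ s' t, Exec M.cost p s s' t ∧ t ≤ N * M.unit ∧ M.Ok s' ∧ Q s'

variable {M : Meter K} {p q : Prog} {s : Store K} {Q Q' : Store K → Prop} {N N' : ℕ}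

theorem Runs.mono (h : Runs M p N s Q) (hN : N ≤ N') (hQ : ∀ s', Same p s s' → Q s' → Q' s') :
    Runs M p N' s Q' := by
  intro hs
  obtain ⟨s', t, he, ht, ho, hq⟩ := h hs
  exact ⟨s', t, he, ht.trans (Nat.mul_le_mul_right _ hN), ho, hQ s' he.same hq⟩

theorem Runs.weaken (h : Runs M p N s Q) (hN : N ≤ N') : Runs M p N' s Q :=
  h.mono hN fun _ _ h => h

theorem runs_skip (h : Q s) : Runs M .skip 1 s Q := fun hs =>
  ⟨s, 1, .skip s, by simp only [Meter.unit]; omega, hs, h⟩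

theorem runs_clear {r : ℕ} (h : Q (s.setReg r 0)) : Runs M (.clear r) 1 s Q := fun hs =>
  ⟨_, _, .clear s r, by
    have := M.idx_le _ (hs.1 r)
    simp only [Meter.unit]; omega, hs.setReg (Nat.zero_le _), h⟩

theorem runs_incr {r : ℕ} (hr : s.reg r + 1 ≤ M.R) (h : Q (s.setReg r (s.reg r + 1))) :
    Runs M (.incr r) 1 s Q := fun hs =>
  ⟨_, _, .incr s r, by
    have := M.idx_le _ (hs.1 r)
    have := M.idx_le _ hr
    simp only [Meter.unit]; omega, hs.setReg hr, h⟩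

theorem runs_copy {r r' : ℕ} (h : Q (s.setReg r (s.reg r'))) : Runs M (.copy r r') 1 s Q :=
  fun hs => ⟨_, _, .copy s r r', by
    have := M.idx_le _ (hs.1 r)
    have := M.idx_le _ (hs.1 r')
    simp only [Meter.unit]; omega, hs.setReg (hs.1 r'), h⟩

theorem runs_const {a : Cell} {z : ℤ} (hz : z.natAbs + 1 ≤ M.H) (h : Q (s.set a (z : K))) :
    Runs M (.const a z) 1 s Q := fun hs => by
  have hz' := (M.ht_int z).trans hz
  refine ⟨_, _, .const s a z, ?_, hs.set hz', h⟩
  have := hs.access_le a hz'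
  simp only [Meter.unit]; omega

theorem runs_move {a b : Cell} (h : Q (s.set a (s.get b))) : Runs M (.move a b) 1 s Q :=
  fun hs => by
  refine ⟨_, _, .move s a b, ?_, hs.set (hs.get b), h⟩
  have := hs.access_le a (hs.get b)
  have := hs.access_le b (hs.get b)
  simp only [Meter.unit]; omega

theorem runs_arith {o : ArithOp} {a b c : Cell} (hx : M.ht (o.eval (s.get b) (s.get c)) ≤ M.H)
    (h : Q (s.set a (o.eval (s.get b) (s.get c)))) : Runs M (.arith o a b c) 1 s Q := fun hs => by
  refine ⟨_, _, .arith s o a b c, ?_, hs.set hx, h⟩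
  have := hs.access_le a hx
  have := hs.access_le b (hs.get b)
  have := hs.access_le c (hs.get c)
  simp only [Meter.unit]; omega

/-- The specification of `q` sits inside the postcondition of `p`, guarded by the frame fact of `p`;
so the proof for `q` may use what `p` establishes as well as what it leaves alone. -/
theorem runs_seq (h : Runs M p N s fun s' => Same p s s' → Runs M q N' s' Q) :
    Runs M (.seq p q) (N + N') s Q := fun hs => by
  obtain ⟨s', t, he, ht, ho, hq⟩ := h hs
  obtain ⟨s'', t', he', ht', ho', hq'⟩ := hq he.same ho
  exact ⟨s'', _, .seq he he', by rw [Nat.add_mul]; omega, ho', hq'⟩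

theorem runs_ifIdx {r r' : ℕ} (hp : s.reg r < s.reg r' → Runs M p N s Q)
    (hq : ¬ s.reg r < s.reg r' → Runs M q N s Q) :
    Runs M (.ifIdx r r' p q) (N + 1) s Q := fun hs => by
  have h1 := M.idx_le _ (hs.1 r)
  have h2 := M.idx_le _ (hs.1 r')
  by_cases h : s.reg r < s.reg r'
  · obtain ⟨s', t, he, ht, ho, hq⟩ := hp h hs
    exact ⟨s', _, .ifIdx_pos h he, by rw [Nat.add_mul]; simp only [Meter.unit] at *; omega, ho, hq⟩
  · obtain ⟨s', t, he, ht, ho, hq⟩ := hq h hs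
    exact ⟨s', _, .ifIdx_neg h he, by rw [Nat.add_mul]; simp only [Meter.unit] at *; omega, ho, hq⟩

theorem runs_ifLe {a b : Cell} (hp : s.get a ≤ s.get b → Runs M p N s Q)
    (hq : ¬ s.get a ≤ s.get b → Runs M q N s Q) :
    Runs M (.ifLe a b p q) (N + 1) s Q := fun hs => by
  have h1 := hs.access_le a (hs.get a)
  have h2 := hs.access_le b (hs.get b)
  by_cases h : s.get a ≤ s.get b
  · obtain ⟨s', t, he, ht, ho, hq⟩ := hp h hs
    exact ⟨s', _, .ifLe_pos h he, by rw [Nat.add_mul]; simp only [Meter.unit] at *; omega, ho, hq⟩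
  · obtain ⟨s', t, he, ht, ho, hq⟩ := hq h hs
    exact ⟨s', _, .ifLe_neg h he, by rw [Nat.add_mul]; simp only [Meter.unit] at *; omega, ho, hq⟩

/-- A loop with the invariant `I`, where `I k` holds at the beginning of round `k`. -/
theorem runs_forLoop {r r' n : ℕ} (I : ℕ → Store K → Prop) (hn : s.reg r' = n)
    (hr : ¬ p.WR r) (hr' : ¬ p.WR r') (hne : r' ≠ r) (h0 : I 0 (s.setReg r 0))
    (hstep : ∀ k < n, ∀ s', Same (.forLoop r r' p) s s' → s'.reg r = k → I k s' →
      Runs M p N s' fun s'' => Same p s' s'' → I (k + 1) (s''.setReg r (k + 1)))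
    (hQ : ∀ s', Same (.forLoop r r' p) s s' → s'.reg r = n → I n s' → Q s') :
    Runs M (.forLoop r r' p) (n * (N + 2) + 2) s Q := by
  -- Induction on the number `j` of remaining rounds. A round costs `N` plus a test and an
  -- increment; the final `1` is the failing test.
  have key : ∀ j k, k + j = n → ∀ s', Same (.forLoop r r' p) s s' → s'.reg r = k → I k s' →
      Runs M (.while r r' (.seq p (.incr r))) (j * (N + 2) + 1) s' Q := by
    intro j
    induction j with
    | zero =>
      intro k hk s' hs hrk hI ho
      have h1 := M.idx_le _ (ho.1 r)
      have h2 := M.idx_le _ (ho.1 r')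
      have hr2 : s'.reg r' = n := by rw [hs.1 r' (by simp [hne, hr']), hn]
      refine ⟨s', _, .while_neg (by omega), ?_, ho, hQ s' hs (by omega) (by simpa [← hk] using hI)⟩
      simp only [Meter.unit]; omega
    | succ j ih =>
      intro k hk s' hs hrk hI ho
      have h1 := M.idx_le _ (ho.1 r)
      have h2 := M.idx_le _ (ho.1 r')
      have hr2 : s'.reg r' = n := by rw [hs.1 r' (by simp [hne, hr']), hn]
      have hnR : n ≤ M.R := hr2 ▸ ho.1 r'
      have hbody : Runs M (.seq p (.incr r)) (N + 1) s' fun s'' =>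
          s''.reg r = k + 1 ∧ I (k + 1) s'' := by
        refine runs_seq ((hstep k (by omega) s' hs hrk hI).mono le_rfl fun s1 h1 h2 _ => ?_)
        have hk1 : s1.reg r = k := by rw [h1.1 r hr, hrk]
        refine runs_incr (by omega) ?_
        rw [hk1]
        exact ⟨by simp [Store.setReg], h2 h1⟩
      obtain ⟨s1, t1, he1, ht1, ho1, hk1, hI1⟩ := hbody ho
      have hs1 : Same (.forLoop r r' p) s s1 := hs.trans (he1.same.mono
        (by simp only [Prog.WR, Prog.WR_forLoop]; tauto)
        (by simp only [Prog.WA, Prog.WA_forLoop]; tauto))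
      obtain ⟨s2, t2, he2, ht2, ho2, hq2⟩ := ih (k + 1) (by omega) s1 hs1 hk1 hI1 ho1
      refine ⟨s2, _, .while_pos (by omega) he1 he2, ?_, ho2, hq2⟩
      calc _ ≤ M.unit + (N + 1) * M.unit + (j * (N + 2) + 1) * M.unit := by
            simp only [Meter.unit] at *; omega
        _ = _ := by ring
  refine (runs_seq (N := 1) (N' := n * (N + 2) + 1) (runs_clear fun hs => ?_)).weaken (by omega)
  exact key n 0 (by omega) _ (hs.mono (by simp) (by simp)) (by simp [Store.setReg]) h0

/-- An unrolled loop with the invariant `I`. -/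
theorem runs_unroll {P : ℕ → Prog} {m : ℕ} (I : ℕ → Store K → Prop) (h0 : I 0 s)
    (hstep : ∀ j < m, ∀ s', Same (.unroll P m) s s' → I j s' →
      Runs M (P j) N s' fun s'' => Same (P j) s' s'' → I (j + 1) s'')
    (hQ : ∀ s', Same (.unroll P m) s s' → I m s' → Q s') :
    Runs M (.unroll P m) (m * N + 1) s Q := by
  have key : ∀ j ≤ m, Runs M (.unroll P j) (j * N + 1) s (I j) := by
    intro j
    induction j with
    | zero => intro _; exact (runs_skip h0).weaken (by omega)
    | succ j ih =>
      intro hj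
      refine (runs_seq ((ih (by omega)).mono le_rfl fun s' hs hI _ => ?_)).weaken
        (N := j * N + 1 + N) (by rw [Nat.succ_mul]; omega)
      refine (hstep j (by omega) s' (hs.mono ?_ ?_) hI).mono le_rfl fun s'' h h' => h' h
      · intro r; simp only [Prog.WR_unroll]; rintro ⟨i, hi, h⟩; exact ⟨i, by omega, h⟩
      · intro r; simp only [Prog.WA_unroll]; rintro ⟨i, hi, h⟩; exact ⟨i, by omega, h⟩
  exact (key m le_rfl).mono le_rfl hQ

theorem runs_load {r k : ℕ} (hk : k ≤ M.R) (h : ∀ s', Same (.load r k) s s' → s'.reg r = k →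
    s'.mem = s.mem → Q s') : Runs M (.load r k) (k + 2) s Q := by
  have : Runs M (.load r k) (1 + (k * 1 + 1)) s fun s' => s'.reg r = k ∧ s'.mem = s.mem := by
    refine runs_seq (runs_clear fun _ => ?_)
    refine runs_unroll (fun j s' => s'.reg r = j ∧ s'.mem = s.mem) (by simp [Store.setReg])
      (fun j hj s' hs hI => runs_incr (by omega) fun _ => ?_) (fun _ _ h => h)
    simp [Store.setReg, hI.1, hI.2]
  exact this.mono (by omega) fun s' hs h1 => h s' hs h1.1 h1.2

end

/-! ### Quantifier-free formulas over an ordered field, and their compilation -/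

/-- Arithmetic terms. -/
inductive Tm (V : Type) where
  | var (v : V)
  | const (z : ℤ)
  | op (o : ArithOp) (a b : Tm V)

/-- Quantifier-free formulas. -/
inductive Fm (V : Type) where
  | le (a b : Tm V)
  | not (φ : Fm V)
  | and (φ ψ : Fm V)

section
variable {V K : Type} [Field K]

def Tm.eval (e : V → K) : Tm V → K
  | .var v => e v
  | .const z => z
  | .op o a b => o.eval (a.eval e) (b.eval e)

def Fm.Holds [LinearOrder K] (e : V → K) : Fm V → Prop
  | .le a b => a.eval e ≤ b.eval e
  | .not φ => ¬ φ.Holds e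
  | .and φ ψ => φ.Holds e ∧ ψ.Holds e

/-- Bounds the evaluation time and also, after multiplication by one more than the height of the
variables, the height of the value. The second use is why a constant does not count as `1`. -/
def Tm.size : Tm V → ℕ
  | .var _ => 1
  | .const z => z.natAbs + 1
  | .op _ a b => a.size + b.size + 1

def Fm.size : Fm V → ℕ
  | .le a b => a.size + b.size + 1
  | .not φ => φ.size
  | .and φ ψ => φ.size + ψ.size

theorem ArithOp.eval_map {L : Type} [Field L] (φ : K →+* L) (o : ArithOp) (x y : K) :
    φ (o.eval x y) = o.eval (φ x) (φ y) := by
  cases o <;> simp [ArithOp.eval]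

theorem Tm.eval_map {L : Type} [Field L] (φ : K →+* L) (e : V → K) (t : Tm V) :
    φ (t.eval e) = t.eval fun v => φ (e v) := by
  induction t with
  | var v => rfl
  | const z => simp [Tm.eval]
  | op o a b iha ihb => simp [Tm.eval, ArithOp.eval_map, iha, ihb]

/-- Field homomorphisms respect all four operations (division by zero included) and integer
constants, and strict monotonicity respects comparisons. This is how a formula about real points is
decided on rational data. -/
theorem Fm.holds_map [LinearOrder K] {L : Type} [Field L] [LinearOrder L] (φ : K →+* L)
    (hφ : StrictMono φ) (e : V → K) (ψ : Fm V) :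
    (ψ.Holds fun v => φ (e v)) ↔ ψ.Holds e := by
  induction ψ with
  | le a b => simp [Fm.Holds, ← Tm.eval_map, hφ.le_iff_le]
  | not ψ ih => simp [Fm.Holds, ih]
  | and ψ χ ih ih' => simp [Fm.Holds, ih, ih']

end

/-- The scalar with number `v`. -/
def varCell (v : ℕ) : Cell := ⟨8 * v + 7, 3, 3⟩

/-- The auxiliary scalar with number `a`. -/
def tmpCell (a : ℕ) : Cell := ⟨8 * a + 8, 3, 3⟩

section
variable {V : Type}

/-- Evaluates a term into the auxiliary scalar with number `a`. -/
def Tm.compile (enc : V → ℕ) : Tm V → ℕ → Prog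
  | .var v, a => .move (tmpCell a) (varCell (enc v))
  | .const z, a => .const (tmpCell a) z
  | .op o x y, a =>
    .seq (x.compile enc a)
      (.seq (y.compile enc (a + 1)) (.arith o (tmpCell a) (tmpCell a) (tmpCell (a + 1))))

/-- If the formula holds then `p` else `q`. -/
def Fm.compile (enc : V → ℕ) : Fm V → Prog → Prog → Prog
  | .le x y, p, q =>
    .seq (x.compile enc 0) (.seq (y.compile enc 1) (.ifLe (tmpCell 0) (tmpCell 1) p q))
  | .not φ, p, q => φ.compile enc q p
  | .and φ ψ, p, q => φ.compile enc (ψ.compile enc p q) q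

theorem Tm.not_WR_compile {enc : V → ℕ} (t : Tm V) {a x : ℕ} : ¬ (t.compile enc a).WR x := by
  induction t generalizing a <;> simp_all [Tm.compile]

/-- The auxiliary scalars form a stack: evaluation at level `a` leaves lower levels alone, so the
first operand survives the evaluation of the second at level `a + 1`. -/
theorem Tm.WA_compile {enc : V → ℕ} (t : Tm V) {a x : ℕ} (h : (t.compile enc a).WA x) :
    ∃ b, a ≤ b ∧ x = 8 * b + 8 := by
  induction t generalizing a with
  | var v => exact ⟨a, le_rfl, h⟩
  | const z => exact ⟨a, le_rfl, h⟩
  | op o p q ihp ihq =>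
    rcases h with h | h | h
    · exact ihp h
    · obtain ⟨b, hb, rfl⟩ := ihq h
      exact ⟨b, by omega, rfl⟩
    · exact ⟨a, le_rfl, h⟩

theorem Fm.WR_compile {enc : V → ℕ} (φ : Fm V) {p q : Prog} {x : ℕ}
    (h : (φ.compile enc p q).WR x) : p.WR x ∨ q.WR x := by
  induction φ generalizing p q with
  | le a b => simpa [Fm.compile, Tm.not_WR_compile] using h
  | not φ ih => exact (ih h).symm
  | and φ ψ ih ih' => rcases ih h with h | h; exacts [ih' h, Or.inr h]

theorem Fm.WA_compile {enc : V → ℕ} (φ : Fm V) {p q : Prog} {x : ℕ}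
    (h : (φ.compile enc p q).WA x) : (∃ b, x = 8 * b + 8) ∨ p.WA x ∨ q.WA x := by
  induction φ generalizing p q with
  | le a b =>
    rcases h with h | h | h
    · obtain ⟨c, -, h⟩ := a.WA_compile h; exact Or.inl ⟨c, h⟩
    · obtain ⟨c, -, h⟩ := b.WA_compile h; exact Or.inl ⟨c, h⟩
    · exact Or.inr h
  | not φ ih => exact (ih h).imp_right Or.symm
  | and φ ψ ih ih' =>
    rcases ih h with h | h | h
    · exact Or.inl h
    · exact ih' h
    · exact Or.inr (Or.inr h)

end

/-! ### Correctness, time and heights for compiled formulas -/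

section
variable {V K : Type}

/-- The scalars hold the values `e`. -/
def HasEnv (enc : V → ℕ) (e : V → K) (s : Store K) : Prop :=
  s.reg 3 = 0 ∧ ∀ v, s.mem (8 * enc v + 7) 0 0 = e v

/-- The stores agree up to the auxiliary scalars. -/
def TmpSame (s s' : Store K) : Prop :=
  s'.reg = s.reg ∧ ∀ a, (∀ b, a ≠ 8 * b + 8) → s'.mem a = s.mem a

theorem TmpSame.trans {s s' s'' : Store K} (h : TmpSame s s') (h' : TmpSame s' s'') :
    TmpSame s s'' :=
  ⟨h'.1.trans h.1, fun a ha => (h'.2 a ha).trans (h.2 a ha)⟩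

theorem Same.tmpSame {enc : V → ℕ} {t : Tm V} {a : ℕ} {s s' : Store K}
    (h : Same (t.compile enc a) s s') : TmpSame s s' :=
  ⟨funext fun r => h.1 r t.not_WR_compile, fun x hx => h.2 x fun hw => by
    obtain ⟨b, -, hb⟩ := t.WA_compile hw
    exact hx b hb⟩

theorem HasEnv.of_tmpSame {enc : V → ℕ} {e : V → K} {s s' : Store K} (h : HasEnv enc e s)
    (hs : TmpSame s s') : HasEnv enc e s' :=
  ⟨by rw [hs.1]; exact h.1, fun v => by rw [hs.2 _ (by omega)]; exact h.2 v⟩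

/-- Heights at most add up, plus one, at every operation, so they grow linearly with the size of the
term. -/
theorem Tm.ht_eval_le [Field K] {M : Meter K} {e : V → K} {h : ℕ} (he : ∀ v, M.ht (e v) ≤ h) (t : Tm V) :
    M.ht (t.eval e) ≤ t.size * (h + 1) := by
  induction t with
  | var v => have := he v; simp only [Tm.eval, Tm.size]; omega
  | const z =>
    calc _ ≤ z.natAbs + 1 := M.ht_int z
      _ ≤ _ := Nat.le_mul_of_pos_right _ (by omega)
  | op o a b iha ihb =>
    have := M.ht_op o (a.eval e) (b.eval e)
    simp only [Tm.eval, Tm.size, Nat.add_mul]; omega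

variable [Field K] [LinearOrder K] {M : Meter K}

theorem Tm.runs_compile {enc : V → ℕ} {e : V → K} {h : ℕ} (he : ∀ v, M.ht (e v) ≤ h) (t : Tm V)
    (hH : t.size * (h + 1) ≤ M.H) (a : ℕ) {s : Store K} (hs : HasEnv enc e s) :
    Runs M (t.compile enc a) t.size s fun s' => s'.mem (8 * a + 8) 0 0 = t.eval e := by
  induction t generalizing a s with
  | var v =>
    exact runs_move (by simp [Store.set, Store.get, tmpCell, varCell, hs.1, hs.2, Tm.eval])
  | const z =>
    refine (runs_const (le_trans ?_ hH) (by simp [Store.set, tmpCell, hs.1, Tm.eval])).weaken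
      (by simp [Tm.size])
    exact Nat.le_mul_of_pos_right _ (by omega)
  | op o x y ihx ihy =>
    have hH' := hH
    simp only [Tm.size, Nat.add_mul] at hH'
    refine (runs_seq ((ihx (by omega) a hs).mono le_rfl fun s1 hs1 h1 _ => ?_)).weaken
      (N := x.size + (y.size + 1)) (by simp only [Tm.size]; omega)
    have henv := hs.of_tmpSame hs1.tmpSame
    refine runs_seq ((ihy (by omega) (a + 1) henv).mono le_rfl fun s2 hs2 h2 _ => ?_)
    have h1' : s2.mem (8 * a + 8) 0 0 = x.eval e := by
      rw [hs2.2 _ fun hw => ?_, h1]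
      obtain ⟨b, hb, hb'⟩ := y.WA_compile hw
      omega
    have h3 := (henv.of_tmpSame hs2.tmpSame).1
    have hv : o.eval (s2.get (tmpCell a)) (s2.get (tmpCell (a + 1))) = (Tm.op o x y).eval e := by
      simp [Store.get, tmpCell, h3, h1', h2, Tm.eval]
    refine runs_arith (by rw [hv]; exact (Tm.ht_eval_le he _).trans hH) ?_
    rw [hv]
    simp [Store.set, tmpCell, h3]

/-- Negation swaps the branches and costs nothing; conjunction nests the tests, and a failed first
test leads straight to `q`. Only scratch scalars change before a branch is entered. -/
theorem Fm.runs_compile {enc : V → ℕ} {e : V → K} {h : ℕ} (he : ∀ v, M.ht (e v) ≤ h) (φ : Fm V)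
    (hH : φ.size * (h + 1) ≤ M.H) {s : Store K} (hs : HasEnv enc e s) {p q : Prog} {N : ℕ}
    {Q : Store K → Prop} (hp : φ.Holds e → ∀ s', TmpSame s s' → Runs M p N s' Q)
    (hq : ¬ φ.Holds e → ∀ s', TmpSame s s' → Runs M q N s' Q) :
    Runs M (φ.compile enc p q) (φ.size + N) s Q := by
  induction φ generalizing s p q N with
  | le x y =>
    have hH' := hH
    simp only [Fm.size, Nat.add_mul] at hH'
    refine (runs_seq ((x.runs_compile he (by omega) 0 hs).mono le_rfl fun s1 hs1 h1 _ => ?_)).weaken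
      (N := x.size + (y.size + (N + 1))) (by simp only [Fm.size]; omega)
    have henv := hs.of_tmpSame hs1.tmpSame
    refine runs_seq ((y.runs_compile he (by omega) 1 henv).mono le_rfl fun s2 hs2 h2 _ => ?_)
    have h1' : s2.mem 8 0 0 = x.eval e := by
      rw [hs2.2 _ fun hw => ?_]
      · simpa using h1
      obtain ⟨b, hb, hb'⟩ := y.WA_compile hw
      omega
    have h3 := (henv.of_tmpSame hs2.tmpSame).1
    have hx : s2.get (tmpCell 0) = x.eval e := by simpa [Store.get, tmpCell, h3] using h1'
    have hy : s2.get (tmpCell 1) = y.eval e := by simpa [Store.get, tmpCell, h3] using h2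
    have hsame := hs1.tmpSame.trans hs2.tmpSame
    refine runs_ifLe (fun h => hp ?_ s2 hsame) (fun h => hq ?_ s2 hsame)
    · rwa [hx, hy] at h
    · rwa [hx, hy] at h
  | not φ ih => exact ih hH hs (fun h => hq (not_not.2 h)) fun h => hp h
  | and φ ψ ih ih' =>
    have hH' := hH
    simp only [Fm.size, Nat.add_mul] at hH'
    refine (ih (N := ψ.size + N) (by omega) hs (fun h1 s1 hs1 => ?_) (fun h1 s1 hs1 => ?_)).weaken
      (by simp only [Fm.size]; omega)
    · exact ih' (by omega) (hs.of_tmpSame hs1) (fun h2 s2 hs2 => hp ⟨h1, h2⟩ s2 (hs1.trans hs2))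
        (fun h2 s2 hs2 => hq (fun h => h2 h.2) s2 (hs1.trans hs2))
    · exact (hq (fun h => h1 h.1) s1 hs1).weaken (by omega)

end

/-! ### Definable functions and predicates -/

/-- The function is given by a term. -/
def DefT {V : Type} (f : (V → ℝ) → ℝ) : Prop := ∃ t : Tm V, ∀ e, t.eval e = f e

/-- The predicate is given by a quantifier-free formula. -/
def DefP {V : Type} (P : (V → ℝ) → Prop) : Prop := ∃ φ : Fm V, ∀ e, φ.Holds e ↔ P e

section
variable {V : Type} {f g : (V → ℝ) → ℝ} {P Q : (V → ℝ) → Prop}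

theorem DefT.var (v : V) : DefT fun e => e v := ⟨.var v, fun _ => rfl⟩

theorem DefT.int (z : ℤ) : DefT fun _ : V → ℝ => (z : ℝ) := ⟨.const z, fun _ => rfl⟩

theorem DefT.nat (k : ℕ) : DefT fun _ : V → ℝ => (k : ℝ) := by simpa using DefT.int (V := V) k

theorem DefT.zero : DefT fun _ : V → ℝ => (0 : ℝ) := by simpa using DefT.int (V := V) 0

theorem DefT.one : DefT fun _ : V → ℝ => (1 : ℝ) := by simpa using DefT.int (V := V) 1

theorem DefT.op (o : ArithOp) (hf : DefT f) (hg : DefT g) : DefT fun e => o.eval (f e) (g e) := by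
  obtain ⟨t, ht⟩ := hf
  obtain ⟨u, hu⟩ := hg
  exact ⟨.op o t u, fun e => by simp [Tm.eval, ht, hu]⟩

theorem DefT.add (hf : DefT f) (hg : DefT g) : DefT fun e => f e + g e := DefT.op .add hf hg
theorem DefT.sub (hf : DefT f) (hg : DefT g) : DefT fun e => f e - g e := DefT.op .sub hf hg
theorem DefT.mul (hf : DefT f) (hg : DefT g) : DefT fun e => f e * g e := DefT.op .mul hf hg
theorem DefT.div (hf : DefT f) (hg : DefT g) : DefT fun e => f e / g e := DefT.op .div hf hg

theorem DefT.sum {ι : Type} (s : Finset ι) {F : ι → (V → ℝ) → ℝ} (h : ∀ i ∈ s, DefT (F i)) :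
    DefT fun e => ∑ i ∈ s, F i e := by
  classical
  induction s using Finset.induction_on with
  | empty => simpa using DefT.zero
  | insert a s ha ih =>
    simp only [Finset.sum_insert ha]
    exact (h a (by simp)).add (ih fun i hi => h i (by simp [hi]))

theorem DefT.prod {ι : Type} (s : Finset ι) {F : ι → (V → ℝ) → ℝ} (h : ∀ i ∈ s, DefT (F i)) :
    DefT fun e => ∏ i ∈ s, F i e := by
  classical
  induction s using Finset.induction_on with
  | empty => simpa using DefT.one
  | insert a s ha ih =>
    simp only [Finset.prod_insert ha]
    exact (h a (by simp)).mul (ih fun i hi => h i (by simp [hi]))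

/-- The Leibniz expansion. Its factorial length is harmless because the index type is fixed before
the data. -/
theorem DefT.det {ι : Type} [Fintype ι] [DecidableEq ι] {A : (V → ℝ) → Matrix ι ι ℝ}
    (h : ∀ i j, DefT fun e => A e i j) : DefT fun e => (A e).det := by
  simp only [Matrix.det_apply']
  exact DefT.sum _ fun σ _ => (DefT.int _).mul (DefT.prod _ fun i _ => h _ _)

theorem DefP.le (hf : DefT f) (hg : DefT g) : DefP fun e => f e ≤ g e := by
  obtain ⟨t, ht⟩ := hf
  obtain ⟨u, hu⟩ := hg
  exact ⟨.le t u, fun e => by simp [Fm.Holds, ht, hu]⟩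

theorem DefP.not (hP : DefP P) : DefP fun e => ¬ P e := by
  obtain ⟨φ, h⟩ := hP
  exact ⟨.not φ, fun e => by simp [Fm.Holds, h]⟩

theorem DefP.and (hP : DefP P) (hQ : DefP Q) : DefP fun e => P e ∧ Q e := by
  obtain ⟨φ, h⟩ := hP
  obtain ⟨ψ, h'⟩ := hQ
  exact ⟨.and φ ψ, fun e => by simp [Fm.Holds, h, h']⟩

theorem DefP.imp (hP : DefP P) (hQ : DefP Q) : DefP fun e => P e → Q e := by
  simpa using (hP.and hQ.not).not

theorem DefP.eq (hf : DefT f) (hg : DefT g) : DefP fun e => f e = g e := by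
  simpa [le_antisymm_iff] using (DefP.le hf hg).and (DefP.le hg hf)

theorem DefP.true : DefP fun _ : V → ℝ => True := by
  simpa using DefP.le (DefT.zero (V := V)) DefT.zero

theorem DefP.forall_mem {ι : Type} (s : Finset ι) {R : ι → (V → ℝ) → Prop}
    (h : ∀ i ∈ s, DefP (R i)) : DefP fun e => ∀ i ∈ s, R i e := by
  classical
  induction s using Finset.induction_on with
  | empty => simpa using DefP.true
  | insert a s ha ih =>
    simpa using (h a (by simp)).and (ih fun i hi => h i (by simp [hi]))

theorem DefP.forall {ι : Type} [Fintype ι] {R : ι → (V → ℝ) → Prop}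
    (h : ∀ i, DefP (R i)) : DefP fun e => ∀ i, R i e := by
  simpa using DefP.forall_mem Finset.univ fun i _ => h i

theorem DefP.exists {ι : Type} [Fintype ι] {R : ι → (V → ℝ) → Prop}
    (h : ∀ i, DefP (R i)) : DefP fun e => ∃ i, R i e := by
  simpa using (DefP.forall fun i => (h i).not).not

end

/-! ### Feasibility of systems of linear inequalities with a norm bound -/

section
variable {ι : Type} [Fintype ι] {E : Type} [NormedAddCommGroup E] [InnerProductSpace ℝ E]

open scoped RealInnerProductSpace

/-- Expresses a norm through coefficients and Gram entries alone, so that a term can compute it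
without access to the ambient space. -/
theorem norm_sum_smul_sq (a : ι → E) (c : ι → ℝ) :
    ‖∑ i, c i • a i‖ ^ 2 = ∑ i, ∑ j, c i * (c j * ⟪a i, a j⟫) := by
  rw [← real_inner_self_eq_norm_sq, sum_inner]
  refine Finset.sum_congr rfl fun i _ => ?_
  rw [inner_sum]
  exact Finset.sum_congr rfl fun j _ => by rw [real_inner_smul_left, real_inner_smul_right]

/-- A small move along a direction orthogonal to the active constraints preserves all of them. -/
theorem exists_small_move (a : ι → E) (γ : ι → ℝ) {z u : E} (hz : ∀ j, ⟪a j, z⟫ ≤ γ j)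
    (hu : ∀ j, ⟪a j, z⟫ = γ j → ⟪a j, u⟫ = 0) :
    ∃ δ > 0, ∀ t : ℝ, |t| ≤ δ → ∀ j, ⟪a j, z + t • u⟫ ≤ γ j := by
  have h : ∀ j, ∃ δ > 0, ∀ t : ℝ, |t| ≤ δ → ⟪a j, z + t • u⟫ ≤ γ j := by
    intro j
    by_cases hj : ⟪a j, z⟫ = γ j
    · exact ⟨1, one_pos, fun t _ => by
        rw [inner_add_right, real_inner_smul_right, hu j hj, mul_zero, add_zero]; exact hz j⟩
    · have hlt : 0 < γ j - ⟪a j, z⟫ := sub_pos.2 (lt_of_le_of_ne (hz j) hj)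
      -- An inactive constraint tolerates a step up to its slack over the rate of change; the added
      -- `1` keeps the denominator positive.
      refine ⟨(γ j - ⟪a j, z⟫) / (|⟪a j, u⟫| + 1), by positivity, fun t ht => ?_⟩
      rw [le_div_iff₀ (by positivity)] at ht
      rw [inner_add_right, real_inner_smul_right]
      have h1 := le_abs_self (t * ⟪a j, u⟫)
      rw [abs_mul] at h1
      nlinarith [abs_nonneg t]
  choose δ hδ h using h
  by_cases hne : Nonempty ι
  · obtain ⟨i, -, hi⟩ := Finset.exists_min_image Finset.univ δ Finset.univ_nonempty
    exact ⟨δ i, hδ i, fun t ht j => h j t (ht.trans (hi j (Finset.mem_univ j)))⟩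
  · exact ⟨1, one_pos, fun t _ j => (hne ⟨j⟩).elim⟩

end

/-! ### Gram systems, Cramer's rule and points of least norm -/

section
variable {ι : Type} [Fintype ι] [DecidableEq ι]

/-- The submatrix on `T`, padded by an identity matrix. -/
def padMat (G : ι → ι → ℝ) (T : Finset ι) : Matrix ι ι ℝ :=
  Matrix.of fun i j => if i ∈ T ∧ j ∈ T then G i j else if i = j then 1 else 0

def padVec (γ : ι → ℝ) (T : Finset ι) : ι → ℝ := fun i => if i ∈ T then γ i else 0

/-- The solution of the linear system on `T` by Cramer's rule. -/
noncomputable def cramerSol (G : ι → ι → ℝ) (γ : ι → ℝ) (T : Finset ι) (i : ι) : ℝ :=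
  ((padMat G T).updateCol i (padVec γ T)).det / (padMat G T).det

theorem padMat_mulVec (G : ι → ι → ℝ) (T : Finset ι) (x : ι → ℝ) (i : ι) :
    (padMat G T).mulVec x i = if i ∈ T then ∑ j ∈ T, G i j * x j else x i := by
  simp only [Matrix.mulVec, dotProduct, padMat, Matrix.of_apply]
  split_ifs with h
  · rw [← Finset.sum_subset (Finset.subset_univ T)]
    · exact Finset.sum_congr rfl fun j hj => by simp [h, hj]
    · intro j _ hj
      have : i ≠ j := fun hij => hj (hij ▸ h)
      simp [hj, this]
  · simp [h]

/-- The identity padding forces zeros outside `T`, so `x` solves the full padded system, which has a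
unique solution. Padding keeps all determinants on one index type. -/
theorem eq_cramerSol {G : ι → ι → ℝ} {γ : ι → ℝ} {T : Finset ι} (hT : (padMat G T).det ≠ 0)
    {x : ι → ℝ} (hx : ∀ i ∈ T, ∑ j ∈ T, G i j * x j = γ i) (hx0 : ∀ i ∉ T, x i = 0) :
    x = cramerSol G γ T := by
  have h1 : (padMat G T).mulVec x = padVec γ T := by
    funext i
    rw [padMat_mulVec, padVec]
    split_ifs with h
    · exact hx i h
    · exact hx0 i h
  have h2 := Matrix.mulVec_cramer (padMat G T) (padVec γ T)
  have h3 : (padMat G T).mulVec ((padMat G T).det • x - (padMat G T).cramer (padVec γ T)) = 0 := by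
    rw [Matrix.mulVec_sub, Matrix.mulVec_smul, h1, h2, sub_self]
  have h4 := Matrix.eq_zero_of_mulVec_eq_zero hT h3
  funext i
  have h5 := congrFun h4 i
  simp only [Pi.sub_apply, Pi.smul_apply, smul_eq_mul, Pi.zero_apply, Matrix.cramer_apply] at h5
  rw [cramerSol, eq_div_iff hT]
  linarith

variable {E : Type} [NormedAddCommGroup E] [InnerProductSpace ℝ E]

open scoped RealInnerProductSpace

/-- A maximal independent subfamily of the vectors in `S` still spans `y`. The prescribed inner
products then form a linear system for the coefficients of `y` whose matrix is an invertible Gram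
matrix. -/
theorem exists_cramerSol (a : ι → E) (γ : ι → ℝ) {S : Set ι} {y : E}
    (hy : y ∈ Submodule.span ℝ (a '' S)) (hγ : ∀ i ∈ S, ⟪a i, y⟫ = γ i) :
    ∃ T : Finset ι, (padMat (fun i j => ⟪a i, a j⟫) T).det ≠ 0 ∧
      y = ∑ i, cramerSol (fun i j => ⟪a i, a j⟫) γ T i • a i := by
  classical
  obtain ⟨b, hbS, -, hb, hli⟩ := exists_linearIndepOn_extension (K := ℝ) (v := a)
    (linearIndepOn_empty ℝ a) (Set.empty_subset S)
  have hli' : LinearIndepOn ℝ a (b.toFinset : Set ι) := by simpa using hli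
  rw [linearIndepOn_finset_iff] at hli'
  -- A kernel vector of the Gram matrix yields a combination orthogonal to each of its own
  -- generators, hence to itself; it vanishes, and independence kills the coefficients.
  have hdet : (padMat (fun i j => ⟪a i, a j⟫) b.toFinset).det ≠ 0 := by
    intro h0
    obtain ⟨x, hx, hx0⟩ := Matrix.exists_mulVec_eq_zero_iff.2 h0
    have h1 : ∀ i ∉ b.toFinset, x i = 0 := fun i hi => by
      have := congrFun hx0 i
      rwa [padMat_mulVec, if_neg hi] at this
    have h2 : ∀ i ∈ b.toFinset, ⟪a i, ∑ j ∈ b.toFinset, x j • a j⟫ = 0 := fun i hi => by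
      have := congrFun hx0 i
      rw [padMat_mulVec, if_pos hi] at this
      simpa [inner_sum, inner_smul_right, mul_comm] using this
    have h3 : ∑ j ∈ b.toFinset, x j • a j = 0 := by
      rw [← inner_self_eq_zero (𝕜 := ℝ), sum_inner]
      exact Finset.sum_eq_zero fun i hi => by rw [inner_smul_left, h2 i hi, mul_zero]
    refine hx (funext fun i => ?_)
    by_cases hi : i ∈ b.toFinset
    · exact hli' x h3 i hi
    · exact h1 i hi
  have hyb : y ∈ Submodule.span ℝ (a '' (b.toFinset : Set ι)) := by
    rw [Set.coe_toFinset]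
    exact Submodule.span_le.2 hb hy
  obtain ⟨c, rfl⟩ := (Submodule.mem_span_image_finset_iff_exists_fun' ℝ).1 hyb
  refine ⟨b.toFinset, hdet, ?_⟩
  -- The coefficients of `y`, extended by zero, solve the padded system.
  have key := eq_cramerSol (γ := γ) hdet (x := fun i => if i ∈ b.toFinset then c i else 0)
    (fun i hi => ?_) (fun i hi => by simp only [if_neg hi])
  · rw [← key, ← Finset.sum_subset (Finset.subset_univ b.toFinset)]
    · exact Finset.sum_congr rfl fun i hi => by simp only [if_pos hi]
    · intro i _ hi
      simp only [if_neg hi, zero_smul]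
  · rw [← hγ i (hbS (by simpa using hi)), inner_sum]
    exact Finset.sum_congr rfl fun j hj => by simp only [if_pos hj, inner_smul_right, mul_comm]

/-- The point given by Cramer's rule on `T` has squared norm at most `r` and satisfies all the
linear inequalities. -/
def CoreAt (G : ι → ι → ℝ) (γ : ι → ℝ) (r : ℝ) (T : Finset ι) : Prop :=
  (padMat G T).det ≠ 0 ∧
    ∑ i, ∑ j, cramerSol G γ T i * (cramerSol G γ T j * G i j) ≤ r ∧
    ∀ j, ∑ i, cramerSol G γ T i * G j i ≤ γ j

/-- The polyhedron is closed, so it has a point nearest to the origin, and a point within the norm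
bound exists iff this one qualifies. Its position in the span of the active normals makes it a
Cramer solution. -/
theorem exists_le_iff_exists_coreAt [FiniteDimensional ℝ E] (a : ι → E) (γ : ι → ℝ) (r : ℝ) :
    (∃ z : E, ‖z‖ ^ 2 ≤ r ∧ ∀ j, ⟪a j, z⟫ ≤ γ j) ↔
      ∃ T : Finset ι, CoreAt (fun i j => ⟪a i, a j⟫) γ r T := by
  constructor
  · rintro ⟨z₀, hz₀, hz₀'⟩
    have hclosed : IsClosed {z : E | ∀ j, ⟪a j, z⟫ ≤ γ j} := by
      simp only [Set.ofPred_forall]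
      exact isClosed_iInter fun j => isClosed_le (by fun_prop) continuous_const
    have : ProperSpace E := FiniteDimensional.proper_real E
    obtain ⟨y, hy, hmin⟩ := hclosed.exists_infDist_eq_dist ⟨z₀, hz₀'⟩ 0
    have hmin' : ∀ z : E, (∀ j, ⟪a j, z⟫ ≤ γ j) → ‖y‖ ≤ ‖z‖ := fun z hz => by
      have := Metric.infDist_le_dist_of_mem (x := (0 : E)) (s := {z : E | ∀ j, ⟪a j, z⟫ ≤ γ j}) hz
      rwa [hmin, dist_zero_left, dist_zero_left] at this
    set S : Set ι := {j | ⟪a j, y⟫ = γ j}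
    -- By double orthogonality it suffices that `y` is orthogonal to every `u` orthogonal to the
    -- active normals. Both small moves along `u` stay feasible, so neither may decrease the norm.
    have hspan : y ∈ Submodule.span ℝ (a '' S) := by
      rw [← Submodule.orthogonal_orthogonal (Submodule.span ℝ (a '' S)),
        Submodule.mem_orthogonal']
      intro u hu
      rw [Submodule.mem_orthogonal] at hu
      obtain ⟨δ, hδ, hmove⟩ := exists_small_move a γ hy (u := u) fun j hj =>
        hu _ (Submodule.subset_span ⟨j, hj, rfl⟩)
      have hq : ∀ t : ℝ, |t| ≤ δ → 0 ≤ 2 * t * ⟪y, u⟫ + t ^ 2 * ‖u‖ ^ 2 := fun t ht => by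
        have h1 := hmin' _ (hmove t ht)
        have h2 : ‖y‖ ^ 2 ≤ ‖y + t • u‖ ^ 2 := by gcongr
        rw [norm_add_sq_real, real_inner_smul_right, norm_smul, mul_pow, Real.norm_eq_abs,
          sq_abs] at h2
        linarith
      by_contra hne
      set p := ⟪y, u⟫
      rcases lt_or_gt_of_ne hne with hp | hp
      -- Below this threshold the quadratic term `t² ‖u‖²` is too small to outweigh the linear term
      -- `2 t p`.
      · set t := min δ (-p / (‖u‖ ^ 2 + 1))
        have ht : 0 < t := lt_min hδ (div_pos (by linarith) (by positivity))
        have ht1 : t ≤ δ := min_le_left _ _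
        have ht2 : t * (‖u‖ ^ 2 + 1) ≤ -p := by
          rw [← le_div_iff₀ (by positivity)]; exact min_le_right _ _
        have := hq t (by rwa [abs_of_pos ht])
        nlinarith [mul_pos ht ht]
      · set t := min δ (p / (‖u‖ ^ 2 + 1))
        have ht : 0 < t := lt_min hδ (div_pos (by linarith) (by positivity))
        have ht1 : t ≤ δ := min_le_left _ _
        have ht2 : t * (‖u‖ ^ 2 + 1) ≤ p := by
          rw [← le_div_iff₀ (by positivity)]; exact min_le_right _ _
        have := hq (-t) (by rwa [abs_neg, abs_of_pos ht])
        nlinarith [mul_pos ht ht]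
    obtain ⟨T, hT, hyT⟩ := exists_cramerSol a γ hspan fun i hi => hi
    refine ⟨T, hT, ?_, fun j => ?_⟩
    · rw [← norm_sum_smul_sq, ← hyT]
      exact le_trans (by gcongr; exact hmin' z₀ hz₀') hz₀
    · have := hy j
      rw [hyT, inner_sum] at this
      simpa only [real_inner_smul_right] using this
  -- The converse is direct: the combination with these coefficients passes exactly the required
  -- tests.
  · rintro ⟨T, -, h1, h2⟩
    refine ⟨∑ i, cramerSol (fun i j => ⟪a i, a j⟫) γ T i • a i, ?_, fun j => ?_⟩
    · rwa [norm_sum_smul_sq]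
    · rw [inner_sum]
      simpa only [real_inner_smul_right] using h2 j

theorem DefT.cramerSol {V : Type} {G : (V → ℝ) → ι → ι → ℝ} {γ : (V → ℝ) → ι → ℝ}
    (hG : ∀ i j, DefT fun e => G e i j) (hγ : ∀ i, DefT fun e => γ e i) (T : Finset ι) (i : ι) :
    DefT fun e => RVPM.cramerSol (G e) (γ e) T i := by
  have h1 : ∀ i j, DefT fun e => padMat (G e) T i j := fun i j => by
    simp only [padMat, Matrix.of_apply]
    split_ifs
    exacts [hG i j, DefT.one, DefT.zero]
  refine DefT.div (DefT.det fun k l => ?_) (DefT.det h1)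
  simp only [Matrix.updateCol_apply, padVec]
  split_ifs
  exacts [hγ k, DefT.zero, h1 k l]

theorem DefP.padMat_det_ne {V : Type} {G : (V → ℝ) → ι → ι → ℝ}
    (hG : ∀ i j, DefT fun e => G e i j) (T : Finset ι) : DefP fun e => (padMat (G e) T).det ≠ 0 := by
  refine (DefP.eq (DefT.det fun i j => ?_) DefT.zero).not
  simp only [padMat, Matrix.of_apply]
  split_ifs
  exacts [hG i j, DefT.one, DefT.zero]

theorem DefP.coreAt {V : Type} {G : (V → ℝ) → ι → ι → ℝ} {γ : (V → ℝ) → ι → ℝ} {r : (V → ℝ) → ℝ}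
    (hG : ∀ i j, DefT fun e => G e i j) (hγ : ∀ i, DefT fun e => γ e i) (hr : DefT r)
    (T : Finset ι) : DefP fun e => CoreAt (G e) (γ e) (r e) T := by
  have hc := fun i => DefT.cramerSol hG hγ T i
  refine (DefP.padMat_det_ne hG T).and (DefP.and ?_ ?_)
  · exact DefP.le (DefT.sum _ fun i _ => DefT.sum _ fun j _ =>
      (hc i).mul ((hc j).mul (hG i j))) hr
  · exact DefP.forall fun j => DefP.le (DefT.sum _ fun i _ => (hc i).mul (hG j i)) (hγ j)

end

open scoped RealInnerProductSpace

/-! ### Vertices of polytopes -/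

section
variable {ι : Type} [Fintype ι] [DecidableEq ι] {E : Type} [NormedAddCommGroup E]
  [InnerProductSpace ℝ E]

/-- A function that does not decrease along one of any two opposite rays takes a nonnegative value
at a vertex of a polytope if it takes one anywhere in it. -/
theorem exists_vertex [FiniteDimensional ℝ E] (a : ι → E) (γ : ι → ℝ)
    (hpos : ∀ u, u ≠ 0 → ∃ j, 0 < ⟪a j, u⟫) (g : E → ℝ)
    (hg : ∀ z u, (∀ t ≥ (0 : ℝ), g z ≤ g (z + t • u)) ∨ ∀ t ≥ (0 : ℝ), g z ≤ g (z + t • -u))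
    {z₀ : E} (hz₀ : ∀ j, ⟪a j, z₀⟫ ≤ γ j) (hg₀ : 0 ≤ g z₀) :
    ∃ T : Finset ι, (padMat (fun i j => ⟪a i, a j⟫) T).det ≠ 0 ∧
      (∀ j, ⟪a j, ∑ i, cramerSol (fun i j => ⟪a i, a j⟫) γ T i • a i⟫ ≤ γ j) ∧
      0 ≤ g (∑ i, cramerSol (fun i j => ⟪a i, a j⟫) γ T i • a i) := by
  classical
  set act : E → Finset ι := fun z => Finset.univ.filter fun j => ⟪a j, z⟫ = γ j with hact
  -- Induction on the number of inactive constraints. While some direction is orthogonal to all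
  -- active normals, follow it, with the sign for which `g` does not decrease, until another
  -- constraint becomes active.
  have key : ∀ k z, Fintype.card ι - (act z).card = k → (∀ j, ⟪a j, z⟫ ≤ γ j) → 0 ≤ g z →
      ∃ y, (∀ j, ⟪a j, y⟫ ≤ γ j) ∧ 0 ≤ g y ∧
        ∀ u, (∀ j, ⟪a j, y⟫ = γ j → ⟪a j, u⟫ = 0) → u = 0 := by
    intro k
    induction k using Nat.strong_induction_on with
    | _ k ih =>
      intro z hk hz hgz
      by_cases h : ∀ u, (∀ j, ⟪a j, z⟫ = γ j → ⟪a j, u⟫ = 0) → u = 0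
      · exact ⟨z, hz, hgz, h⟩
      push Not at h
      obtain ⟨u, hu, hu0⟩ := h
      obtain ⟨u, hu, hu0, hgu⟩ : ∃ u, (∀ j, ⟪a j, z⟫ = γ j → ⟪a j, u⟫ = 0) ∧ u ≠ 0 ∧
          ∀ t ≥ (0 : ℝ), g z ≤ g (z + t • u) := by
        rcases hg z u with h | h
        · exact ⟨u, hu, hu0, h⟩
        · exact ⟨-u, fun j hj => by rw [inner_neg_right, hu j hj, neg_zero], neg_ne_zero.2 hu0, h⟩
      -- Boundedness: some constraint increases along `u`, so the ratio test below has a candidate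
      -- and the ray is stopped.
      obtain ⟨j₀, hj₀⟩ := hpos u hu0
      obtain ⟨i, hi, hmin⟩ := Finset.exists_min_image (Finset.univ.filter fun j => 0 < ⟪a j, u⟫)
        (fun j => (γ j - ⟪a j, z⟫) / ⟪a j, u⟫) ⟨j₀, by simpa using hj₀⟩
      have hi' : 0 < ⟪a i, u⟫ := by simpa using hi
      set t := (γ i - ⟪a i, z⟫) / ⟪a i, u⟫
      have ht : 0 ≤ t := div_nonneg (sub_nonneg.2 (hz i)) hi'.le
      have hin : ∀ j, ⟪a j, z + t • u⟫ = ⟪a j, z⟫ + t * ⟪a j, u⟫ := fun j => by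
        rw [inner_add_right, real_inner_smul_right]
      have hz' : ∀ j, ⟪a j, z + t • u⟫ ≤ γ j := fun j => by
        rw [hin]
        by_cases hj : 0 < ⟪a j, u⟫
        · have := hmin j (by simpa using hj)
          rw [le_div_iff₀ hj] at this
          linarith
        · nlinarith [hz j]
      have hti : ⟪a i, z + t • u⟫ = γ i := by
        rw [hin, div_mul_cancel₀ _ hi'.ne']; ring
      have hss : act z ⊂ act (z + t • u) := by
        refine (Finset.ssubset_iff_of_subset fun j hj => ?_).2 ⟨i, ?_, fun hiz => ?_⟩
        · simp only [hact, Finset.mem_filter, Finset.mem_univ, true_and] at hj ⊢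
          rw [hin, hu j hj, hj, mul_zero, add_zero]
        · simpa [hact] using hti
        · simp only [hact, Finset.mem_filter, Finset.mem_univ, true_and] at hiz
          exact hi'.ne' (hu i hiz)
      have h1 := Finset.card_lt_card hss
      have h2 := Finset.card_le_univ (act (z + t • u))
      exact ih _ (by omega) (z + t • u) rfl hz' (hgz.trans (hgu t ht))
  obtain ⟨y, hy, hgy, hy0⟩ := key _ z₀ rfl hz₀ hg₀
  -- Without a free direction the active normals span the whole space, so Cramer's rule reaches `y`.
  have hspan : y ∈ Submodule.span ℝ (a '' {j | ⟪a j, y⟫ = γ j}) := by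
    have : Submodule.span ℝ (a '' {j | ⟪a j, y⟫ = γ j}) = ⊤ := by
      rw [← Submodule.orthogonal_eq_bot_iff, Submodule.eq_bot_iff]
      intro u hu
      rw [Submodule.mem_orthogonal] at hu
      exact hy0 u fun j hj => hu _ (Submodule.subset_span ⟨j, hj, rfl⟩)
    rw [this]; exact Submodule.mem_top
  obtain ⟨T, hT, hyT⟩ := exists_cramerSol a γ hspan fun i hi => hi
  exact ⟨T, hT, hyT ▸ hy, hyT ▸ hgy⟩

end

/-! ### Points close to given points -/

section near
variable {m : ℕ}

/-- The inner products of the differences `W i₀ - W i`, in terms of those of the `W i`. -/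
def diffGram {ι : Type} (G : ι → ι → ℝ) (i₀ i j : ι) : ℝ := G i₀ i₀ - G i₀ j - G i i₀ + G i j

/-- Let `i₀` maximize ‖x - W i‖² - R i. In the coordinate `z = x - W i₀` the comparison with any
other index is linear, as ‖z‖² cancels, and the norm bound at `i₀` implies all the others. The
linear system uses only differences of the centres, hence only Gram entries. -/
theorem near_iff {ι : Type} [Fintype ι] [DecidableEq ι] [Nonempty ι] {E : Type}
    [NormedAddCommGroup E] [InnerProductSpace ℝ E] [FiniteDimensional ℝ E] (W : ι → E)
    (R : ι → ℝ) : (∃ x, ∀ i, ‖x - W i‖ ^ 2 ≤ R i) ↔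
      ∃ i₀, ∃ T : Finset ι, CoreAt (diffGram (fun i j => ⟪W i, W j⟫) i₀)
        (fun i => (R i - R i₀ - diffGram (fun i j => ⟪W i, W j⟫) i₀ i i) / 2) (R i₀) T := by
  have hG : ∀ i₀, diffGram (fun i j => ⟪W i, W j⟫) i₀ = fun i j => ⟪W i₀ - W i, W i₀ - W j⟫ := by
    intro i₀; funext i j
    simp only [diffGram, inner_sub_left, inner_sub_right]; ring
  have hsq : ∀ i₀ i z, ‖z + W i₀ - W i‖ ^ 2 =
      ‖z‖ ^ 2 + 2 * ⟪W i₀ - W i, z⟫ + ⟪W i₀ - W i, W i₀ - W i⟫ := fun i₀ i z => by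
    rw [add_sub_assoc, norm_add_sq_real, real_inner_comm, real_inner_self_eq_norm_sq]
  simp only [hG, ← exists_le_iff_exists_coreAt]
  constructor
  · rintro ⟨x, hx⟩
    obtain ⟨i₀, -, h₀⟩ := Finset.exists_max_image Finset.univ
      (fun i => ‖x - W i‖ ^ 2 - R i) Finset.univ_nonempty
    refine ⟨i₀, x - W i₀, hx i₀, fun i => ?_⟩
    have h1 := h₀ i (Finset.mem_univ i)
    have h2 := hsq i₀ i (x - W i₀)
    rw [sub_add_cancel] at h2
    linarith
  · rintro ⟨i₀, z, hz, h⟩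
    refine ⟨z + W i₀, fun i => ?_⟩
    have h1 := h i
    rw [hsq]
    linarith

end near

/-! ### Points far from given points -/

section far
variable {m d : ℕ}

/-- The indices of the constraints for a point `x` of the ball and a bound `s` on its squared
norm. -/
abbrev FarIdx (m d : ℕ) : Type := Fin m ⊕ (Fin d × Bool) ⊕ Bool

/-- The normal vectors of the constraints. -/
def farVec (w : Fin m → Fin d → ℝ) : FarIdx m d → Option (Fin d) → ℝ
  | .inl j, some k => 2 * w j k
  | .inl _, none => -1
  | .inr (.inl (k, true)), some l => if l = k then 1 else 0
  | .inr (.inl (k, false)), some l => if l = k then -1 else 0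
  | .inr (.inl _), none => 0
  | .inr (.inr _), some _ => 0
  | .inr (.inr true), none => 1
  | .inr (.inr false), none => -1

/-- The right hand sides of the constraints. -/
def farRhs (G : Fin m → Fin m → ℝ) (ρ : Fin m → ℝ) (b : ℝ) : FarIdx m d → ℝ
  | .inl j => G j j - ρ j
  | .inr (.inl _) => b + 1
  | .inr (.inr true) => b
  | .inr (.inr false) => 0

/-- The vertex given by `T` is feasible and has a squared norm of at least `s`. -/
def FarVertex (w : Fin m → Fin d → ℝ) (G : Fin m → Fin m → ℝ) (ρ : Fin m → ℝ) (b : ℝ)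
    (T : Finset (FarIdx m d)) : Prop :=
  let A := fun i j => ∑ k, farVec w i k * farVec w j k
  let c := cramerSol A (farRhs G ρ b) T
  (padMat A T).det ≠ 0 ∧ (∀ j, ∑ i, c i * A j i ≤ farRhs G ρ b j) ∧
    ∑ i, c i * farVec w i none ≤
      ∑ k : Fin d, (∑ i, c i * farVec w i (some k)) * ∑ i, c i * farVec w i (some k)

/-- Applies `exists_vertex` to the convex function ‖x‖² - s on the polytope of pairs `(x, s)`, where
the coordinate `none` carries `s`. -/
theorem farVertex_of_exists {w : Fin m → Fin d → ℝ} {G : Fin m → Fin m → ℝ} {ρ : Fin m → ℝ} {b : ℝ}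
    (z : EuclideanSpace ℝ (Option (Fin d)))
    (hz : ∀ j, ∑ k, farVec w j k * z k ≤ farRhs G ρ b j)
    (hs : z none ≤ ∑ k : Fin d, z (some k) * z (some k)) : ∃ T, FarVertex w G ρ b T := by
  set a : FarIdx m d → EuclideanSpace ℝ (Option (Fin d)) := fun i => WithLp.toLp 2 (farVec w i)
  have hin : ∀ i (y : EuclideanSpace ℝ (Option (Fin d))), ⟪a i, y⟫ = ∑ k, farVec w i k * y k := by
    intro i y
    simp only [PiLp.inner_apply, a]
    exact Finset.sum_congr rfl fun k _ => by simp [mul_comm]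
  -- The box constraints contain both signs of every coordinate direction, so a vector that
  -- increases none of them is zero.
  have hpos : ∀ u, u ≠ 0 → ∃ j, 0 < ⟪a j, u⟫ := by
    intro u hu
    by_contra hcon
    push Not at hcon
    refine hu ?_
    ext l
    rcases l with _ | l
    · have h1 := hcon (.inr (.inr true))
      have h2 := hcon (.inr (.inr false))
      simp only [hin, farVec, Fintype.sum_option] at h1 h2
      simp at h1 h2 ⊢
      linarith
    · have h1 := hcon (.inr (.inl (l, true)))
      have h2 := hcon (.inr (.inl (l, false)))
      simp only [hin, farVec, Fintype.sum_option] at h1 h2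
      simp at h1 h2 ⊢
      linarith
  -- Along a line the function is quadratic with nonnegative leading coefficient. One of the two
  -- opposite directions has a nonnegative linear coefficient, and there the function does not
  -- decrease.
  have hg : ∀ z u : EuclideanSpace ℝ (Option (Fin d)), (∀ t ≥ (0 : ℝ),
      ∑ k : Fin d, z (some k) * z (some k) - z none ≤
        ∑ k : Fin d, (z + t • u) (some k) * (z + t • u) (some k) - (z + t • u) none) ∨
      ∀ t ≥ (0 : ℝ), ∑ k : Fin d, z (some k) * z (some k) - z none ≤
        ∑ k : Fin d, (z + t • -u) (some k) * (z + t • -u) (some k) - (z + t • -u) none := by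
    intro z u
    have hexp : ∀ t : ℝ, ∀ v : EuclideanSpace ℝ (Option (Fin d)),
        ∑ k : Fin d, (z + t • v) (some k) * (z + t • v) (some k) - (z + t • v) none =
        (∑ k : Fin d, z (some k) * z (some k) - z none) +
          t * (2 * ∑ k : Fin d, z (some k) * v (some k) - v none) +
          t ^ 2 * ∑ k : Fin d, v (some k) * v (some k) := by
      intro t v
      have : ∀ k : Fin d, (z + t • v) (some k) * (z + t • v) (some k) =
          z (some k) * z (some k) + 2 * t * (z (some k) * v (some k)) +
            t ^ 2 * (v (some k) * v (some k)) := fun k => by simp; ring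
      simp only [this, Finset.sum_add_distrib, ← Finset.mul_sum]
      simp
      ring
    have hsq : ∀ v : EuclideanSpace ℝ (Option (Fin d)), 0 ≤ ∑ k : Fin d, v (some k) * v (some k) :=
      fun v => Finset.sum_nonneg fun k _ => mul_self_nonneg _
    rcases le_total 0 (2 * ∑ k : Fin d, z (some k) * u (some k) - u none) with h | h
    · left; intro t ht
      rw [hexp]
      have := mul_nonneg ht h
      have := mul_nonneg (sq_nonneg t) (hsq u)
      linarith
    · right; intro t ht
      rw [hexp]
      have h1 : 2 * ∑ k : Fin d, z (some k) * (-u) (some k) - (-u) none =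
          -(2 * ∑ k : Fin d, z (some k) * u (some k) - u none) := by
        simp; ring
      rw [h1]
      have := mul_nonneg ht (neg_nonneg.2 h)
      have := mul_nonneg (sq_nonneg t) (hsq (-u))
      linarith
  obtain ⟨T, hT, h1, h2⟩ := exists_vertex a (farRhs G ρ b) hpos
    (fun z => ∑ k : Fin d, z (some k) * z (some k) - z none) hg (z₀ := z)
    (fun j => by rw [hin]; exact hz j) (sub_nonneg.2 hs)
  have hA : (fun i j => ⟪a i, a j⟫) = fun i j => ∑ k, farVec w i k * farVec w j k := by
    funext i j; rw [hin]
  rw [hA] at hT h1 h2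
  have hev : ∀ (c : FarIdx m d → ℝ) k, (∑ i, c i • a i) k = ∑ i, c i * farVec w i k := by
    intro c k; simp [a]
  refine ⟨T, hT, fun j => ?_, ?_⟩
  · have := h1 j
    simp only [inner_sum, real_inner_smul_right] at this
    simpa only [hin] using this
  · simpa only [hev, sub_nonneg] using h2

/-- The witness is the combination of the normals itself; interchanging sums turns Gram products
into values of the constraints. -/
theorem FarVertex.exists {w : Fin m → Fin d → ℝ} {G : Fin m → Fin m → ℝ} {ρ : Fin m → ℝ} {b : ℝ}
    {T : Finset (FarIdx m d)} (h : FarVertex w G ρ b T) :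
    ∃ z : Option (Fin d) → ℝ, (∀ j, ∑ k, farVec w j k * z k ≤ farRhs G ρ b j) ∧
      z none ≤ ∑ k : Fin d, z (some k) * z (some k) := by
  obtain ⟨-, h1, h2⟩ := h
  refine ⟨fun k => ∑ i, cramerSol (fun i j => ∑ k, farVec w i k * farVec w j k)
    (farRhs G ρ b) T i * farVec w i k, fun j => le_of_eq_of_le ?_ (h1 j), h2⟩
  simp only [Finset.mul_sum]
  rw [Finset.sum_comm]
  exact Finset.sum_congr rfl fun i _ => Finset.sum_congr rfl fun k _ => by ring

/-- From a point of small norm and a point of large norm to a feasible point between them. -/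
theorem exists_between {E ι : Type} [NormedAddCommGroup E] [InnerProductSpace ℝ E] {w : ι → E}
    {ρ : ι → ℝ} {b s : ℝ} {y x : E} (hy : ‖y‖ ^ 2 ≤ b)
    (hyw : ∀ j, 2 * ⟪w j, y⟫ ≤ b + ⟪w j, w j⟫ - ρ j) (hsb : s ≤ b) (hx : s ≤ ‖x‖ ^ 2)
    (hxw : ∀ j, 2 * ⟪w j, x⟫ ≤ s + ⟪w j, w j⟫ - ρ j) :
    ∃ x : E, ‖x‖ ^ 2 ≤ b ∧ ∀ j, ρ j ≤ ‖x - w j‖ ^ 2 := by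
  have hf : ContinuousOn (fun τ : ℝ => ‖(1 - τ) • y + τ • x‖ ^ 2 - ((1 - τ) * b + τ * s))
      (Set.Icc 0 1) := by fun_prop
  -- The difference of squared norm and second coordinate along the segment from `(y, b)` to `(x,
  -- s)` is at most zero at the start and at least zero at the end. Where it vanishes, the linear
  -- constraints become the distance bounds.
  obtain ⟨τ, ⟨h0, h1⟩, hτ⟩ := intermediate_value_Icc zero_le_one hf
    (show (0 : ℝ) ∈ Set.Icc _ _ by
      simp only [sub_zero, one_smul, zero_smul, add_zero, sub_self, one_mul, zero_mul, zero_add,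
        Set.mem_Icc]
      constructor <;> linarith)
  have hτ' : ‖(1 - τ) • y + τ • x‖ ^ 2 = (1 - τ) * b + τ * s := by
    simpa [sub_eq_zero] using hτ
  refine ⟨(1 - τ) • y + τ • x, by rw [hτ']; nlinarith, fun j => ?_⟩
  rw [norm_sub_sq_real, hτ', real_inner_comm, inner_add_right, real_inner_smul_right,
    real_inner_smul_right, ← real_inner_self_eq_norm_sq]
  have h2 := mul_le_mul_of_nonneg_left (hyw j) (sub_nonneg.2 h1)
  have h3 := mul_le_mul_of_nonneg_left (hxw j) h0
  nlinarith

/-- Fewer vectors than the dimension cannot span, so the orthogonal complement of their span is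
nonzero. -/
theorem exists_ne_zero_orthogonal {E : Type} [NormedAddCommGroup E] [InnerProductSpace ℝ E]
    [FiniteDimensional ℝ E] (hd : m < Module.finrank ℝ E) (w : Fin m → E) :
    ∃ u : E, u ≠ 0 ∧ ∀ j, ⟪w j, u⟫ = 0 := by
  have hne : Submodule.span ℝ (Set.range w) ≠ ⊤ := fun h => by
    have := finrank_range_le_card (R := ℝ) w
    rw [Set.finrank, h, finrank_top, Fintype.card_fin] at this
    omega
  obtain ⟨u, hu, hu0⟩ := (Submodule.ne_bot_iff _).1
    (mt Submodule.orthogonal_eq_bot_iff.1 hne)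
  exact ⟨u, hu0, fun j => (Submodule.mem_orthogonal _ _).1 hu _ (Submodule.subset_span ⟨j, rfl⟩)⟩

/-- Two relaxations, one for ‖x‖² ≤ s at the level `s = b` and one for ‖x‖² ≥ s, are jointly exact
by `exists_between`. The second is only tested for `d ≤ m`, so the number of coordinates entering
the test is bounded in terms of `m`. -/
theorem far_iff (w : Fin m → EuclideanSpace ℝ (Fin d)) (ρ : Fin m → ℝ) (b : ℝ) :
    (∃ x : EuclideanSpace ℝ (Fin d), ‖x‖ ^ 2 ≤ b ∧ ∀ j, ρ j ≤ ‖x - w j‖ ^ 2) ↔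
      (∃ T : Finset (Fin m), CoreAt (fun i j => ⟪w i, w j⟫)
        (fun j => (b + ⟪w j, w j⟫ - ρ j) / 2) b T) ∧
      (d ≤ m → ∃ T, FarVertex (fun j => w j) (fun i j => ⟪w i, w j⟫) ρ b T) := by
  rw [← exists_le_iff_exists_coreAt]
  have hin : ∀ x y : EuclideanSpace ℝ (Fin d), ⟪x, y⟫ = ∑ k, x k * y k := fun x y => by
    simp only [PiLp.inner_apply]
    exact Finset.sum_congr rfl fun k _ => by simp [mul_comm]
  constructor
  · rintro ⟨x, hx, hxw⟩
    have hxw' : ∀ j, 2 * ⟪w j, x⟫ - ‖x‖ ^ 2 ≤ ⟪w j, w j⟫ - ρ j := fun j => by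
      have := hxw j
      rw [norm_sub_sq_real, real_inner_comm, ← real_inner_self_eq_norm_sq (w j)] at this
      linarith
    refine ⟨⟨x, hx, fun j => by have := hxw' j; linarith⟩, fun _ => ?_⟩
    have hxx : ‖x‖ ^ 2 = ∑ k, x k * x k := by rw [← real_inner_self_eq_norm_sq, hin]
    have hk : ∀ k, x k * x k ≤ b := fun k => by
      refine le_trans ?_ hx
      rw [hxx]
      exact Finset.single_le_sum (f := fun k => x k * x k) (fun k _ => mul_self_nonneg _)
        (Finset.mem_univ k)
    -- The point itself, with its squared norm as `s`. The box of half-width `b + 1` contains the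
    -- ball of squared radius `b` and avoids a square root.
    refine farVertex_of_exists (WithLp.toLp 2 fun o => o.elim (‖x‖ ^ 2) x) (fun j => ?_) ?_
    · rcases j with j | ⟨k, _ | _⟩ | _ | _
      · have := hxw' j
        simp only [hin (w j) x] at this
        simp only [farVec, farRhs, Fintype.sum_option, Option.elim, mul_assoc, ← Finset.mul_sum]
        linarith
      · simp [farVec, farRhs]
        nlinarith [hk k, sq_nonneg (x k + 1)]
      · simp [farVec, farRhs]
        nlinarith [hk k, sq_nonneg (x k - 1)]
      · simp [farVec, farRhs]
      · simpa [farVec, farRhs] using hx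
    · simp [hxx]
  · rintro ⟨⟨y, hy, hyw⟩, h⟩
    have hyw' : ∀ j, 2 * ⟪w j, y⟫ ≤ b + ⟪w j, w j⟫ - ρ j := fun j => by
      have := hyw j; linarith
    by_cases hd : d ≤ m
    · obtain ⟨T, hT⟩ := h hd
      obtain ⟨z, hz, hz'⟩ := hT.exists
      refine exists_between (x := WithLp.toLp 2 fun k => z (some k)) (s := z none) hy hyw' ?_ ?_
        fun j => ?_
      · simpa [farVec, farRhs] using hz (.inr (.inr true))
      · rw [← real_inner_self_eq_norm_sq, hin]; exact hz'
      · have := hz (.inl j)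
        simp only [farVec, farRhs, Fintype.sum_option, mul_assoc, ← Finset.mul_sum] at this
        rw [hin (w j) (WithLp.toLp 2 _)]
        simp only
        linarith
    · obtain ⟨u, hu0, hu⟩ := exists_ne_zero_orthogonal (by simpa using hd) w
      have hb : 0 ≤ b := (sq_nonneg _).trans hy
      -- Moving along `u` changes no product with the `w j`. The step has length ‖y‖ + b + 1, so the
      -- end point has norm at least `b + 1` and squared norm at least `b`.
      refine exists_between (x := y + ((‖y‖ + (b + 1)) / ‖u‖) • u) (s := b) hy hyw' le_rfl ?_
        fun j => ?_
      · have h1 : ‖((‖y‖ + (b + 1)) / ‖u‖) • u‖ = ‖y‖ + (b + 1) := by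
          rw [norm_smul, Real.norm_of_nonneg (by positivity),
            div_mul_cancel₀ _ (norm_ne_zero_iff.2 hu0)]
        have h2 := norm_sub_le (y + ((‖y‖ + (b + 1)) / ‖u‖) • u) y
        rw [add_sub_cancel_left, h1] at h2
        nlinarith
      · rw [inner_add_right, real_inner_smul_right, hu, mul_zero, add_zero]
        exact hyw' j

end far

/-! ### The data of an instance, indexed by natural numbers -/

/-- The numbers of an instance as they are found in the memory. -/
structure Data (K : Type) where
  n : ℕ
  d : ℕ
  cand : ℕ → ℕ → K
  voter : ℕ → ℕ → K
  score : ℕ → K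
  budget : K

/-- The parameters of the geometric question: the squared budget, the dimension, the squared radii,
the inner products and the coordinates of the voters with the target candidate at the origin. -/
abbrev Var (m : ℕ) : Type := Bool ⊕ Fin m ⊕ (Fin m × Fin m) ⊕ (Fin m × Fin m)

namespace Data

section
variable {K : Type} [Field K] (D : Data K)

/-- The inner product of the positions of the voters `j` and `l` seen from candidate `i`. -/
def dot (j l i : ℕ) : K :=
  ∑ k ∈ Finset.range D.d, (D.voter j k - D.cand i k) * (D.voter l k - D.cand i k)

/-- The values of the parameters for the squared radii `ρ`. -/
def env (m : ℕ) (ρ : ℕ → K) : Var m → K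
  | .inl false => D.budget * D.budget
  | .inl true => D.d
  | .inr (.inl j) => ρ j
  | .inr (.inr (.inl (j, l))) => D.dot j l 0
  | .inr (.inr (.inr (j, k))) => D.voter j k - D.cand 0 k

end

/-- The target candidate can be moved to a point that satisfies all the distance bounds. -/
def Feasible (g : Goal) (m : ℕ) (D : Data ℝ) (ρ : ℕ → ℝ) : Prop :=
  ∃ x : Fin D.d → ℝ, ∑ k : Fin D.d, (x k - D.cand 0 k) ^ 2 ≤ D.budget * D.budget ∧
    ∀ j < m, match g with
      | .constructive => ∑ k : Fin D.d, (x k - D.voter j k) ^ 2 ≤ ρ j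
      | .destructive => ρ j ≤ ∑ k : Fin D.d, (x k - D.voter j k) ^ 2

/-- Position of voter `j` with the target candidate at the origin. -/
noncomputable def shift (D : Data ℝ) (j : ℕ) : EuclideanSpace ℝ (Fin D.d) :=
  WithLp.toLp 2 fun k => D.voter j k - D.cand 0 k

open scoped RealInnerProductSpace

theorem inner_shift (D : Data ℝ) (j l : ℕ) : ⟪D.shift j, D.shift l⟫ = D.dot j l 0 := by
  rw [dot, Finset.sum_range]
  simp only [PiLp.inner_apply, shift]
  exact Finset.sum_congr rfl fun k _ => by simp [mul_comm]

/-- Translation of the target to the origin. The conditions are abstract so that upper and lower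
distance bounds are covered at once. -/
theorem exists_shift {D : Data ℝ} {P : ℝ → Prop} {R : (ℕ → ℝ) → Prop} :
    (∃ x : Fin D.d → ℝ, P (∑ k : Fin D.d, (x k - D.cand 0 k) ^ 2) ∧
      R fun j => ∑ k : Fin D.d, (x k - D.voter j k) ^ 2) ↔
    ∃ z : EuclideanSpace ℝ (Fin D.d), P (‖z‖ ^ 2) ∧ R fun j => ‖z - D.shift j‖ ^ 2 := by
  have hn : ∀ z : EuclideanSpace ℝ (Fin D.d), ‖z‖ ^ 2 = ∑ k, z k ^ 2 := fun z => by
    rw [EuclideanSpace.norm_sq_eq]; simp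
  constructor
  · rintro ⟨x, h1, h2⟩
    refine ⟨WithLp.toLp 2 fun k => x k - D.cand 0 k, ?_, ?_⟩
    · simpa [hn] using h1
    · simpa [hn, shift] using h2
  · rintro ⟨z, h1, h2⟩
    refine ⟨fun k => z k + D.cand 0 k, ?_, ?_⟩
    · simpa [hn] using h1
    · simpa only [hn, shift, PiLp.sub_apply, sub_sub_eq_add_sub] using h2

end Data

/-- The index `none` is the budget ball; its centre is the origin, hence the zero Gram entries. The
existential quantifiers over the centre and the constraint set are finite disjunctions. -/
theorem exists_formula_constructive (m : ℕ) : ∃ φ : Fm (Var m), ∀ (D : Data ℝ) (ρ : ℕ → ℝ),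
    φ.Holds (D.env m ρ) ↔ D.Feasible .constructive m ρ := by
  let G : (Var m → ℝ) → Option (Fin m) → Option (Fin m) → ℝ := fun e i j =>
    match i, j with
    | some i, some j => e (.inr (.inr (.inl (i, j))))
    | _, _ => 0
  let R : (Var m → ℝ) → Option (Fin m) → ℝ := fun e i => i.elim (e (.inl false))
    fun i => e (.inr (.inl i))
  have hG : ∀ i j, DefT fun e => G e i j := by
    rintro (_ | i) (_ | j)
    exacts [DefT.zero, DefT.zero, DefT.zero, DefT.var _]
  have hR : ∀ i, DefT fun e => R e i := by
    rintro (_ | i)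
    exacts [DefT.var _, DefT.var _]
  have hdG : ∀ i₀ i j, DefT fun e => diffGram (G e) i₀ i j := fun i₀ i j =>
    (((hG _ _).sub (hG _ _)).sub (hG _ _)).add (hG _ _)
  obtain ⟨φ, hφ⟩ : DefP fun e => ∃ i₀, ∃ T : Finset (Option (Fin m)), CoreAt (diffGram (G e) i₀)
      (fun i => (R e i - R e i₀ - diffGram (G e) i₀ i i) / 2) (R e i₀) T := by
    refine DefP.exists fun i₀ => DefP.exists fun T => DefP.coreAt (hdG i₀) (fun i => ?_) (hR i₀) T
    exact (((hR i).sub (hR i₀)).sub (hdG _ _ _)).div (by simpa using DefT.nat 2)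
  refine ⟨φ, fun D ρ => (hφ _).trans ?_⟩
  have h1 := near_iff (fun i : Option (Fin m) => i.elim 0 fun j => D.shift j) (R (D.env m ρ))
  have h2 : (fun i j : Option (Fin m) => inner ℝ (i.elim 0 fun j => D.shift j)
      (j.elim 0 fun j => D.shift j)) = G (D.env m ρ) := by
    funext i j
    rcases i with _ | i <;> rcases j with _ | j <;> simp [G, Data.env, Data.inner_shift]
  rw [h2] at h1
  refine h1.symm.trans (Iff.trans ?_ (Data.exists_shift (P := fun a => a ≤ D.budget * D.budget)
    (R := fun a => ∀ j < m, a j ≤ ρ j)).symm)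
  refine exists_congr fun z => ?_
  simp [Option.forall, R, Data.env, Fin.forall_iff]

/-- The dimension is itself a parameter: for each value up to `m` the formula contains a vertex test
of that dimension, guarded by an equation that selects the right one. For larger dimensions no guard
applies. -/
theorem exists_formula_destructive (m : ℕ) : ∃ φ : Fm (Var m), ∀ (D : Data ℝ) (ρ : ℕ → ℝ),
    φ.Holds (D.env m ρ) ↔ D.Feasible .destructive m ρ := by
  let G : (Var m → ℝ) → Fin m → Fin m → ℝ := fun e i j => e (.inr (.inr (.inl (i, j))))
  let R : (Var m → ℝ) → Fin m → ℝ := fun e i => e (.inr (.inl i))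
  let b : (Var m → ℝ) → ℝ := fun e => e (.inl false)
  -- The parameters include `m` coordinates per voter; a test in dimension `d ≤ m` reads the first
  -- `d` of them.
  let W : (d : Fin (m + 1)) → (Var m → ℝ) → Fin m → Fin d → ℝ := fun d e j k =>
    e (.inr (.inr (.inr (j, Fin.castLE (Nat.lt_succ_iff.1 d.2) k))))
  have hG : ∀ i j, DefT fun e => G e i j := fun i j => DefT.var _
  have hR : ∀ i, DefT fun e => R e i := fun i => DefT.var _
  have hb : DefT b := DefT.var _
  have hf : ∀ d i k, DefT fun e => farVec (W d e) i k := by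
    rintro d (j | ⟨k, _ | _⟩ | _ | _) (_ | l)
    · simpa [farVec] using DefT.int (-1)
    · exact DefT.mul (by simpa using DefT.nat 2) (DefT.var _)
    · exact DefT.zero
    · simp only [farVec]; split_ifs
      · simpa using DefT.int (-1)
      · exact DefT.zero
    · exact DefT.zero
    · simp only [farVec]; split_ifs
      · exact DefT.one
      · exact DefT.zero
    · simpa [farVec] using DefT.int (-1)
    · exact DefT.zero
    · exact DefT.one
    · exact DefT.zero
  have hr : ∀ (d : ℕ) (i : FarIdx m d), DefT fun e => farRhs (G e) (R e) (b e) i := by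
    rintro d (j | ⟨k, _ | _⟩ | _ | _)
    exacts [(hG _ _).sub (hR _), hb.add DefT.one, hb.add DefT.one, DefT.zero, hb]
  obtain ⟨φ, hφ⟩ : DefP fun e => (∃ T : Finset (Fin m), CoreAt (G e)
      (fun j => (b e + G e j j - R e j) / 2) (b e) T) ∧
      ∀ d : Fin (m + 1), e (.inl true) = ((d : ℕ) : ℝ) →
        ∃ T, FarVertex (W d e) (G e) (R e) (b e) T := by
    refine DefP.and (DefP.exists fun T => DefP.coreAt hG (fun j => ?_) hb T)
      (DefP.forall fun d => DefP.imp (DefP.eq (DefT.var _) (DefT.nat _)) (DefP.exists fun T => ?_))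
    · exact ((hb.add (hG _ _)).sub (hR _)).div (by simpa using DefT.nat 2)
    · have hA : ∀ i j, DefT fun e => ∑ k, farVec (W d e) i k * farVec (W d e) j k := fun i j =>
        DefT.sum _ fun k _ => (hf _ _ _).mul (hf _ _ _)
      have hc := fun i => DefT.cramerSol hA (hr d) T i
      refine (DefP.padMat_det_ne hA T).and (DefP.and (DefP.forall fun j => DefP.le
        (DefT.sum _ fun i _ => (hc i).mul (hA j i)) (hr _ _)) (DefP.le ?_ ?_))
      · exact DefT.sum _ fun i _ => (hc i).mul (hf _ _ _)
      · exact DefT.sum _ fun k _ => (DefT.sum _ fun i _ => (hc i).mul (hf _ _ _)).mul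
          (DefT.sum _ fun i _ => (hc i).mul (hf _ _ _))
  refine ⟨φ, fun D ρ => (hφ _).trans ?_⟩
  have h1 := far_iff (fun j : Fin m => D.shift j) (R (D.env m ρ)) (D.budget * D.budget)
  simp only [Data.inner_shift] at h1
  refine Iff.trans ?_ (Data.exists_shift (P := fun a => a ≤ D.budget * D.budget)
    (R := fun a => ∀ j < m, ρ j ≤ a j)).symm
  have h2 : (∃ z : EuclideanSpace ℝ (Fin D.d), ‖z‖ ^ 2 ≤ D.budget * D.budget ∧
      ∀ j < m, ρ j ≤ ‖z - D.shift j‖ ^ 2) ↔ ∃ z : EuclideanSpace ℝ (Fin D.d),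
      ‖z‖ ^ 2 ≤ D.budget * D.budget ∧ ∀ j : Fin m, R (D.env m ρ) j ≤ ‖z - D.shift j‖ ^ 2 := by
    simp [R, Data.env, Fin.forall_iff]
  rw [h2, h1]
  refine and_congr Iff.rfl ⟨fun h hd => ?_, fun h d hd => ?_⟩
  · exact h ⟨D.d, Nat.lt_succ_iff.2 hd⟩ rfl
  · have hd' : D.d = d := by exact Nat.cast_injective (R := ℝ) hd
    obtain ⟨n, d', cand, voter, score, budget⟩ := D
    obtain ⟨d, hdm⟩ := d
    obtain rfl : d' = d := hd'
    exact h (Nat.lt_succ_iff.1 hdm)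

theorem exists_formula (m : ℕ) (g : Goal) : ∃ φ : Fm (Var m), ∀ (D : Data ℝ) (ρ : ℕ → ℝ),
    φ.Holds (D.env m ρ) ↔ D.Feasible g m ρ := by
  cases g
  exacts [exists_formula_constructive m, exists_formula_destructive m]

/-! ### Scenarios of ranks of the target candidate -/

namespace Data

section defs
variable {K : Type} [Field K] [LinearOrder K] (D : Data K)

/-- Squared distance of voter `j` and candidate `i`. -/
def dist (j i : ℕ) : K := D.dot j j i

open Classical in
/-- The rank of candidate `i` for voter `j`, the target candidate left out. -/
noncomputable def pos (j i : ℕ) : ℕ :=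
  ((Finset.range D.n).filter fun k => 0 < k ∧ D.dist j k < D.dist j i).card

/-- The ranks that stand for all ranks of the same score: the worst one if the target candidate is
to win, the best one if it is to lose. -/
def Mark (g : Goal) (t : ℕ) : Prop :=
  match g with
  | .constructive => t + 1 < D.n → D.score (t + 1) < D.score t
  | .destructive => 0 < t → D.score t < D.score (t - 1)

open Classical in
/-- The number of marked ranks before `t`. -/
noncomputable def blk (g : Goal) (t : ℕ) : ℕ := ((Finset.range t).filter fun s => D.Mark g s).card

/-- The score of candidate `i` from voter `j`, who puts the target candidate on rank `t`. -/
noncomputable def virt (j t i : ℕ) : K :=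
  if i = 0 then D.score t else
    if D.pos j i < t then D.score (D.pos j i) else D.score (D.pos j i + 1)

/-- The candidate with this rank determines the distance bound for the target rank `t`. -/
def Bounds (g : Goal) (p t : ℕ) : Prop :=
  match g with
  | .constructive => p = t
  | .destructive => p + 1 = t

/-- The distance bound if there is none. -/
def dflt (g : Goal) (j : ℕ) : K :=
  match g with
  | .constructive =>
    (D.dist j 0 + D.budget * D.budget) + (D.dist j 0 + D.budget * D.budget)
  | .destructive => 0

open Classical in
/-- The squared distance bound for the target rank `t` and voter `j`. -/
noncomputable def rad (g : Goal) (j t : ℕ) : K :=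
  if ∃ i < D.n, 0 < i ∧ Bounds g (D.pos j i) t then
    ∑ i ∈ (Finset.range D.n).filter fun i => 0 < i ∧ Bounds g (D.pos j i) t, D.dist j i
  else D.dflt g j

/-- The goal is reached if voter `j` puts the target candidate on rank `e j`. -/
def Elected (g : Goal) (m : ℕ) (e : ℕ → ℕ) : Prop :=
  match g with
  | .constructive => ∀ i < D.n,
      ∑ j ∈ Finset.range m, D.virt j (e j) i ≤ ∑ j ∈ Finset.range m, D.virt j (e j) 0
  | .destructive => ∃ i < D.n, 0 < i ∧
      ∑ j ∈ Finset.range m, D.virt j (e j) 0 ≤ ∑ j ∈ Finset.range m, D.virt j (e j) i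

/-- No voter has a tie. -/
def NoTies (m : ℕ) : Prop :=
  ∀ j < m, ∀ i < D.n, ∀ k < D.n, D.dist j i = D.dist j k → i = k

/-- Change of the number type. -/
def map {L : Type} (φ : K → L) : Data L where
  n := D.n
  d := D.d
  cand i k := φ (D.cand i k)
  voter j k := φ (D.voter j k)
  score t := φ (D.score t)
  budget := φ D.budget

end defs

/-! ### Invariance under embeddings of ordered fields -/

theorem dot_map {K L : Type} [Field K] [Field L] (D : Data K) {φ : K →+* L} (j l i : ℕ) :
    (D.map φ).dot j l i = φ (D.dot j l i) := by
  simp [dot, map]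

theorem dist_map {K L : Type} [Field K] [Field L] (D : Data K) {φ : K →+* L} (j i : ℕ) :
    (D.map φ).dist j i = φ (D.dist j i) :=
  D.dot_map j j i

theorem env_map {K L : Type} [Field K] [Field L] (D : Data K) {φ : K →+* L} (m : ℕ) (ρ : ℕ → K) :
    ((D.map φ).env m fun j => φ (ρ j)) = fun v => φ (D.env m ρ v) := by
  funext v
  rcases v with (_ | _) | _ | ⟨_, _⟩ | ⟨_, _⟩ <;> simp [env, dot_map] <;> simp [map]

section map
variable {K L : Type} [Field K] [LinearOrder K] [Field L] [LinearOrder L] (D : Data K)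
  {φ : K →+* L} (hφ : StrictMono φ)

include hφ

theorem pos_map (j i : ℕ) : (D.map φ).pos j i = D.pos j i := by
  simp only [pos, dist_map, hφ.lt_iff_lt]; rfl

theorem mark_map (g : Goal) (t : ℕ) : (D.map φ).Mark g t ↔ D.Mark g t := by
  cases g <;> simp [Mark, map, hφ.lt_iff_lt]

theorem virt_map (j t i : ℕ) : (D.map φ).virt j t i = φ (D.virt j t i) := by
  simp only [virt, D.pos_map hφ]
  split_ifs <;> rfl

theorem rad_map (g : Goal) (j t : ℕ) : (D.map φ).rad g j t = φ (D.rad g j t) := by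
  classical
  simp only [rad, D.pos_map hφ, dist_map]
  change (if ∃ i < D.n, 0 < i ∧ Bounds g (D.pos j i) t then _ else _) = _
  split_ifs
  · rw [map_sum]; rfl
  · cases g
    · simp only [dflt, dist_map, map_add, map_mul]; rfl
    · exact (map_zero φ).symm

theorem elected_map (g : Goal) (m : ℕ) (e : ℕ → ℕ) :
    (D.map φ).Elected g m e ↔ D.Elected g m e := by
  cases g <;> simp only [Elected, D.virt_map hφ, ← map_sum, hφ.le_iff_le] <;> rfl

theorem noTies_map (m : ℕ) : (D.map φ).NoTies m ↔ D.NoTies m := by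
  simp only [NoTies, dist_map, hφ.injective.eq_iff]; rfl

end map

/-! ### Positions among the other candidates -/

section order
variable {K : Type} [Field K] [LinearOrder K] {D : Data K} {m : ℕ}

theorem pos_lt_pos {j i k : ℕ} (hi : i < D.n) (hi0 : 0 < i)
    (h : D.dist j i < D.dist j k) : D.pos j i < D.pos j k := by
  classical
  refine Finset.card_lt_card ((Finset.ssubset_iff_of_subset fun l hl => ?_).2 ⟨i, ?_, ?_⟩)
  · simp only [Finset.mem_filter] at hl ⊢
    exact ⟨hl.1, hl.2.1, hl.2.2.trans h⟩
  · simp [hi, hi0, h]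
  · simp

theorem pos_inj (hD : D.NoTies m) {j i k : ℕ} (hj : j < m) (hi : i < D.n) (hi0 : 0 < i)
    (hk : k < D.n) (hk0 : 0 < k) (h : D.pos j i = D.pos j k) : i = k := by
  rcases lt_trichotomy (D.dist j i) (D.dist j k) with h1 | h1 | h1
  · exact absurd h (pos_lt_pos hi hi0 h1).ne
  · exact hD j hj i hi k hk h1
  · exact absurd h.symm (pos_lt_pos hk hk0 h1).ne

/-- The set counted by the position misses both the target and the candidate itself. -/
theorem pos_succ_lt {j i : ℕ} (hi : i < D.n) (hi0 : 0 < i) : D.pos j i + 1 < D.n := by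
  classical
  have h1 : (Finset.range D.n).filter (fun k => 0 < k ∧ D.dist j k < D.dist j i) ⊆
      ((Finset.range D.n).erase 0).erase i := fun k hk => by
    simp only [Finset.mem_filter, Finset.mem_range] at hk
    simp only [Finset.mem_erase, Finset.mem_range]
    exact ⟨fun h => by simp [h] at hk, hk.2.1.ne', hk.1⟩
  have h2 := Finset.card_le_card h1
  rw [Finset.card_erase_of_mem (by simp [hi, hi0.ne']), Finset.card_erase_of_mem (by simp; omega),
    Finset.card_range] at h2
  simp only [pos]
  omega

/-- The `n - 1` other candidates have distinct positions below `n - 1`, so they fill all of them. -/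
theorem exists_pos_eq (hD : D.NoTies m) {j t : ℕ} (hj : j < m) (ht : t + 1 < D.n) :
    ∃ i < D.n, 0 < i ∧ D.pos j i = t := by
  classical
  have h : ((Finset.range D.n).erase 0).image (D.pos j) = Finset.range (D.n - 1) := by
    refine Finset.eq_of_subset_of_card_le (fun p hp => ?_) ?_
    · obtain ⟨i, hi, rfl⟩ := Finset.mem_image.1 hp
      simp only [Finset.mem_erase, Finset.mem_range] at hi ⊢
      have := pos_succ_lt (j := j) hi.2 (Nat.pos_of_ne_zero hi.1)
      omega
    · rw [Finset.card_image_of_injOn, Finset.card_erase_of_mem (by simp; omega)]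
      · simp
      · intro i hi k hk h
        simp only [Finset.coe_erase, Set.mem_sdiff, Finset.mem_coe, Finset.mem_range,
          Set.mem_singleton_iff] at hi hk
        exact pos_inj hD hj hi.1 (Nat.pos_of_ne_zero hi.2) hk.1 (Nat.pos_of_ne_zero hk.2) h
  have ht' : t ∈ ((Finset.range D.n).erase 0).image (D.pos j) := by
    rw [h, Finset.mem_range]; omega
  obtain ⟨i, hi, hit⟩ := Finset.mem_image.1 ht'
  simp only [Finset.mem_erase, Finset.mem_range] at hi
  exact ⟨i, hi.2, Nat.pos_of_ne_zero hi.1, hit⟩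

theorem Bounds.unique {g : Goal} {p p' t : ℕ} (h : Bounds g p t) (h' : Bounds g p' t) : p = p' := by
  cases g <;> simp only [Bounds] at h h' <;> omega

/-- Positions are injective in the absence of ties, so the sum in the definition has a single
summand. -/
theorem rad_eq_dist (hD : D.NoTies m) {g : Goal} {j i t : ℕ} (hj : j < m) (hi : i < D.n)
    (hi0 : 0 < i) (h : Bounds g (D.pos j i) t) : D.rad g j t = D.dist j i := by
  classical
  rw [rad, if_pos ⟨i, hi, hi0, h⟩]
  have : ((Finset.range D.n).filter fun i => 0 < i ∧ Bounds g (D.pos j i) t) = {i} := by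
    ext k
    simp only [Finset.mem_filter, Finset.mem_range, Finset.mem_singleton]
    constructor
    · rintro ⟨hk, hk0, h'⟩
      exact pos_inj hD hj hk hk0 hi hi0 (h'.unique h)
    · rintro rfl
      exact ⟨hi, hi0, h⟩
  convert Finset.sum_singleton _ i

theorem rad_eq_dflt {g : Goal} {j t : ℕ}
    (h : ∀ i < D.n, 0 < i → ¬ Bounds g (D.pos j i) t) : D.rad g j t = D.dflt g j := by
  rw [rad, if_neg]
  rintro ⟨i, hi, hi0, hb⟩
  exact h i hi hi0 hb

/-! ### Effect of the target's rank on the scores -/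

section anti
variable (hs : ∀ s t, s ≤ t → t < D.n → D.score t ≤ D.score s)
include hs

theorem virt_zero_le {j t t' : ℕ} (h : t ≤ t') (ht : t' < D.n) : D.virt j t' 0 ≤ D.virt j t 0 := by
  simpa [virt] using hs t t' h ht

/-- A later target shifts fewer candidates back by a place. Only a candidate with position between
`t` and `t'` changes its score, and it gains. -/
theorem virt_le {j t t' i : ℕ} (hi : i < D.n) (hi0 : 0 < i) (h : t ≤ t') :
    D.virt j t i ≤ D.virt j t' i := by
  have := pos_succ_lt (j := j) hi hi0
  simp only [virt, hi0.ne', if_false]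
  split_ifs
  · exact le_rfl
  · omega
  · exact hs _ _ (by omega) this
  · exact le_rfl

/-- The score is constant between the two ranks, so the candidates that shift by one place inside
this block keep their scores. -/
theorem virt_eq {j t t' : ℕ} (i : ℕ) (h : t ≤ t') (ht : t' < D.n) (he : D.score t = D.score t') :
    D.virt j t i = D.virt j t' i := by
  simp only [virt]
  split_ifs
  · exact he
  · rfl
  · omega
  · have h1 := hs t (D.pos j i) (by omega) (by omega)
    have h2 := hs (D.pos j i) (D.pos j i + 1) (by omega) (by omega)
    have h3 := hs (D.pos j i + 1) t' (by omega) (by omega)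
    exact le_antisymm h2 (by rw [← he] at h3; exact h1.trans h3)
  · rfl

/-- Take the last, respectively first, rank of the block of equal scores. It represents the weakest
demand on the target that still yields the same scores. -/
theorem exists_mark (g : Goal) {t : ℕ} (ht : t < D.n) : ∃ e < D.n, D.Mark g e ∧
    D.score e = D.score t ∧
    match g with
    | .constructive => t ≤ e
    | .destructive => e ≤ t := by
  classical
  set S := (Finset.range D.n).filter fun s => D.score s = D.score t with hS
  have htS : t ∈ S := by simp [hS, ht]
  have hmem : ∀ e, e ∈ S ↔ e < D.n ∧ D.score e = D.score t := fun e => by simp [hS]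
  cases g
  · have he := (hmem _).1 (S.max'_mem ⟨t, htS⟩)
    refine ⟨S.max' ⟨t, htS⟩, he.1, fun h => lt_of_le_of_ne (hs _ _ (by omega) h) fun h' => ?_, he.2,
      S.le_max' _ htS⟩
    have := S.le_max' _ ((hmem _).2 ⟨h, h'.trans he.2⟩)
    omega
  · have he := (hmem _).1 (S.min'_mem ⟨t, htS⟩)
    refine ⟨S.min' ⟨t, htS⟩, he.1, fun h => lt_of_le_of_ne (hs _ _ (by omega) he.1) fun h' => ?_,
      he.2, S.min'_le _ htS⟩
    have := S.min'_le _ ((hmem _).2 ⟨by omega, h'.symm.trans he.2⟩)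
    omega

/-- There are at most as many marked ranks as scores. -/
theorem blk_le (g : Goal) : D.blk g D.n ≤ (Set.range fun t : Fin D.n => D.score t).ncard := by
  classical
  rw [blk, ← Set.ncard_coe_finset]
  refine Set.ncard_le_ncard_of_injOn D.score (fun t ht => ?_) (fun s h1 t h2 h => ?_)
    (Set.finite_range _)
  · simp only [Finset.coe_filter, Finset.mem_range, Set.mem_ofPred_eq] at ht
    exact ⟨⟨t, ht.1⟩, rfl⟩
  · simp only [Finset.coe_filter, Finset.mem_range, Set.mem_ofPred_eq] at h1 h2
    by_contra hne
    -- A marked rank has a strict drop of the score next to it; for two marked ranks of equal score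
    -- that drop would lie between them, against monotonicity.
    wlog hlt : s < t generalizing s t
    · exact this t s h.symm h2 h1 (Ne.symm hne) (by omega)
    cases g
    · have h3 := h1.2 (by omega)
      have h4 := hs (s + 1) t (by omega) h2.1
      rw [h] at h3
      exact absurd h3 (not_lt.2 h4)
    · have h3 := h2.2 (by omega)
      have h4 := hs s (t - 1) (by omega) (by omega)
      rw [h] at h4
      exact absurd h3 (not_lt.2 h4)

end anti

/-- A set of candidates that is closed under taking closer ones, and its size. -/
theorem pos_lt_card_iff {j i : ℕ} {P : ℕ → Prop} [DecidablePred P] (hi : i < D.n) (hi0 : 0 < i)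
    (hP : ∀ i k, D.dist j i ≤ D.dist j k → P k → P i) :
    D.pos j i < ((Finset.range D.n).filter fun k => 0 < k ∧ P k).card ↔ P i := by
  classical
  constructor
  · intro h
    by_contra hPi
    refine absurd h (not_lt.2 (Finset.card_le_card fun k hk => ?_))
    simp only [Finset.mem_filter] at hk ⊢
    exact ⟨hk.1, hk.2.1, not_le.1 fun hle => hPi (hP i k hle hk.2.2)⟩
  · intro h
    refine Finset.card_lt_card ((Finset.ssubset_iff_of_subset fun k hk => ?_).2 ⟨i, ?_, ?_⟩)
    · simp only [Finset.mem_filter] at hk ⊢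
      exact ⟨hk.1, hk.2.1, hP k i hk.2.2.le h⟩
    · simp [hi, hi0, h]
    · simp

end order

end Data

/-! ### Manipulability in terms of scenarios -/

/-- The data of an instance. -/
def Instance.data {K : Type} [Zero K] {n d m : ℕ} (I : Instance K n d m) : Data K where
  n := n
  d := d
  cand i k := if h : i < n ∧ k < d then I.cand ⟨i, h.1⟩ ⟨k, h.2⟩ else 0
  voter j k := if h : j < m ∧ k < d then I.voter ⟨j, h.1⟩ ⟨k, h.2⟩ else 0
  score k := if h : k < n then I.score ⟨k, h⟩ else 0
  budget := I.budget

theorem Instance.data_map {K L : Type} [Field K] [Field L] {n d m : ℕ} (φ : K →+* L)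
    (I : Instance K n d m) : (I.map φ).data = I.data.map φ := by
  simp only [Instance.data, Data.map, Instance.map, Data.mk.injEq, true_and, and_true]
  refine ⟨?_, ?_, ?_⟩ <;> funext <;> split_ifs <;> simp

theorem l2dist_eq {d : ℕ} (x y : Fin d → ℝ) : l2dist x y = √(∑ k, (x k - y k) ^ 2) := by
  simp [l2dist, EuclideanSpace.dist_eq, Real.dist_eq, sq_abs]

theorem card_filter_fin (n : ℕ) (P : ℕ → Prop) [DecidablePred P] :
    (Finset.univ.filter fun i : Fin n => P i).card = ((Finset.range n).filter P).card := by
  rw [Finset.card_filter, Finset.card_filter, Finset.sum_range]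

section
variable {n d m : ℕ} {I : Instance ℝ n d m}

/-- Squared distance of voter `j` and a point. -/
def Instance.sqDist (I : Instance ℝ n d m) (j : Fin m) (x : Fin d → ℝ) : ℝ :=
  ∑ k, (x k - I.voter j k) ^ 2

theorem Instance.dist_data (I : Instance ℝ n d m) (j : Fin m) (i : Fin n) :
    I.data.dist j i = I.sqDist j (I.cand i) := by
  simp only [Data.dist, Data.dot, Instance.sqDist]
  change ∑ k ∈ Finset.range d, _ = _
  rw [Finset.sum_range]
  refine Finset.sum_congr rfl fun k _ => ?_
  simp [Instance.data]
  ring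

theorem l2dist_voter (I : Instance ℝ n d m) (j : Fin m) (x : Fin d → ℝ) :
    l2dist (I.voter j) x = √(I.sqDist j x) := by
  rw [l2dist_eq, Instance.sqDist]
  simp only [sub_sq_comm]

theorem Instance.sqDist_nonneg (I : Instance ℝ n d m) (j : Fin m) (x : Fin d → ℝ) :
    0 ≤ I.sqDist j x := Finset.sum_nonneg fun _ _ => sq_nonneg _

/-- A candidate at squared distance `a` is ranked ahead of the target candidate at squared
distance `b`. -/
def BeatsTarget (g : Goal) (a b : ℝ) : Prop :=
  match g with
  | .constructive => a < b
  | .destructive => a ≤ b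

open Classical in
/-- The rank of the target candidate at `x`. -/
noncomputable def Instance.targetRank (I : Instance ℝ n d m) (g : Goal) (x : Fin d → ℝ)
    (j : Fin m) : ℕ :=
  ((Finset.range n).filter fun k => 0 < k ∧ BeatsTarget g (I.data.dist j k) (I.sqDist j x)).card

theorem Instance.pos_lt_targetRank_iff (g : Goal) (x : Fin d → ℝ) (j : Fin m) {i : ℕ} (hi : i < n)
    (hi0 : 0 < i) : I.data.pos j i < I.targetRank g x j ↔
      BeatsTarget g (I.data.dist j i) (I.sqDist j x) := by
  classical
  refine Data.pos_lt_card_iff (D := I.data) hi hi0 fun i k h hk => ?_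
  cases g
  · exact lt_of_le_of_lt h hk
  · exact le_trans h hk

theorem Instance.Valid.score_anti (hI : I.Valid) (s t : ℕ) (h : s ≤ t) (ht : t < n) :
    I.data.score t ≤ I.data.score s := by
  simp only [Instance.data, ht, h.trans_lt ht, dif_pos]
  exact hI.antitone_score (by simpa using h)

theorem Instance.Valid.noTies (hI : I.Valid) : I.data.NoTies m := by
  intro j hj i hi k hk h
  have h1 := I.dist_data ⟨j, hj⟩ ⟨i, hi⟩
  have h2 := I.dist_data ⟨j, hj⟩ ⟨k, hk⟩
  simp only at h1 h2
  have := hI.no_ties ⟨j, hj⟩ (a₁ := ⟨i, hi⟩) (a₂ := ⟨k, hk⟩)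
    (by simp only [l2dist_voter, ← h1, ← h2, h])
  exact congrArg Fin.val this

/-! ### Ranks after the manipulation -/

variable [NeZero n]

theorem Instance.targetRank_lt (g : Goal) (x : Fin d → ℝ) (j : Fin m) : I.targetRank g x j < n := by
  classical
  have hn : 0 < n := Nat.pos_of_ne_zero (NeZero.ne n)
  refine lt_of_lt_of_eq (Finset.card_lt_card ((Finset.ssubset_iff_of_subset
    (Finset.filter_subset _ _)).2 ⟨0, by simpa using hn, by simp⟩)) (Finset.card_range n)

/-- Only comparisons involving the target depend on `x` and on the tie rule; both are absorbed in
`BeatsTarget`. -/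
theorem ahead_iff (g : Goal) (x : Fin d → ℝ) (j : Fin m) (k i : Fin n) :
    Ahead g (I.perceived x) (I.voter j) k i ↔
      if k = 0 then i ≠ 0 ∧ ¬ BeatsTarget g (I.data.dist j i) (I.sqDist j x)
      else if i = 0 then BeatsTarget g (I.data.dist j k) (I.sqDist j x)
      else I.data.dist j k < I.data.dist j i := by
  have hlt : ∀ y z : Fin d → ℝ, l2dist (I.voter j) y < l2dist (I.voter j) z ↔
      I.sqDist j y < I.sqDist j z := fun y z => by
    rw [l2dist_voter, l2dist_voter, Real.sqrt_lt_sqrt_iff (I.sqDist_nonneg j y)]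
  have heq : ∀ y z : Fin d → ℝ, l2dist (I.voter j) y = l2dist (I.voter j) z ↔
      I.sqDist j y = I.sqDist j z := fun y z => by
    rw [l2dist_voter, l2dist_voter, Real.sqrt_inj (I.sqDist_nonneg j y) (I.sqDist_nonneg j z)]
  simp only [Ahead, hlt, heq, Instance.perceived, Instance.dist_data]
  by_cases hk : k = 0 <;> by_cases hi : i = 0 <;> cases g <;>
    simp [hk, hi, BeatsTarget, le_iff_lt_or_eq]
  rw [← le_iff_lt_or_eq, lt_iff_le_and_ne, ne_comm]

theorem rank_zero (g : Goal) (x : Fin d → ℝ) (j : Fin m) :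
    (rank g (I.perceived x) (I.voter j) 0 : ℕ) = I.targetRank g x j := by
  classical
  have h := card_filter_fin n fun k => 0 < k ∧ BeatsTarget g (I.data.dist j k) (I.sqDist j x)
  simp only [rank, Instance.targetRank]
  refine Eq.trans ?_ (h.trans ?_)
  · congr 1
    ext k
    simp only [Finset.mem_filter, Finset.mem_univ, true_and, ahead_iff]
    by_cases hk : k = 0
    · simp [hk]
    · simp [hk, Fin.pos_iff_ne_zero]
  · congr

/-- The candidates ahead of `i` are those counted by its position, together with the target unless
`i` beats it. -/
theorem rank_ne_zero (g : Goal) (x : Fin d → ℝ) (j : Fin m) {i : Fin n} (hi : i ≠ 0) :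
    (rank g (I.perceived x) (I.voter j) i : ℕ) =
      if I.data.pos j i < I.targetRank g x j then I.data.pos j i else I.data.pos j i + 1 := by
  classical
  have hi0 : 0 < (i : ℕ) := Nat.pos_of_ne_zero fun h => hi (Fin.ext (by simpa using h))
  simp only [Instance.pos_lt_targetRank_iff g x j i.2 hi0]
  have h := card_filter_fin n fun k => 0 < k ∧ I.data.dist j k < I.data.dist j i
  have hpos : (Finset.univ.filter fun k : Fin n =>
      0 < (k : ℕ) ∧ I.data.dist j k < I.data.dist j i).card = I.data.pos j i := by
    rw [h, Data.pos]; congr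
  simp only [rank, ahead_iff, if_neg hi]
  have hk0 : ∀ k : Fin n, 0 < (k : ℕ) ↔ k ≠ 0 := fun k => by
    rw [Nat.pos_iff_ne_zero, ne_eq, ne_eq, Fin.ext_iff]; simp
  by_cases hb : BeatsTarget g (I.data.dist j i) (I.sqDist j x)
  · rw [if_pos hb, ← hpos]
    congr 1
    ext k
    simp only [Finset.mem_filter, Finset.mem_univ, true_and, hk0]
    by_cases hk : k = 0 <;> simp [hk, hi, hb]
  · rw [if_neg hb, ← hpos, ← Finset.card_insert_of_notMem (a := (0 : Fin n)) (by simp)]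
    congr 1
    ext k
    simp only [Finset.mem_filter, Finset.mem_univ, true_and, hk0, Finset.mem_insert]
    by_cases hk : k = 0 <;> simp [hk, hi, hb]

theorem Instance.score_rank (g : Goal) (x : Fin d → ℝ) (j : Fin m) (i : Fin n) :
    I.score (rank g (I.perceived x) (I.voter j) i) =
      I.data.virt j (I.targetRank g x j) i := by
  have hsc : ∀ t : Fin n, I.score t = I.data.score t := fun t => by simp [Instance.data]
  rw [hsc, Data.virt]
  by_cases hi : i = 0
  · subst hi
    rw [rank_zero]; simp
  · have hi0 : (i : ℕ) ≠ 0 := fun h => hi (Fin.ext (by simpa using h))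
    rw [rank_ne_zero g x j hi, if_neg hi0]
    split_ifs <;> rfl

open Classical in
/-- The ranks of the target candidate, indexed by natural numbers. -/
noncomputable def Instance.ranks (I : Instance ℝ n d m) (g : Goal) (x : Fin d → ℝ) (j : ℕ) : ℕ :=
  if h : j < m then I.targetRank g x ⟨j, h⟩ else 0

theorem Instance.total_eq (g : Goal) (x : Fin d → ℝ) (i : Fin n) :
    I.total g x i = ∑ j ∈ Finset.range m, I.data.virt j (I.ranks g x j) i := by
  rw [Finset.sum_range, Instance.total]
  exact Finset.sum_congr rfl fun j _ => by simp [I.score_rank, Instance.ranks]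

theorem Instance.succeeds_iff (g : Goal) (x : Fin d → ℝ) :
    I.Succeeds g x ↔ I.data.Elected g m (I.ranks g x) := by
  cases g
  · simp only [Instance.Succeeds, Data.Elected, I.total_eq, Fin.forall_iff]
    simp [Instance.data]
  · simp only [Instance.Succeeds, Data.Elected, I.total_eq, Fin.val_zero]
    constructor
    · rintro ⟨i, hi, h⟩
      exact ⟨i, i.2, Nat.pos_of_ne_zero fun h0 => hi (Fin.ext (by simpa using h0)), h⟩
    · rintro ⟨i, hi, hi0, h⟩
      exact ⟨⟨i, hi⟩, fun h0 => hi0.ne' (by simpa [Fin.ext_iff] using h0), h⟩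

/-- The distance bound for a rank expresses a bound on the rank of the target candidate. -/
theorem Instance.Valid.rad_iff (hI : I.Valid) (g : Goal) {x : Fin d → ℝ}
    (hx : ∑ k, (x k - I.cand 0 k) ^ 2 ≤ I.budget * I.budget) (j : Fin m) {t : ℕ} (ht : t < n) :
    match g with
    | .constructive => I.sqDist j x ≤ I.data.rad g j t ↔ I.targetRank g x j ≤ t
    | .destructive => I.data.rad g j t ≤ I.sqDist j x ↔ t ≤ I.targetRank g x j := by
  have hinj := hI.noTies
  have hex : ∀ t, t + 1 < n → _ := fun t h => Data.exists_pos_eq (D := I.data) (t := t) hinj j.2 h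
  have hrad : ∀ g t i, i < n → 0 < i → _ := fun g t i h h' =>
    Data.rad_eq_dist (D := I.data) (g := g) (t := t) hinj j.2 h h'
  have hlt : ∀ {i}, i < n → 0 < i → _ := fun {i} h h' =>
    Instance.pos_lt_targetRank_iff (I := I) g x j h h'
  cases g
  · by_cases h : t + 1 < n
    · obtain ⟨i, hi, hi0, hit⟩ := hex t h
      have := hlt hi hi0
      simp only
      rw [hrad .constructive t i hi hi0 hit, ← not_lt, ← not_lt]
      rw [hit] at this
      exact not_congr this.symm
    -- The last rank demands nothing, as there is no other candidate at this position; the default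
    -- bound has to hold throughout the budget ball.
    · have h1 := I.targetRank_lt .constructive x j
      have h2 : I.data.rad .constructive j t = I.data.dflt .constructive j := by
        refine Data.rad_eq_dflt fun i hi hi0 hb => ?_
        have h3 : I.data.pos j i + 1 < n := Data.pos_succ_lt (D := I.data) hi hi0
        simp only [Data.Bounds] at hb
        omega
      simp only
      rw [h2]
      refine iff_of_true ?_ (by omega)
      have h4 := I.dist_data j 0
      -- The inequality `(p + q)² ≤ 2 p² + 2 q²` in each coordinate; it is the reason for the
      -- doubled sum in `Data.dflt`.
      have h5 : I.sqDist j x ≤ 2 * ∑ k, (x k - I.cand 0 k) ^ 2 + 2 * I.sqDist j (I.cand 0) := by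
        simp only [Instance.sqDist, Finset.mul_sum, ← Finset.sum_add_distrib]
        refine Finset.sum_le_sum fun k _ => ?_
        nlinarith [sq_nonneg (x k - I.cand 0 k - (I.cand 0 k - I.voter j k))]
      simp only [Fin.val_zero] at h4
      simp only [Data.dflt, h4]
      have h6 : I.data.budget = I.budget := rfl
      rw [h6]
      linarith
  · rcases t with _ | t
    -- Being ranked first or worse is no demand, and the bound zero always holds.
    · have h2 : I.data.rad .destructive j 0 = 0 := by
        refine Data.rad_eq_dflt fun i hi hi0 hb => ?_
        simp [Data.Bounds] at hb
      simp only
      rw [h2]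
      exact iff_of_true (I.sqDist_nonneg j x) (Nat.zero_le _)
    · obtain ⟨i, hi, hi0, hit⟩ := hex t ht
      have := hlt hi hi0
      simp only
      rw [hrad _ (t + 1) i hi hi0 (by simp [Data.Bounds, hit])]
      rw [hit] at this
      exact this.symm

theorem l2dist_le_budget (hI : I.Valid) (x : Fin d → ℝ) : l2dist x (I.cand 0) ≤ I.budget ↔
    ∑ k, (x k - I.cand 0 k) ^ 2 ≤ I.budget * I.budget := by
  rw [l2dist_eq, Real.sqrt_le_left hI.budget_pos.le, sq I.budget]

theorem Instance.feasible_iff (g : Goal) (ρ : ℕ → ℝ) : I.data.Feasible g m ρ ↔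
    ∃ x : Fin d → ℝ, ∑ k, (x k - I.cand 0 k) ^ 2 ≤ I.budget * I.budget ∧
      ∀ j : Fin m, match g with
        | .constructive => I.sqDist j x ≤ ρ j
        | .destructive => ρ j ≤ I.sqDist j x := by
  have hn : 0 < n := Nat.pos_of_ne_zero (NeZero.ne n)
  have h1 : ∀ x : Fin d → ℝ, ∑ k : Fin d, (x k - I.data.cand 0 k) ^ 2 =
      ∑ k, (x k - I.cand 0 k) ^ 2 := fun x =>
    Finset.sum_congr rfl fun k _ => by simp [Instance.data, hn]
  have h2 : ∀ (x : Fin d → ℝ) (j : Fin m), ∑ k : Fin d, (x k - I.data.voter j k) ^ 2 =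
      I.sqDist j x := fun x j =>
    Finset.sum_congr rfl fun k _ => by simp [Instance.data]
  refine exists_congr fun x => and_congr
    (iff_of_eq (congrArg (· ≤ I.budget * I.budget) (h1 x))) ?_
  rw [Fin.forall_iff]
  refine forall_congr' fun j => forall_congr' fun hj => ?_
  rw [← h2 x ⟨j, hj⟩]
  rfl

/-- From a successful position, replace each actual rank by the marked rank of the same score: no
score changes and the distance bounds hold. Conversely the bounds only give ranks at least as
favourable as `e`, and monotonicity of the scores in the target's rank carries success over to the
actual ranks. -/
theorem Instance.Valid.manipulable_iff (hI : I.Valid) (g : Goal) : I.Manipulable g ↔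
    ∃ e : ℕ → ℕ, (∀ j < m, e j < n ∧ I.data.Mark g (e j)) ∧ I.data.Elected g m e ∧
      I.data.Feasible g m fun j => I.data.rad g j (e j) := by
  have hs := hI.score_anti
  have hrk : ∀ g x j, I.ranks g x j < n := fun g x j => by
    rw [Instance.ranks]; split_ifs
    exacts [I.targetRank_lt g x _, Nat.pos_of_ne_zero (NeZero.ne n)]
  simp only [Instance.Manipulable, l2dist_le_budget hI, I.succeeds_iff, I.feasible_iff]
  constructor
  · rintro ⟨x, hx, hel⟩
    have hm := fun j => Data.exists_mark (D := I.data) hs g (hrk g x j)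
    choose e he hem hes hee using hm
    refine ⟨e, fun j _ => ⟨he j, hem j⟩, ?_, x, hx, fun j => ?_⟩
    · have hv : ∀ j i, I.data.virt j (I.ranks g x j) i = I.data.virt j (e j) i := fun j i => by
        cases g
        · exact Data.virt_eq hs i (hee j) (he j) (hes j).symm
        · exact (Data.virt_eq hs i (hee j) (hrk _ x j) (hes j)).symm
      cases g <;> simpa only [Data.Elected, hv] using hel
    · have h1 := hI.rad_iff g hx j (he j)
      have h2 : I.ranks g x j = I.targetRank g x j := by simp [Instance.ranks]
      have h3 := hee j
      cases g
      · exact h1.2 (h2 ▸ h3)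
      · exact h1.2 (h2 ▸ h3)
  · rintro ⟨e, he, hel, x, hx, hf⟩
    refine ⟨x, hx, ?_⟩
    cases g
    · have hle : ∀ j ∈ Finset.range m, I.ranks .constructive x j ≤ e j := fun j hj => by
        have hj' := Finset.mem_range.1 hj
        rw [Instance.ranks, dif_pos hj']
        exact (hI.rad_iff .constructive hx ⟨j, hj'⟩ (he j hj').1).1 (hf ⟨j, hj'⟩)
      have h0 : ∑ j ∈ Finset.range m, I.data.virt j (e j) 0 ≤
          ∑ j ∈ Finset.range m, I.data.virt j (I.ranks .constructive x j) 0 :=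
        Finset.sum_le_sum fun j hj =>
          Data.virt_zero_le hs (hle j hj) (he j (Finset.mem_range.1 hj)).1
      intro i hi
      rcases Nat.eq_zero_or_pos i with rfl | hi0
      · exact le_rfl
      · exact ((Finset.sum_le_sum fun j hj => Data.virt_le hs hi hi0 (hle j hj)).trans
          (hel i hi)).trans h0
    · have hle : ∀ j ∈ Finset.range m, e j ≤ I.ranks .destructive x j := fun j hj => by
        have hj' := Finset.mem_range.1 hj
        rw [Instance.ranks, dif_pos hj']
        exact (hI.rad_iff .destructive hx ⟨j, hj'⟩ (he j hj').1).1 (hf ⟨j, hj'⟩)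
      obtain ⟨i, hi, hi0, h⟩ := hel
      exact ⟨i, hi, hi0, ((Finset.sum_le_sum fun j hj =>
        Data.virt_zero_le hs (hle j hj) (hrk _ x j)).trans h).trans
        (Finset.sum_le_sum fun j hj => Data.virt_le hs hi hi0 (hle j hj))⟩

end

/-- The question, in terms of the numbers of the instance, for an ordered field inside the reals. -/
theorem manipulable_iff_exists {K : Type} [Field K] [LinearOrder K] {φ : K →+* ℝ}
    (hφ : StrictMono φ) {n d m : ℕ} [NeZero n] {I : Instance K n d m} (hI : (I.map φ).Valid)
    (g : Goal) {ψ : Fm (Var m)}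
    (hψ : ∀ (D : Data ℝ) (ρ : ℕ → ℝ), ψ.Holds (D.env m ρ) ↔ D.Feasible g m ρ) :
    (I.map φ).Manipulable g ↔
      ∃ e : ℕ → ℕ, (∀ j < m, e j < n ∧ I.data.Mark g (e j)) ∧ I.data.Elected g m e ∧
        ψ.Holds (I.data.env m fun j => I.data.rad g j (e j)) := by
  rw [hI.manipulable_iff, Instance.data_map]
  simp only [Data.mark_map _ hφ, Data.elected_map _ hφ, ← hψ, Data.rad_map _ hφ, Data.env_map,
    Fm.holds_map φ hφ]

/-! ### Programs for the parameters and the distances -/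

section
variable {K : Type}

/-- The store contains the data. -/
structure Input (D : Data K) (s : Store K) : Prop where
  n : s.reg 0 = D.n
  d : s.reg 1 = D.d
  zero : s.reg 3 = 0
  cand : s.mem 0 = D.cand
  voter : s.mem 1 = D.voter
  score : ∀ k, s.mem 2 0 k = D.score k
  budget : s.mem 3 0 0 = D.budget

/-- The program does not overwrite the data. -/
def Prog.KeepsInput (p : Prog) : Prop :=
  (∀ r, p.WR r → r ≠ 0 ∧ r ≠ 1 ∧ r ≠ 3) ∧ ∀ a, p.WA a → 4 ≤ a

theorem Input.of_same {D : Data K} {s s' : Store K} (h : Input D s) {p : Prog}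
    (hs : Same p s s') (hp : p.KeepsInput) : Input D s' where
  n := (hs.1 0 fun hw => (hp.1 _ hw).1 rfl).trans h.n
  d := (hs.1 1 fun hw => (hp.1 _ hw).2.1 rfl).trans h.d
  zero := (hs.1 3 fun hw => (hp.1 _ hw).2.2 rfl).trans h.zero
  cand := (hs.2 0 fun hw => by have := hp.2 _ hw; omega).trans h.cand
  voter := (hs.2 1 fun hw => by have := hp.2 _ hw; omega).trans h.voter
  score k := by rw [hs.2 2 fun hw => by have := hp.2 _ hw; omega]; exact h.score k
  budget := by rw [hs.2 3 fun hw => by have := hp.2 _ hw; omega]; exact h.budget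

variable [Field K]

/-- A bound on the sizes of the parameters of the geometric question. -/
def Data.height (D : Data K) (L : ℕ) : ℕ := 2 * (D.d * (4 * L + 4) + 1) + 4 * L + D.d + 6

/-- The bounds of the meter are large enough for data of size at most `L`. -/
structure Fits (M : Meter K) (D : Data K) (m L : ℕ) : Prop where
  cand : ∀ i k, M.ht (D.cand i k) ≤ L
  voter : ∀ j k, M.ht (D.voter j k) ≤ L
  score : ∀ k, M.ht (D.score k) ≤ L
  budget : M.ht D.budget ≤ L
  height : D.height L ≤ M.H
  sum : m * (L + 1) + 1 ≤ M.H
  reg : D.n + D.d + m + 2 ≤ M.R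

namespace Fits
variable {M : Meter K} {D : Data K} {m L : ℕ} (hF : Fits M D m L)
include hF

theorem ht_diff (j i k : ℕ) : M.ht (D.voter j k - D.cand i k) ≤ 2 * L + 1 := by
  have h := M.ht_op .sub (D.voter j k) (D.cand i k)
  have h1 := hF.voter j k
  have h2 := hF.cand i k
  simp only [ArithOp.eval] at h
  omega

theorem ht_prod (j l i k : ℕ) :
    M.ht ((D.voter j k - D.cand i k) * (D.voter l k - D.cand i k)) ≤ 4 * L + 3 := by
  have h := M.ht_op .mul (D.voter j k - D.cand i k) (D.voter l k - D.cand i k)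
  have h1 := hF.ht_diff j i k
  have h2 := hF.ht_diff l i k
  simp only [ArithOp.eval] at h
  omega

/-- A product of two differences has height at most `4 * L + 3`, and each addition contributes one
more. -/
theorem ht_sum (j l i c : ℕ) : M.ht (∑ k ∈ Finset.range c,
    (D.voter j k - D.cand i k) * (D.voter l k - D.cand i k)) ≤ c * (4 * L + 4) + 1 := by
  induction c with
  | zero => simpa using M.ht_int 0
  | succ c ih =>
    rw [Finset.sum_range_succ]
    have h := M.ht_op .add (∑ k ∈ Finset.range c,
      (D.voter j k - D.cand i k) * (D.voter l k - D.cand i k))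
      ((D.voter j c - D.cand i c) * (D.voter l c - D.cand i c))
    have h1 := hF.ht_prod j l i c
    simp only [ArithOp.eval] at h
    rw [Nat.succ_mul]
    omega

theorem ht_dot (j l i : ℕ) : M.ht (D.dot j l i) ≤ D.d * (4 * L + 4) + 1 := hF.ht_sum j l i D.d

theorem ht_sq : M.ht (D.budget * D.budget) ≤ 2 * L + 1 := by
  have h := M.ht_op .mul D.budget D.budget
  have h1 := hF.budget
  simp only [ArithOp.eval] at h
  omega

theorem ht_dist_add (j : ℕ) :
    M.ht (D.dist j 0 + D.budget * D.budget) ≤ D.d * (4 * L + 4) + 2 * L + 3 := by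
  have h := M.ht_op .add (D.dist j 0) (D.budget * D.budget)
  have h1 := hF.ht_sq
  have h2 := hF.ht_dot j j 0
  simp only [ArithOp.eval] at h
  simp only [Data.dist] at *
  omega

theorem ht_dflt [LinearOrder K] (g : Goal) (j : ℕ) : M.ht (D.dflt g j) ≤ D.height L := by
  cases g
  · have h := M.ht_op .add (D.dist j 0 + D.budget * D.budget) (D.dist j 0 + D.budget * D.budget)
    have h1 := hF.ht_dist_add j
    simp only [ArithOp.eval] at h
    simp only [Data.dflt, Data.height] at *
    omega
  · have := M.ht_int 0
    simp only [Int.cast_zero, Int.natAbs_zero] at this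
    simp only [Data.dflt, Data.height]
    omega

theorem ht_dist (j i : ℕ) : M.ht (D.dist j i) ≤ D.height L := by
  have := hF.ht_dot j j i
  simp only [Data.dist, Data.height]
  omega

theorem one_le : 1 ≤ M.H := by have := hF.sum; omega

end Fits
end

theorem Meter.ht_nat_le {K : Type} [Field K] (M : Meter K) (k : ℕ) : M.ht (k : K) ≤ k + 1 := by
  simpa using M.ht_int k

/-- The inner product of the voters in registers `J` and `L` seen from the candidate in
register `I`. -/
def dotProg (J L I : ℕ) : Prog :=
  .seq (.const (tmpCell 0) 0) (.forLoop 4 1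
    (.seq (.arith .sub (tmpCell 1) ⟨1, J, 4⟩ ⟨0, I, 4⟩)
      (.seq (.arith .sub (tmpCell 2) ⟨1, L, 4⟩ ⟨0, I, 4⟩)
        (.seq (.arith .mul (tmpCell 1) (tmpCell 1) (tmpCell 2))
          (.arith .add (tmpCell 0) (tmpCell 0) (tmpCell 1))))))

@[simp] theorem WR_dotProg {J L I x : ℕ} : (dotProg J L I).WR x ↔ x = 4 := by
  simp [dotProg]

@[simp] theorem WA_dotProg {J L I x : ℕ} :
    (dotProg J L I).WA x ↔ x = 8 ∨ x = 16 ∨ x = 24 := by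
  simp [dotProg, tmpCell]; tauto

section
variable {K : Type} [Field K] [LinearOrder K] {M : Meter K} {D : Data K} {m L : ℕ} {s : Store K}

theorem runs_dotProg (hF : Fits M D m L) (hI : Input D s) {J J' I : ℕ} (hJ : J ≠ 4) (hJ' : J' ≠ 4)
    (hI4 : I ≠ 4) : Runs M (dotProg J J' I) (D.d * 6 + 3) s fun s' =>
      s'.mem 8 0 0 = D.dot (s.reg J) (s.reg J') (s.reg I) := by
  refine (runs_seq (N := 1) (N' := D.d * 6 + 2) (runs_const (by simpa using hF.one_le)
    fun hs0 => ?_)).weaken (by omega)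
  have h3 := hI.zero
  refine runs_forLoop (N := 4) (fun k s' => s'.mem 8 0 0 = ∑ k ∈ Finset.range k,
    (D.voter (s.reg J) k - D.cand (s.reg I) k) * (D.voter (s.reg J') k - D.cand (s.reg I) k))
    (by simpa [Store.set] using hI.d) (by simp) (by simp) (by simp) ?_ ?_ ?_
  · simp [Store.setReg, Store.set, tmpCell, h3]
  · intro k hk s' hs hk4 hsum
    have hin : Input D s' := (hI.of_same hs0 (by simp [Prog.KeepsInput, tmpCell])).of_same hs
      (by simp [Prog.KeepsInput, tmpCell])
    have hrJ : s'.reg J = s.reg J := by rw [hs.1 J (by simp [hJ])]; rfl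
    have hrJ' : s'.reg J' = s.reg J' := by rw [hs.1 J' (by simp [hJ'])]; rfl
    have hrI : s'.reg I = s.reg I := by rw [hs.1 I (by simp [hI4])]; rfl
    have h3' := hin.zero
    have hH := hF.height
    simp only [Data.height] at hH
    have e1 := hF.ht_diff (s.reg J) (s.reg I) k
    have e2 := hF.ht_diff (s.reg J') (s.reg I) k
    have e3 := hF.ht_prod (s.reg J) (s.reg J') (s.reg I) k
    have e4 := hF.ht_sum (s.reg J) (s.reg J') (s.reg I) (k + 1)
    have e5 : (k + 1) * (4 * L + 4) ≤ D.d * (4 * L + 4) := Nat.mul_le_mul_right _ hk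
    refine runs_seq (N := 1) (N' := 3) (runs_arith ?_ fun _ => runs_seq (N := 1) (N' := 2)
      (runs_arith ?_ fun _ => runs_seq (N := 1) (N' := 1) (runs_arith ?_ fun _ =>
        runs_arith ?_ fun _ => ?_)))
    all_goals
      simp [Store.get, Store.set, Store.setReg, tmpCell, hrJ, hrJ', hrI, h3', hk4, hin.cand,
        hin.voter, ArithOp.eval, hsum, ← Finset.sum_range_succ]
    all_goals omega
  · intro s' _ _ h
    exact h

end

section
variable {K : Type} [Field K] [LinearOrder K] {M : Meter K} {D : Data K} {m L : ℕ} {s : Store K}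

/-- An unrolled loop whose rounds do not disturb each other. -/
theorem runs_unroll_posts {P : ℕ → Prog} {k N : ℕ} (Post : ℕ → Store K → Prop)
    (hpres : ∀ i < k, ∀ i' < k, i ≠ i' → ∀ s₁ s₂, Same (P i') s₁ s₂ → Post i s₁ → Post i s₂)
    (h : ∀ i < k, ∀ s', Same (.unroll P k) s s' → Runs M (P i) N s' (Post i)) :
    Runs M (.unroll P k) (k * N + 1) s fun s' => ∀ i < k, Post i s' := by
  refine runs_unroll (fun j s' => ∀ i < j, Post i s') (by simp) (fun j hj s' hs hI => ?_)
    (fun _ _ h => h)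
  refine (h j hj s' hs).mono le_rfl fun s'' hs' hp _ i hi => ?_
  rcases Nat.lt_succ_iff_lt_or_eq.1 hi with hi | rfl
  · exact hpres i (by omega) j hj (by omega) s' s'' hs' (hI i hi)
  · exact hp

end

/-- Computes the squared budget. -/
def sqProg : Prog := .arith .mul (varCell 0) ⟨3, 3, 3⟩ ⟨3, 3, 3⟩

/-- Computes the dimension as a number. -/
def dimProg : Prog :=
  .seq (.const (tmpCell 0) 1) (.seq (.const (varCell 1) 0)
    (.forLoop 4 1 (.arith .add (varCell 1) (varCell 1) (tmpCell 0))))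

/-- Computes an entry of the Gram matrix. -/
def gramProg (m i : ℕ) : Prog :=
  .seq (.load 5 (i / m)) (.seq (.load 6 (i % m))
    (.seq (dotProg 5 6 3) (.move (varCell (4 * i + 3)) (tmpCell 0))))

/-- Computes a coordinate of a voter with the target candidate at the origin. -/
def coordProg (m i : ℕ) : Prog :=
  .seq (.load 5 (i / m)) (.seq (.load 6 (i % m))
    (.arith .sub (varCell (4 * i + 4)) ⟨1, 5, 6⟩ ⟨0, 3, 6⟩))

/-- Computes all the parameters of the geometric question except the squared radii. -/
def paramProg (m : ℕ) : Prog :=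
  .seq sqProg (.seq dimProg
    (.seq (.unroll (gramProg m) (m * m)) (.unroll (coordProg m) (m * m))))

/-- Computes the squared distances of all candidates to voter `j`. -/
def distProg (j : ℕ) : Prog :=
  .seq (.load 5 j) (.forLoop 7 0 (.seq (dotProg 5 5 7) (.move ⟨8 * j + 4, 3, 7⟩ (tmpCell 0))))

/-- The store contains the parameters. -/
structure Params {K : Type} [Field K] (D : Data K) (m : ℕ) (s : Store K) : Prop where
  sq : s.mem 7 0 0 = D.budget * D.budget
  dim : s.mem 15 0 0 = D.d
  gram : ∀ i < m * m, s.mem (8 * (4 * i + 3) + 7) 0 0 = D.dot (i / m) (i % m) 0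
  coord : ∀ i < m * m, s.mem (8 * (4 * i + 4) + 7) 0 0 =
    D.voter (i / m) (i % m) - D.cand 0 (i % m)

/-- Scalars whose number is 2 modulo 4 hold the squared radii, the only parameters that change
between scenarios. -/
theorem Params.of_same {K : Type} [Field K] {D : Data K} {m : ℕ} {s s' : Store K}
    (h : Params D m s) {p : Prog} (hs : Same p s s') (hp : ∀ v, p.WA (8 * v + 7) → v % 4 = 2) :
    Params D m s' where
  sq := by rw [hs.2 7 fun hw => by have := hp 0 hw; omega]; exact h.sq
  dim := by rw [hs.2 15 fun hw => by have := hp 1 hw; omega]; exact h.dim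
  gram i hi := by
    rw [hs.2 _ fun hw => by have := hp (4 * i + 3) hw; omega]; exact h.gram i hi
  coord i hi := by
    rw [hs.2 _ fun hw => by have := hp (4 * i + 4) hw; omega]; exact h.coord i hi

section
variable {K : Type} [Field K] [LinearOrder K] {M : Meter K} {D : Data K} {m L : ℕ} {s : Store K}

theorem runs_sqProg (hF : Fits M D m L) (hI : Input D s) :
    Runs M sqProg 1 s fun s' => s'.mem 7 0 0 = D.budget * D.budget := by
  have h3 := hI.zero
  have hb : s.get ⟨3, 3, 3⟩ = D.budget := by simp [Store.get, h3, hI.budget]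
  have hH := hF.height
  have hq := hF.ht_sq
  simp only [Data.height] at hH
  refine runs_arith ?_ ?_
  · rw [hb]
    simp only [ArithOp.eval]
    omega
  · rw [hb]
    simp [Store.set, varCell, h3, ArithOp.eval]

theorem runs_dimProg (hF : Fits M D m L) (hI : Input D s) :
    Runs M dimProg (D.d * 3 + 4) s fun s' => s'.mem 15 0 0 = D.d := by
  have h3 := hI.zero
  have hH := hF.height
  simp only [Data.height] at hH
  have h0 : (0 : ℤ).natAbs + 1 ≤ M.H := by simpa using hF.one_le
  have h1 : (1 : ℤ).natAbs + 1 ≤ M.H := by simp; omega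
  refine (runs_seq (N := 1) (N' := 1 + (D.d * (1 + 2) + 2)) (runs_const h1 fun _ =>
    runs_seq (runs_const h0 fun hs0 => ?_))).weaken (by omega)
  refine runs_forLoop (fun k s' => s'.mem 15 0 0 = k ∧ s'.mem 8 0 0 = 1)
    (by simpa [Store.set] using hI.d) (by simp) (by simp) (by simp) ?_ ?_ ?_
  · simp [Store.setReg, Store.set, tmpCell, varCell, h3]
  · intro k hk s' hs hk4 hsum
    have h3' : s'.reg 3 = 0 := by rw [hs.1 3 (by simp)]; exact h3
    have e := M.ht_nat_le (k + 1)
    push_cast at e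
    refine runs_arith ?_ fun _ => ?_
    · simp [Store.get, varCell, tmpCell, h3', hsum.1, hsum.2, ArithOp.eval]
      omega
    · simp [Store.get, Store.set, Store.setReg, varCell, tmpCell, h3', hsum.1, hsum.2, ArithOp.eval]
  · intro s' _ _ h
    exact h.1

theorem div_mod_lt {i : ℕ} (hi : i < m * m) : i / m < m ∧ i % m < m := by
  have hm : 0 < m := Nat.pos_of_ne_zero fun h => by simp [h] at hi
  exact ⟨Nat.div_lt_of_lt_mul hi, Nat.mod_lt _ hm⟩

theorem runs_gramProg (hF : Fits M D m L) (hI : Input D s) {i : ℕ} (hi : i < m * m) :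
    Runs M (gramProg m i) (D.d * 6 + 2 * m + 8) s fun s' =>
      s'.mem (8 * (4 * i + 3) + 7) 0 0 = D.dot (i / m) (i % m) 0 := by
  obtain ⟨h1, h2⟩ := div_mod_lt hi
  have hR := hF.reg
  refine (runs_seq (N' := (i % m + 2) + ((D.d * 6 + 3) + 1)) (runs_load (by omega)
    fun s1 hs1 hr1 _ _ => runs_seq (runs_load (by omega) fun s2 hs2 hr2 _ _ => ?_))).weaken
    (by omega)
  have hI2 : Input D s2 := (hI.of_same hs1 (by simp [Prog.KeepsInput])).of_same hs2
    (by simp [Prog.KeepsInput])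
  refine runs_seq ((runs_dotProg hF hI2 (by simp) (by simp) (by simp)).mono le_rfl
    fun s3 hs3 hv _ => runs_move ?_)
  have h5 : s2.reg 5 = i / m := by rw [hs2.1 5 (by simp), hr1]
  have h3 : s3.reg 3 = 0 := by rw [hs3.1 3 (by simp), hI2.zero]
  rw [h5, hr2, hI2.zero] at hv
  simp [Store.get, Store.set, varCell, tmpCell, h3, hv]

theorem runs_coordProg (hF : Fits M D m L) (hI : Input D s) {i : ℕ} (hi : i < m * m) :
    Runs M (coordProg m i) (2 * m + 5) s fun s' =>
      s'.mem (8 * (4 * i + 4) + 7) 0 0 = D.voter (i / m) (i % m) - D.cand 0 (i % m) := by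
  obtain ⟨h1, h2⟩ := div_mod_lt hi
  have hR := hF.reg
  have hH := hF.height
  have e := hF.ht_diff (i / m) 0 (i % m)
  simp only [Data.height] at hH
  refine (runs_seq (N' := (i % m + 2) + 1) (runs_load (by omega)
    fun s1 hs1 hr1 _ _ => runs_seq (runs_load (by omega) fun s2 hs2 hr2 _ _ => ?_))).weaken
    (by omega)
  have hI2 : Input D s2 := (hI.of_same hs1 (by simp [Prog.KeepsInput])).of_same hs2
    (by simp [Prog.KeepsInput])
  have h5 : s2.reg 5 = i / m := by rw [hs2.1 5 (by simp), hr1]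
  have h3 := hI2.zero
  refine runs_arith ?_ ?_
  · simp [Store.get, ArithOp.eval, h3, h5, hr2, hI2.voter, hI2.cand]
    omega
  · simp [Store.get, Store.set, varCell, ArithOp.eval, h3, h5, hr2, hI2.voter, hI2.cand]

theorem runs_paramProg (hF : Fits M D m L) (hI : Input D s) :
    Runs M (paramProg m) (m * m * (D.d * 6 + 4 * m + 13) + D.d * 3 + 7) s (Params D m) := by
  have hg : (Prog.unroll (gramProg m) (m * m)).KeepsInput := by
    constructor
    · intro r; simp [gramProg]; omega
    · intro a; simp [gramProg, varCell]; omega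
  refine (runs_seq (N := 1) (N' := (D.d * 3 + 4) + ((m * m * (D.d * 6 + 2 * m + 8) + 1) +
    (m * m * (2 * m + 5) + 1))) ((runs_sqProg hF hI).mono le_rfl fun s1 hs1 h1 _ => ?_)).weaken
    (by rw [show m * m * (D.d * 6 + 4 * m + 13) = m * m * (D.d * 6 + 2 * m + 8) +
      m * m * (2 * m + 5) by ring]; omega)
  have hI1 := hI.of_same hs1 (by simp [Prog.KeepsInput, sqProg, varCell])
  refine runs_seq ((runs_dimProg hF hI1).mono le_rfl fun s2 hs2 h2 _ => ?_)
  have hI2 := hI1.of_same hs2 (by simp [Prog.KeepsInput, dimProg, varCell, tmpCell])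
  refine runs_seq ((runs_unroll_posts (fun i s' => s'.mem (8 * (4 * i + 3) + 7) 0 0 =
    D.dot (i / m) (i % m) 0) (fun i _ i' _ hne s3 s4 hs h => ?_)
    fun i hi s' hs' => runs_gramProg hF (hI2.of_same hs' hg) hi).mono le_rfl
    fun s3 hs3 h3 _ => ?_)
  · rw [hs.2 _ (by simp [gramProg, varCell]; omega)]; exact h
  have hI3 := hI2.of_same hs3 hg
  refine (runs_unroll_posts (fun i s' => s'.mem (8 * (4 * i + 4) + 7) 0 0 =
    D.voter (i / m) (i % m) - D.cand 0 (i % m)) (fun i _ i' _ hne s3 s4 hs h => ?_)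
    fun i hi s' hs' => runs_coordProg hF (hI3.of_same hs' ?_) hi).mono le_rfl
    fun s4 hs4 h4 => ⟨?_, ?_, fun i hi => ?_, h4⟩
  · rw [hs.2 _ (by simp [coordProg, varCell]; omega)]; exact h
  · constructor
    · intro r; simp [coordProg]; omega
    · intro a; simp [coordProg, varCell]; omega
  · rw [hs4.2 7 (by simp [coordProg, varCell]), hs3.2 7 (by simp [gramProg, varCell]),
      hs2.2 7 (by simp [dimProg, varCell, tmpCell]), h1]
  · rw [hs4.2 15 (by simp [coordProg, varCell]),
      hs3.2 15 (by simp [gramProg, varCell]), h2]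
  · rw [hs4.2 _ (by simp [coordProg, varCell]; omega), h3 i hi]

theorem runs_distProg (hF : Fits M D m L) (hI : Input D s) {j : ℕ} (hj : j < m) :
    Runs M (distProg j) (D.n * (D.d * 6 + 6) + m + 4) s fun s' =>
      ∀ i < D.n, s'.mem (8 * j + 4) 0 i = D.dist j i := by
  have hR := hF.reg
  refine (runs_seq (N' := D.n * ((D.d * 6 + 3 + 1) + 2) + 2) (runs_load (by omega)
    fun s1 hs1 hr1 _ _ => ?_)).weaken
    (by rw [show D.d * 6 + 3 + 1 + 2 = D.d * 6 + 6 by omega]; omega)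
  have hI1 := hI.of_same hs1 (by simp [Prog.KeepsInput])
  have hp : (Prog.forLoop 7 0
      (.seq (dotProg 5 5 7) (.move ⟨8 * j + 4, 3, 7⟩ (tmpCell 0)))).KeepsInput := by
    constructor
    · intro r; simp; omega
    · intro a; simp; omega
  refine runs_forLoop (fun k s' => ∀ i < k, s'.mem (8 * j + 4) 0 i = D.dist j i) hI1.n
    (by simp) (by simp) (by simp) (by simp) (fun k hk s2 hs2 hk7 hprev => ?_) (fun _ _ _ h => h)
  have hI2 := hI1.of_same hs2 hp
  have h5 : s2.reg 5 = j := by rw [hs2.1 5 (by simp), hr1]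
  refine runs_seq (N := D.d * 6 + 3) (N' := 1)
    ((runs_dotProg hF hI2 (by simp) (by simp) (by simp)).mono le_rfl
    fun s3 hs3 hv _ => runs_move fun _ => ?_)
  rw [h5, hk7] at hv
  have h3 : s3.reg 3 = 0 := by rw [hs3.1 3 (by simp), hI2.zero]
  have h7 : s3.reg 7 = k := by rw [hs3.1 7 (by simp), hk7]
  intro i hi
  have hprev' : i < k → s3.mem (8 * j + 4) 0 i = D.dist j i := fun h => by
    rw [hs3.2 _ (by simp; omega)]; exact hprev i h
  rcases Nat.lt_succ_iff_lt_or_eq.1 hi with hi | rfl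
  · simp [Store.setReg, Store.set, h3, h7, hi.ne, hprev' hi]
  · simpa [Store.setReg, Store.set, Store.get, tmpCell, h3, h7, Data.dist] using hv

end

/-! ### Programs for the tables of scores and distance bounds -/

/-- The distance bound if there is none. -/
def dfltProg (g : Goal) (j : ℕ) : Prog :=
  match g with
  | .constructive => .seq (.arith .add (tmpCell 0) ⟨8 * j + 4, 3, 3⟩ (varCell 0))
      (.arith .add (tmpCell 0) (tmpCell 0) (tmpCell 0))
  | .destructive => .const (tmpCell 0) 0

/-- Puts the rank of the candidate in register `7` into register `8`. -/
def posProg (j : ℕ) : Prog :=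
  .seq (.clear 8) (.forLoop 4 0
    (.ifIdx 3 4 (.ifLe ⟨8 * j + 4, 3, 7⟩ ⟨8 * j + 4, 3, 4⟩ .skip (.incr 8)) .skip))

/-- Does `p` if the rank in register `10` is marked. -/
def markProg (g : Goal) (p : Prog) : Prog :=
  match g with
  | .constructive => .seq (.copy 11 10) (.seq (.incr 11)
      (.ifIdx 11 0 (.ifLe ⟨2, 3, 10⟩ ⟨2, 3, 11⟩ .skip p) p))
  | .destructive => .ifIdx 3 10 (.ifLe ⟨2, 3, 11⟩ ⟨2, 3, 10⟩ .skip p) p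

/-- Does `p` if the candidate determines the distance bound. -/
def boundsProg (g : Goal) (p : Prog) : Prog :=
  match g with
  | .constructive => .ifIdx 8 10 .skip (.ifIdx 10 8 .skip p)
  | .destructive => .ifIdx 9 10 .skip (.ifIdx 10 9 .skip p)

/-- Writes the score of the candidate and the distance bound for the marked rank in
register `10`. -/
def entryProg (g : Goal) (j : ℕ) : Prog :=
  .seq (.ifIdx 3 7
    (.seq (.ifIdx 8 10 (.move ⟨8 * j + 5, 12, 7⟩ ⟨2, 3, 8⟩) (.move ⟨8 * j + 5, 12, 7⟩ ⟨2, 3, 9⟩))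
      (boundsProg g (.move ⟨8 * j + 6, 3, 12⟩ ⟨8 * j + 4, 3, 7⟩)))
    (.seq (.move ⟨8 * j + 5, 12, 7⟩ ⟨2, 3, 10⟩) (.move ⟨8 * j + 6, 3, 12⟩ (tmpCell 0))))
    (.incr 12)

/-- Writes the entries of the candidate in register `7` for all marked ranks. -/
def columnProg (g : Goal) (j : ℕ) : Prog :=
  .seq (.clear 12) (.seq (.clear 11)
    (.forLoop 10 0 (.seq (markProg g (entryProg g j)) (.copy 11 10))))

/-- Writes the tables of voter `j`. -/
def tableProg (g : Goal) (j : ℕ) : Prog :=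
  .seq (dfltProg g j) (.seq
    (.forLoop 7 0 (.seq (posProg j) (.seq (.copy 9 8) (.seq (.incr 9) (columnProg g j)))))
    (.copy 13 12))

@[simp] theorem WR_dfltProg {g : Goal} {j x : ℕ} : ¬ (dfltProg g j).WR x := by
  cases g <;> simp [dfltProg]

@[simp] theorem WA_dfltProg {g : Goal} {j x : ℕ} : (dfltProg g j).WA x ↔ x = 8 := by
  cases g <;> simp [dfltProg, tmpCell]

@[simp] theorem WR_posProg {j x : ℕ} : (posProg j).WR x ↔ x = 8 ∨ x = 4 := by
  simp [posProg]; tauto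

@[simp] theorem WA_posProg {j x : ℕ} : ¬ (posProg j).WA x := by
  simp [posProg]

@[simp] theorem WA_markProg {g : Goal} {p : Prog} {x : ℕ} : (markProg g p).WA x ↔ p.WA x := by
  cases g <;> simp [markProg]

theorem WR_markProg {g : Goal} {p : Prog} {x : ℕ} (h : (markProg g p).WR x) :
    x = 11 ∨ p.WR x := by
  cases g <;> simp [markProg] at h <;> tauto

@[simp] theorem WR_boundsProg {g : Goal} {p : Prog} {x : ℕ} :
    (boundsProg g p).WR x ↔ p.WR x := by
  cases g <;> simp [boundsProg]

@[simp] theorem WA_boundsProg {g : Goal} {p : Prog} {x : ℕ} :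
    (boundsProg g p).WA x ↔ p.WA x := by
  cases g <;> simp [boundsProg]

@[simp] theorem WR_entryProg {g : Goal} {j x : ℕ} : (entryProg g j).WR x ↔ x = 12 := by
  simp [entryProg]

@[simp] theorem WA_entryProg {g : Goal} {j x : ℕ} :
    (entryProg g j).WA x ↔ x = 8 * j + 5 ∨ x = 8 * j + 6 := by
  simp [entryProg]

theorem WR_columnProg {g : Goal} {j x : ℕ} (h : (columnProg g j).WR x) :
    x = 10 ∨ x = 11 ∨ x = 12 := by
  simp only [columnProg, Prog.WR, Prog.WR_forLoop] at h
  rcases h with h | h | h | h | h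
  · omega
  · omega
  · omega
  · rcases WR_markProg h with h | h
    · omega
    · simp at h; omega
  · omega

@[simp] theorem WA_columnProg {g : Goal} {j x : ℕ} :
    (columnProg g j).WA x ↔ x = 8 * j + 5 ∨ x = 8 * j + 6 := by
  simp [columnProg]

theorem WR_tableProg {g : Goal} {j x : ℕ} (h : (tableProg g j).WR x) :
    x = 4 ∨ (7 ≤ x ∧ x ≤ 13) := by
  simp only [tableProg, Prog.WR, Prog.WR_forLoop, WR_dfltProg, WR_posProg] at h
  rcases h with h | (h | h | h | h | h) | h
  · exact h.elim
  · omega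
  · omega
  · omega
  · omega
  · have := WR_columnProg h; omega
  · omega

@[simp] theorem WA_tableProg {g : Goal} {j x : ℕ} :
    (tableProg g j).WA x ↔ x = 8 ∨ x = 8 * j + 5 ∨ x = 8 * j + 6 := by
  simp [tableProg]

section
variable {K : Type} [LinearOrder K] {D : Data K} {g : Goal}

namespace Data

theorem blk_zero : D.blk g 0 = 0 := by simp [blk]

theorem blk_succ_of_mark {t : ℕ} (h : D.Mark g t) : D.blk g (t + 1) = D.blk g t + 1 := by
  classical
  simp [blk, Finset.range_add_one, Finset.filter_insert, h]

theorem blk_succ_of_not_mark {t : ℕ} (h : ¬ D.Mark g t) : D.blk g (t + 1) = D.blk g t := by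
  classical
  simp [blk, Finset.range_add_one, Finset.filter_insert, h]

theorem blk_mono {t t' : ℕ} (h : t ≤ t') : D.blk g t ≤ D.blk g t' := by
  classical
  exact Finset.card_le_card (Finset.filter_subset_filter _ (Finset.range_mono h))

theorem blk_lt_blk {t t' : ℕ} (ht : D.Mark g t) (h : t < t') : D.blk g t < D.blk g t' :=
  lt_of_lt_of_le (by rw [blk_succ_of_mark ht]; omega) (blk_mono (D := D) (g := g) h)

theorem blk_inj {t t' : ℕ} (ht : D.Mark g t) (ht' : D.Mark g t') (h : D.blk g t = D.blk g t') :
    t = t' := by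
  rcases lt_trichotomy t t' with h1 | h1 | h1
  · exact absurd h (blk_lt_blk ht h1).ne
  · exact h1
  · exact absurd h.symm (blk_lt_blk ht' h1).ne

theorem blk_le_self (t : ℕ) : D.blk g t ≤ t := by
  classical
  exact (Finset.card_filter_le _ _).trans (Finset.card_range t).le

theorem exists_blk_eq {k t : ℕ} (h : k < D.blk g t) :
    ∃ t' < t, D.Mark g t' ∧ D.blk g t' = k := by
  induction t with
  | zero => simp [blk_zero] at h
  | succ t ih =>
    by_cases ht : D.Mark g t
    · rw [blk_succ_of_mark ht] at h
      rcases Nat.lt_succ_iff_lt_or_eq.1 h with h | h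
      · obtain ⟨t', h1, h2⟩ := ih h
        exact ⟨t', by omega, h2⟩
      · exact ⟨t, by omega, ht, h.symm⟩
    · rw [blk_succ_of_not_mark ht] at h
      obtain ⟨t', h1, h2⟩ := ih h
      exact ⟨t', by omega, h2⟩

end Data

end

section
variable {K : Type} [Field K] [LinearOrder K] {M : Meter K} {D : Data K} {m L : ℕ} {s : Store K}
  {g : Goal} {j : ℕ}

theorem runs_dfltProg (hF : Fits M D m L) (hI : Input D s) (hn : 0 < D.n)
    (hd : ∀ i < D.n, s.mem (8 * j + 4) 0 i = D.dist j i)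
    (hsq : s.mem 7 0 0 = D.budget * D.budget) :
    Runs M (dfltProg g j) 2 s fun s' => s'.mem 8 0 0 = D.dflt g j := by
  have h3 := hI.zero
  have hH := hF.height
  have h0 := hd 0 hn
  cases g
  · have h1 := hF.ht_dist_add j
    have h2 := (hF.ht_dflt .constructive j).trans hH
    simp only [Data.dflt] at h2
    simp only [Data.height] at hH
    refine runs_seq (N := 1) (N' := 1) (runs_arith ?_ fun _ => runs_arith ?_ ?_)
    · simp [Store.get, varCell, h3, h0, hsq, ArithOp.eval]
      omega
    · simpa [Store.get, Store.set, varCell, tmpCell, h3, h0, hsq, ArithOp.eval] using h2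
    · simp [Store.get, Store.set, varCell, tmpCell, h3, h0, hsq, ArithOp.eval, Data.dflt]
  · exact (runs_const (by simpa using hF.one_le)
      (by simp [Store.set, tmpCell, h3, Data.dflt])).weaken (by omega)

theorem runs_posProg (hF : Fits M D m L) (hI : Input D s) {i : ℕ} (hi : s.reg 7 = i)
    (hin : i < D.n) (hd : ∀ i < D.n, s.mem (8 * j + 4) 0 i = D.dist j i) :
    Runs M (posProg j) (D.n * 5 + 3) s fun s' => s'.reg 8 = D.pos j i := by
  classical
  have h3 := hI.zero
  have hR := hF.reg
  refine (runs_seq (N := 1) (N' := D.n * 5 + 2) (runs_clear fun _ => ?_)).weaken (by omega)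
  refine runs_forLoop (N := 3) (fun k s' => s'.reg 8 =
    ((Finset.range k).filter fun k => 0 < k ∧ D.dist j k < D.dist j i).card)
    (by simpa [Store.setReg] using hI.n) (by simp) (by simp) (by simp) ?_ ?_ ?_
  · simp [Store.setReg]
  · intro k hk s' hs hk4 hc
    have h3' : s'.reg 3 = 0 := by rw [hs.1 3 (by simp)]; simpa [Store.setReg] using h3
    have h7' : s'.reg 7 = i := by rw [hs.1 7 (by simp)]; simpa [Store.setReg] using hi
    have hm : s'.mem (8 * j + 4) = s.mem (8 * j + 4) := by rw [hs.2 _ (by simp)]; rfl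
    have hle := (Finset.card_filter_le (Finset.range k) fun k => 0 < k ∧ D.dist j k < D.dist j i)
    rw [Finset.card_range, ← hc] at hle
    have e1 : s'.get ⟨8 * j + 4, 3, 7⟩ = D.dist j i := by
      simp [Store.get, h3', h7', hm, hd i hin]
    have e2 : s'.get ⟨8 * j + 4, 3, 4⟩ = D.dist j k := by
      simp [Store.get, h3', hk4, hm, hd k hk]
    -- Register `3` holds zero, so the index test leaves out the target; the failing branch of `≤`
    -- is the strict comparison that is counted.
    refine runs_ifIdx (N := 2) (fun h => runs_ifLe (N := 1) (fun hle => runs_skip fun _ => ?_)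
      fun hlt => runs_incr (by omega) fun _ => ?_) fun h => (runs_skip fun _ => ?_).weaken (by omega)
    · rw [e1, e2] at hle
      simp [Store.setReg, hc, Finset.range_add_one, Finset.filter_insert, not_lt.2 hle]
    · rw [e1, e2, not_le] at hlt
      rw [h3', hk4] at h
      simp [Store.setReg, hc, Finset.range_add_one, Finset.filter_insert, hlt, h]
    · rw [h3', hk4] at h
      simp [Store.setReg, hc, Finset.range_add_one, Finset.filter_insert, h]
  · intro s' _ _ h
    rw [h, Data.pos]

/-- Register `11` points to the neighbouring rank: it is set to `t + 1` in the constructive case,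
and retains `t - 1` from the previous round in the destructive case. At the end of the range without
a neighbour the rank is marked and no score is compared. -/
theorem runs_markProg (hF : Fits M D m L) (hI : Input D s) {p : Prog} {N t : ℕ}
    {Q : Store K → Prop} (ht : s.reg 10 = t) (htn : t < D.n) (h11 : 0 < t → s.reg 11 + 1 = t)
    (hp : D.Mark g t → ∀ s', s'.mem = s.mem → (∀ r, r ≠ 11 → s'.reg r = s.reg r) →
      Runs M p (N + 1) s' Q)
    (hq : ¬ D.Mark g t → ∀ s', s'.mem = s.mem → (∀ r, r ≠ 11 → s'.reg r = s.reg r) → Q s') :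
    Runs M (markProg g p) (N + 5) s Q := by
  have h3 := hI.zero
  have hn := hI.n
  have hR := hF.reg
  cases g
  · refine (runs_seq (N := 1) (N' := 1 + (N + 1 + 1 + 1)) (runs_copy fun _ =>
      runs_seq (runs_incr ?_ fun _ => ?_))).weaken (by omega)
    · simp [Store.setReg, ht]; omega
    set s' := (s.setReg 11 (s.reg 10)).setReg 11 ((s.setReg 11 (s.reg 10)).reg 11 + 1)
    have hmem : s'.mem = s.mem := rfl
    have hreg : ∀ r, r ≠ 11 → s'.reg r = s.reg r := fun r hr => by simp [s', Store.setReg, hr]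
    have h11' : s'.reg 11 = t + 1 := by simp [s', Store.setReg, ht]
    have e1 : s'.get ⟨2, 3, 10⟩ = D.score t := by
      simp [Store.get, hmem, hreg, h3, ht, hI.score]
    have e2 : s'.get ⟨2, 3, 11⟩ = D.score (t + 1) := by
      simp [Store.get, hmem, hreg, h3, h11', hI.score]
    refine runs_ifIdx (fun h => runs_ifLe (fun hle => ?_) fun hlt => ?_) fun h => ?_
    · rw [h11', hreg 0 (by simp), hn] at h
      rw [e1, e2] at hle
      exact (runs_skip (hq (fun hm => absurd (hm h) (not_lt.2 hle)) s' hmem hreg)).weaken (by omega)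
    · rw [e1, e2, not_le] at hlt
      exact hp (fun _ => hlt) s' hmem hreg
    · rw [h11', hreg 0 (by simp), hn] at h
      exact (hp (fun h' => absurd h' h) s' hmem hreg).weaken (by omega)
  · refine (runs_ifIdx (N := N + 1 + 1) (fun h => ?_) fun h => ?_).weaken (by omega)
    · rw [h3, ht] at h
      have h11' : s.reg 11 = t - 1 := by have := h11 h; omega
      have e1 : s.get ⟨2, 3, 10⟩ = D.score t := by simp [Store.get, h3, ht, hI.score]
      have e2 : s.get ⟨2, 3, 11⟩ = D.score (t - 1) := by simp [Store.get, h3, h11', hI.score]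
      refine runs_ifLe (fun hle => ?_) fun hlt => ?_
      · rw [e1, e2] at hle
        exact (runs_skip (hq (fun hm => absurd (hm h) (not_lt.2 hle)) s rfl fun _ _ => rfl)).weaken
          (by omega)
      · rw [e1, e2, not_le] at hlt
        exact hp (fun _ => hlt) s rfl fun _ _ => rfl
    · rw [h3, ht] at h
      exact (hp (fun h' => absurd h' h) s rfl fun _ _ => rfl).weaken (by omega)

/-- Equality of two indices is the failure of both strict comparisons; register `9` is compared
instead of `8` where the rank is one more than the position. -/
theorem runs_boundsProg {p : Prog} {N q t : ℕ} {Q : Store K → Prop} (ht : s.reg 10 = t)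
    (h8 : s.reg 8 = q) (h9 : s.reg 9 = q + 1) (hp : Data.Bounds g q t → Runs M p (N + 1) s Q)
    (hq : ¬ Data.Bounds g q t → Q s) : Runs M (boundsProg g p) (N + 3) s Q := by
  cases g
  · refine runs_ifIdx (N := N + 2) (fun h => (runs_skip (hq fun h' => ?_)).weaken (by omega))
      fun h => runs_ifIdx (N := N + 1) (fun h' => (runs_skip (hq fun h'' => ?_)).weaken (by omega))
      fun h' => hp ?_
    all_goals simp only [Data.Bounds] at *; omega
  · refine runs_ifIdx (N := N + 2) (fun h => (runs_skip (hq fun h' => ?_)).weaken (by omega))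
      fun h => runs_ifIdx (N := N + 1) (fun h' => (runs_skip (hq fun h'' => ?_)).weaken (by omega))
      fun h' => hp ?_
    all_goals simp only [Data.Bounds] at *; omega

open Classical in
/-- The distance bound for the rank `t` after candidate `i`, where it was `x` before. -/
noncomputable def Data.newRad (D : Data K) (g : Goal) (j i t : ℕ) (x : K) : K :=
  if i = 0 then D.dflt g j else if Data.Bounds g (D.pos j i) t then D.dist j i else x

theorem runs_entryProg (hF : Fits M D m L) (hI : Input D s) {i t b : ℕ} (hi : s.reg 7 = i)
    (hin : i < D.n) (ht : s.reg 10 = t) (h8 : s.reg 8 = D.pos j i) (h9 : s.reg 9 = D.pos j i + 1)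
    (hb : s.reg 12 = b) (hbn : b < D.n)
    (hd : ∀ i < D.n, s.mem (8 * j + 4) 0 i = D.dist j i) (hdf : s.mem 8 0 0 = D.dflt g j) :
    Runs M (entryProg g j) 7 s fun s' => s'.reg 12 = b + 1 ∧
      (∀ b' c, s'.mem (8 * j + 5) b' c =
        if b' = b ∧ c = i then D.virt j t i else s.mem (8 * j + 5) b' c) ∧
      ∀ b', s'.mem (8 * j + 6) 0 b' =
        if b' = b then D.newRad g j i t (s.mem (8 * j + 6) 0 b) else s.mem (8 * j + 6) 0 b' := by
  have h3 := hI.zero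
  have hR := hF.reg
  refine runs_seq (N := 6) (N' := 1) (Q := fun s' => s'.reg 12 = b + 1 ∧ _) ?_
  suffices h : Runs M (.ifIdx 3 7
    (.seq (.ifIdx 8 10 (.move ⟨8 * j + 5, 12, 7⟩ ⟨2, 3, 8⟩) (.move ⟨8 * j + 5, 12, 7⟩ ⟨2, 3, 9⟩))
      (boundsProg g (.move ⟨8 * j + 6, 3, 12⟩ ⟨8 * j + 4, 3, 7⟩)))
    (.seq (.move ⟨8 * j + 5, 12, 7⟩ ⟨2, 3, 10⟩) (.move ⟨8 * j + 6, 3, 12⟩ (tmpCell 0)))) 6 s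
    fun s' => (∀ b' c, s'.mem (8 * j + 5) b' c =
        if b' = b ∧ c = i then D.virt j t i else s.mem (8 * j + 5) b' c) ∧
      ∀ b', s'.mem (8 * j + 6) 0 b' =
        if b' = b then D.newRad g j i t (s.mem (8 * j + 6) 0 b) else s.mem (8 * j + 6) 0 b' by
    refine h.mono le_rfl fun s' hs' h' _ => ?_
    have hb' : s'.reg 12 = b := by rw [hs'.1 12 (by simp), hb]
    exact runs_incr (by omega) ⟨by simp [Store.setReg, hb'], h'⟩
  refine runs_ifIdx (N := 5) (fun h => ?_) fun h => ?_
  · rw [h3, hi] at h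
    refine runs_seq (N := 2) (N' := 3) (Runs.mono (Q := fun s' =>
      (∀ b' c, s'.mem (8 * j + 5) b' c =
        if b' = b ∧ c = i then D.virt j t i else s.mem (8 * j + 5) b' c)) ?_ le_rfl
        fun s1 hs1 h1 _ => ?_)
    · refine runs_ifIdx (N := 1) (fun hlt => runs_move ?_) fun hlt => runs_move ?_
      · rw [h8, ht] at hlt
        simp [Store.set, Store.get, hb, hi, h3, h8, hI.score, Data.virt, h.ne', hlt]
      · rw [h8, ht] at hlt
        simp [Store.set, Store.get, hb, hi, h3, h9, hI.score, Data.virt, h.ne', hlt]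
    · have hr : s1.reg = s.reg := funext fun r => hs1.1 r (by simp)
      have hm6 : s1.mem (8 * j + 6) = s.mem (8 * j + 6) := hs1.2 _ (by simp)
      have hm4 : s1.mem (8 * j + 4) = s.mem (8 * j + 4) := hs1.2 _ (by simp)
      refine runs_boundsProg (N := 0) (by rw [hr, ht]) (by rw [hr, h8]) (by rw [hr, h9])
        (fun hB => runs_move ⟨fun b' c => ?_, fun b' => ?_⟩) fun hB => ⟨h1, fun b' => ?_⟩
      · simp [Store.set, h1]
      · simp [Store.set, Store.get, hr, hb, hi, h3, hm4, hm6, hd i hin, Data.newRad, h.ne', hB]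
      · rw [hm6]
        split_ifs with hbb
        · simp [Data.newRad, h.ne', hB, hbb]
        · rfl
  · rw [h3, hi] at h
    obtain rfl : i = 0 := by omega
    refine (runs_seq (N := 1) (N' := 1) (runs_move fun _ => runs_move ⟨fun b' c => ?_,
      fun b' => ?_⟩)).weaken (by omega)
    · simp [Store.set, Store.get, hb, hi, h3, ht, hI.score, Data.virt]
    · have h8j : 8 * j ≠ 3 := by omega
      simp [Store.set, Store.get, hb, h3, tmpCell, hdf, Data.newRad, h8j]

/-- Register `12` advances only at marked ranks, so it equals `blk` of the current rank. Distinct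
marked ranks have distinct rows, hence no entry of this column is overwritten later in the loop. -/
theorem runs_columnProg (hF : Fits M D m L) (hI : Input D s) {i : ℕ} (hi : s.reg 7 = i)
    (hin : i < D.n) (h8 : s.reg 8 = D.pos j i) (h9 : s.reg 9 = D.pos j i + 1)
    (hd : ∀ i < D.n, s.mem (8 * j + 4) 0 i = D.dist j i) (hdf : s.mem 8 0 0 = D.dflt g j) :
    Runs M (columnProg g j) (D.n * 14 + 4) s fun s' => s'.reg 12 = D.blk g D.n ∧
      (∀ t < D.n, D.Mark g t → s'.mem (8 * j + 5) (D.blk g t) i = D.virt j t i) ∧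
      (∀ b c, c ≠ i → s'.mem (8 * j + 5) b c = s.mem (8 * j + 5) b c) ∧
      ∀ t < D.n, D.Mark g t → s'.mem (8 * j + 6) 0 (D.blk g t) =
        D.newRad g j i t (s.mem (8 * j + 6) 0 (D.blk g t)) := by
  refine (runs_seq (N := 1) (N' := 1 + (D.n * (11 + 1 + 2) + 2)) (runs_clear fun _ =>
    runs_seq (runs_clear fun _ => ?_))).weaken (by omega)
  set s0 := (s.setReg 12 0).setReg 11 0 with hs0
  have hr0 : ∀ r, r ≠ 11 → r ≠ 12 → s0.reg r = s.reg r := fun r h1 h2 => by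
    simp [hs0, Store.setReg, h1, h2]
  have hm0 : s0.mem = s.mem := rfl
  have hwr : ∀ x, (Prog.forLoop 10 0 (.seq (markProg g (entryProg g j)) (.copy 11 10))).WR x →
      x = 10 ∨ x = 11 ∨ x = 12 := by
    intro x hx
    simp only [Prog.WR, Prog.WR_forLoop] at hx
    rcases hx with h | h | h
    · exact Or.inl h
    · rcases WR_markProg h with h | h
      · exact Or.inr (Or.inl h)
      · exact Or.inr (Or.inr (WR_entryProg.1 h))
    · exact Or.inr (Or.inl h)
  refine runs_forLoop (fun t s' => s'.reg 12 = D.blk g t ∧ (0 < t → s'.reg 11 + 1 = t) ∧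
      (∀ t' < t, D.Mark g t' → s'.mem (8 * j + 5) (D.blk g t') i = D.virt j t' i) ∧
      (∀ b c, c ≠ i → s'.mem (8 * j + 5) b c = s.mem (8 * j + 5) b c) ∧
      ∀ t', D.Mark g t' → s'.mem (8 * j + 6) 0 (D.blk g t') = if t' < t then
        D.newRad g j i t' (s.mem (8 * j + 6) 0 (D.blk g t'))
        else s.mem (8 * j + 6) 0 (D.blk g t')) ?_ (fun h => ?_) (fun h => ?_) (by simp) ?_ ?_ ?_
  · rw [hr0 0 (by simp) (by simp)]; exact hI.n
  · rcases h with h | h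
    · rcases WR_markProg h with h | h
      · simp at h
      · simp at h
    · simp at h
  · rcases h with h | h
    · rcases WR_markProg h with h | h
      · simp at h
      · simp at h
    · simp at h
  · simp [hs0, Store.setReg, Data.blk_zero]
  · rintro t ht s' hs h10 ⟨h12, h11, hA, hA', hS⟩
    have hr : ∀ r, r ≠ 10 → r ≠ 11 → r ≠ 12 → s'.reg r = s.reg r := fun r h1 h2 h3 => by
      rw [hs.1 r fun h => by have := hwr r h; omega, hr0 r h2 h3]
    have hm : ∀ a, a ≠ 8 * j + 5 → a ≠ 8 * j + 6 → s'.mem a = s.mem a := fun a h1 h2 => by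
      rw [hs.2 a (by simp [h1, h2]), hm0]
    have hI' : Input D s' := ⟨by rw [hr 0 (by simp) (by simp) (by simp), hI.n],
      by rw [hr 1 (by simp) (by simp) (by simp), hI.d],
      by rw [hr 3 (by simp) (by simp) (by simp), hI.zero],
      by rw [hm 0 (by simp) (by simp), hI.cand],
      by rw [hm 1 (by simp) (by simp), hI.voter],
      by rw [hm 2 (by omega) (by omega)]; exact hI.score,
      by rw [hm 3 (by omega) (by omega)]; exact hI.budget⟩
    refine runs_seq (N := 11) (N' := 1) (Runs.mono (Q := fun s2 => s2.reg 12 = D.blk g (t + 1) ∧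
      (∀ t' < t + 1, D.Mark g t' → s2.mem (8 * j + 5) (D.blk g t') i = D.virt j t' i) ∧
      (∀ b c, c ≠ i → s2.mem (8 * j + 5) b c = s.mem (8 * j + 5) b c) ∧
      ∀ t', D.Mark g t' → s2.mem (8 * j + 6) 0 (D.blk g t') = if t' < t + 1 then
        D.newRad g j i t' (s.mem (8 * j + 6) 0 (D.blk g t'))
        else s.mem (8 * j + 6) 0 (D.blk g t')) ?_ le_rfl fun s2 hs2 h2 _ => runs_copy fun _ => ?_)
    · refine runs_markProg (N := 6) hF hI' h10 ht h11 (fun hM s1 hm1 hr1 => ?_)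
        fun hM s1 hm1 hr1 => ?_
      · have hI1 : Input D s1 := ⟨by rw [hr1 0 (by simp), hI'.n], by rw [hr1 1 (by simp), hI'.d],
          by rw [hr1 3 (by simp), hI'.zero], by rw [hm1, hI'.cand], by rw [hm1, hI'.voter],
          by rw [hm1]; exact hI'.score, by rw [hm1, hI'.budget]⟩
        have hbn : D.blk g t < D.n := lt_of_le_of_lt (Data.blk_le_self t) ht
        refine (runs_entryProg (g := g) hF hI1
          (by rw [hr1 7 (by simp), hr 7 (by simp) (by simp) (by simp), hi]) hin
          (by rw [hr1 10 (by simp), h10])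
          (by rw [hr1 8 (by simp), hr 8 (by simp) (by simp) (by simp), h8])
          (by rw [hr1 9 (by simp), hr 9 (by simp) (by simp) (by simp), h9])
          (by rw [hr1 12 (by simp), h12]) hbn
          (by rw [hm1, hm _ (by omega) (by omega)]; exact hd)
          (by rw [hm1, hm _ (by omega) (by omega)]; exact hdf)).mono le_rfl ?_
        rintro s2 - ⟨k12, kA, kS⟩
        rw [hm1] at kA kS
        refine ⟨by rw [k12, Data.blk_succ_of_mark hM], fun t' ht' hM' => ?_, fun b c hc => ?_,
          fun t' hM' => ?_⟩
        · rcases Nat.lt_succ_iff_lt_or_eq.1 ht' with h | rfl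
          · rw [kA, if_neg fun h' => (Data.blk_lt_blk hM' h).ne h'.1]; exact hA t' h hM'
          · rw [kA, if_pos ⟨rfl, rfl⟩]
        · rw [kA, if_neg fun h' => hc h'.2]; exact hA' b c hc
        · rw [kS]
          by_cases htt : t' = t
          · subst htt
            rw [if_pos rfl, if_pos (by omega), hS t' hM', if_neg (by omega)]
          · rw [if_neg fun h' => htt (Data.blk_inj hM' hM h'), hS t' hM']
            congr 1
            simp only [eq_iff_iff]; omega
      · rw [hm1]
        refine ⟨by rw [hr1 12 (by simp), h12, Data.blk_succ_of_not_mark hM],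
          fun t' ht' hM' => ?_, hA', fun t' hM' => ?_⟩
        · rcases Nat.lt_succ_iff_lt_or_eq.1 ht' with h | rfl
          · exact hA t' h hM'
          · exact absurd hM' hM
        · rw [hS t' hM']
          have : t' ≠ t := fun h => hM (h ▸ hM')
          congr 1
          simp only [eq_iff_iff]; omega
    · have h10' : s2.reg 10 = t := by
        rw [hs2.1 10 fun h => ?_, h10]
        rcases WR_markProg h with h | h
        · simp at h
        · simp at h
      exact ⟨by simpa [Store.setReg] using h2.1, fun _ => by simp [Store.setReg, h10'], h2.2⟩
  · rintro s' - - ⟨h12, -, hA, hA', hS⟩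
    exact ⟨h12, hA, hA', fun t ht hM => by rw [hS t hM, if_pos ht]⟩

/-- The store contains the tables of voter `j`. -/
def Table (D : Data K) (g : Goal) (j : ℕ) (s : Store K) : Prop :=
  ∀ t < D.n, D.Mark g t →
    (∀ i < D.n, s.mem (8 * j + 5) (D.blk g t) i = D.virt j t i) ∧
      s.mem (8 * j + 6) 0 (D.blk g t) = D.rad g j t

/-- Candidate `0` comes first and initializes all distance bounds with the default; a later
candidate overwrites the bound of a rank exactly if it delimits this rank, and by injectivity of
positions at most one does. -/
theorem runs_tableProg (hF : Fits M D m L) (hI : Input D s) (hT : D.NoTies m) (hj : j < m)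
    (hn : 0 < D.n) (hd : ∀ i < D.n, s.mem (8 * j + 4) 0 i = D.dist j i)
    (hsq : s.mem 7 0 0 = D.budget * D.budget) :
    Runs M (tableProg g j) (D.n * (D.n * 19 + 11) + 5) s fun s' =>
      Table D g j s' ∧ s'.reg 13 = D.blk g D.n := by
  have hR := hF.reg
  refine (runs_seq (N := 2) (N' := (D.n * (((D.n * 5 + 3) + (1 + (1 + (D.n * 14 + 4)))) + 2) + 2) +
    1) ((runs_dfltProg hF hI hn hd hsq).mono le_rfl fun s0 hs0 hdf _ => ?_)).weaken
    (by rw [show (D.n * 5 + 3) + (1 + (1 + (D.n * 14 + 4))) + 2 = D.n * 19 + 11 by omega]; omega)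
  have hI0 := hI.of_same hs0 (by simp [Prog.KeepsInput])
  have hd0 : ∀ i < D.n, s0.mem (8 * j + 4) 0 i = D.dist j i := by
    rw [hs0.2 _ (by simp; omega)]; exact hd
  set loop := Prog.forLoop 7 0
    (.seq (posProg j) (.seq (.copy 9 8) (.seq (.incr 9) (columnProg g j)))) with hloop
  have hwr : ∀ x, loop.WR x → x = 4 ∨ (7 ≤ x ∧ x ≤ 12) := by
    intro x hx
    simp only [hloop, Prog.WR, Prog.WR_forLoop, WR_posProg] at hx
    rcases hx with h | h | h | h | h
    · omega
    · omega
    · omega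
    · omega
    · have := WR_columnProg h; omega
  have hcol : ∀ x, x ≠ 10 → x ≠ 11 → x ≠ 12 → ¬ (columnProg g j).WR x := fun x h1 h2 h3 h => by
    have := WR_columnProg h; omega
  have hkeep : loop.KeepsInput := by
    refine ⟨fun r hr => ?_, fun a ha => ?_⟩
    · have := hwr r hr; omega
    · simp [hloop] at ha; omega
  refine runs_seq (Runs.mono (Q := fun s1 => s1.reg 12 = D.blk g D.n ∧ Table D g j s1) ?_ le_rfl
    fun s1 _ h1 _ => runs_copy ⟨h1.2, by simp [Store.setReg, h1.1]⟩)
  -- The guards `0 < i` are needed because before the target's round neither the counter nor the row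
  -- of bounds has been set.
  refine runs_forLoop (fun i s' => (0 < i → s'.reg 12 = D.blk g D.n) ∧
    (∀ t < D.n, D.Mark g t → ∀ i' < i, s'.mem (8 * j + 5) (D.blk g t) i' = D.virt j t i') ∧
    (0 < i → ∀ t < D.n, D.Mark g t →
      (∀ i' < i, 0 < i' → Data.Bounds g (D.pos j i') t →
        s'.mem (8 * j + 6) 0 (D.blk g t) = D.dist j i') ∧
      ((∀ i' < i, 0 < i' → ¬ Data.Bounds g (D.pos j i') t) →
        s'.mem (8 * j + 6) 0 (D.blk g t) = D.dflt g j))) hI0.n ?_ ?_ (by simp) (by simp) ?_ ?_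
  · simp only [Prog.WR, WR_posProg]
    have := hcol 7 (by simp) (by simp) (by simp)
    simp [this]
  · simp only [Prog.WR, WR_posProg]
    have := hcol 0 (by simp) (by simp) (by simp)
    simp [this]
  · rintro i hi s1 hs1 h7 ⟨h12, hA, hS⟩
    have hI1 := hI0.of_same hs1 hkeep
    have hd1 : ∀ i < D.n, s1.mem (8 * j + 4) 0 i = D.dist j i := by
      rw [hs1.2 _ (by simp)]; exact hd0
    refine runs_seq ((runs_posProg hF hI1 h7 hi hd1).mono le_rfl fun s2 hs2 h8 _ => ?_)
    have hI2 := hI1.of_same hs2 (by simp [Prog.KeepsInput])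
    have hpn : D.pos j i ≤ D.n := (Finset.card_filter_le _ _).trans (Finset.card_range _).le
    refine runs_seq (runs_copy fun hs3 => runs_seq (runs_incr (by simp [Store.setReg, h8]; omega)
      fun hs4 => ?_))
    have hI3 := (hI2.of_same hs3 (by simp [Prog.KeepsInput])).of_same hs4
      (by simp [Prog.KeepsInput])
    have hm2 : s2.mem = s1.mem := funext fun a => hs2.2 a (by simp)
    refine (runs_columnProg (g := g) (i := i) hF hI3 ?_ hi ?_ ?_ ?_ ?_).mono le_rfl
      fun s5 hs5 h5 _ => ?_
    · simp [Store.setReg, hs2.1 7 (by simp), h7]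
    · simp [Store.setReg, h8]
    · simp [Store.setReg, h8]
    · intro i' hi'
      change s2.mem _ _ _ = _
      rw [hm2]; exact hd1 i' hi'
    · change s2.mem _ _ _ = _
      rw [hm2, hs1.2 _ (by simp; omega)]; exact hdf
    obtain ⟨k12, kA, kA', kS⟩ := h5
    have hmm : ((s2.setReg 9 (s2.reg 8)).setReg 9 ((s2.setReg 9 (s2.reg 8)).reg 9 + 1)).mem =
      s1.mem := hm2
    rw [hmm] at kA' kS
    refine ⟨fun _ => by simpa [Store.setReg] using k12, fun t ht hM i' hi' => ?_,
      fun _ t ht hM => ?_⟩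
    · change s5.mem _ _ _ = _
      rcases Nat.lt_succ_iff_lt_or_eq.1 hi' with h | rfl
      · rw [kA' _ _ h.ne]; exact hA t ht hM i' h
      · exact kA t ht hM
    · change (∀ i' < i + 1, 0 < i' → Data.Bounds g (D.pos j i') t → s5.mem _ _ _ = _) ∧
        (_ → s5.mem _ _ _ = _)
      rw [kS t ht hM, Data.newRad]
      rcases Nat.eq_zero_or_pos i with rfl | hi0
      · simp only [if_true, implies_true, and_true]
        intro i' h1 h2; omega
      · obtain ⟨hS1, hS2⟩ := hS hi0 t ht hM
        rw [if_neg hi0.ne']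
        split_ifs with hB
        · refine ⟨fun i' hi' hi0' hB' => ?_, fun h => absurd hB (h i (by omega) hi0)⟩
          rw [Data.pos_inj hT hj hi hi0 (by omega) hi0' (hB.unique hB')]
        · refine ⟨fun i' hi' hi0' hB' => ?_, fun h => hS2 fun i' hi' => h i' (by omega)⟩
          rcases Nat.lt_succ_iff_lt_or_eq.1 hi' with h | rfl
          · exact hS1 i' h hi0' hB'
          · exact absurd hB' hB
  · rintro s' - - ⟨h12, hA, hS⟩
    refine ⟨h12 hn, fun t ht hM => ⟨hA t ht hM, ?_⟩⟩
    obtain ⟨hS1, hS2⟩ := hS hn t ht hM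
    by_cases h : ∃ i < D.n, 0 < i ∧ Data.Bounds g (D.pos j i) t
    · obtain ⟨i, hi, hi0, hB⟩ := h
      rw [hS1 i hi hi0 hB, Data.rad_eq_dist hT hj hi hi0 hB]
    · push Not at h
      rw [hS2 h, Data.rad_eq_dflt h]

end

/-! ### The search through the scenarios -/

/-- Sums the scores, in the current scenario, of the candidate in register `c`. -/
def sumProg (m c a : ℕ) : Prog :=
  .seq (.const (tmpCell a) 0)
    (.unroll (fun j => .arith .add (tmpCell a) (tmpCell a) ⟨8 * j + 5, 20 + j, c⟩) m)

/-- Decides whether the goal is reached in the current scenario. -/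
def electProg (g : Goal) (m : ℕ) : Prog :=
  .seq (sumProg m 3 0)
    (match g with
      | .constructive => .seq (.load 14 1) (.forLoop 7 0
          (.seq (sumProg m 7 1) (.ifLe (tmpCell 1) (tmpCell 0) .skip (.clear 14))))
      | .destructive => .seq (.clear 14) (.forLoop 7 0
          (.seq (sumProg m 7 1)
            (.ifIdx 3 7 (.ifLe (tmpCell 0) (tmpCell 1) (.load 14 1) .skip) .skip))))

/-- The number of the scalar for a parameter. -/
def encVar (m : ℕ) : Var m → ℕ
  | .inl false => 0
  | .inl true => 1
  | .inr (.inl j) => 4 * j + 2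
  | .inr (.inr (.inl (j, l))) => 4 * (j * m + l) + 3
  | .inr (.inr (.inr (j, k))) => 4 * (j * m + k) + 4

/-- Checks the current scenario. -/
def scenarioProg (g : Goal) (m : ℕ) (ψ : Fm (Var m)) : Prog :=
  .seq (.unroll (fun j => .move (varCell (4 * j + 2)) ⟨8 * j + 6, 3, 20 + j⟩) m)
    (.seq (electProg g m) (.ifIdx 3 14 (ψ.compile (encVar m) (.load 15 1) .skip) .skip))

/-- Runs `p` for all scenarios of the first `j` voters. -/
def searchProg (p : Prog) : ℕ → Prog
  | 0 => p
  | j + 1 => .forLoop (20 + j) 13 (searchProg p j)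

@[simp] theorem WR_sumProg {m c a x : ℕ} : ¬ (sumProg m c a).WR x := by
  simp [sumProg]

theorem WA_sumProg {m c a x : ℕ} (h : (sumProg m c a).WA x) : x = 8 * a + 8 := by
  simp only [sumProg, Prog.WA, Prog.WA_unroll, tmpCell] at h
  rcases h with h | ⟨_, _, h⟩ <;> exact h

theorem WR_electProg {g : Goal} {m x : ℕ} (h : (electProg g m).WR x) : x = 7 ∨ x = 14 := by
  cases g <;> simp [electProg] at h <;> omega

theorem WA_electProg {g : Goal} {m x : ℕ} (h : (electProg g m).WA x) : x = 8 ∨ x = 16 := by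
  cases g
  · simp only [electProg, Prog.WA, Prog.WA_forLoop, Prog.WA_load, false_or, or_false] at h
    rcases h with h | h <;> have := WA_sumProg h <;> omega
  · simp only [electProg, Prog.WA, Prog.WA_forLoop, Prog.WA_load, false_or, or_false] at h
    rcases h with h | h <;> have := WA_sumProg h <;> omega

theorem WR_scenarioProg {g : Goal} {m : ℕ} {ψ : Fm (Var m)} {x : ℕ}
    (h : (scenarioProg g m ψ).WR x) : x = 7 ∨ x = 14 ∨ x = 15 := by
  simp only [scenarioProg, Prog.WR, Prog.WR_unroll, and_false, exists_false, false_or,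
    or_false] at h
  rcases h with h | h
  · have := WR_electProg h; omega
  · have := ψ.WR_compile h
    simp at this; omega

theorem WA_scenarioProg {g : Goal} {m : ℕ} {ψ : Fm (Var m)} {x : ℕ}
    (h : (scenarioProg g m ψ).WA x) : x % 32 = 23 ∨ x % 8 = 0 := by
  simp only [scenarioProg, Prog.WA, Prog.WA_unroll, or_false] at h
  rcases h with ⟨j, -, h⟩ | h | h
  · simp only [varCell] at h; omega
  · have := WA_electProg h; omega
  · obtain ⟨b, hb⟩ | h | h := ψ.WA_compile h
    · omega
    · simp at h
    · simp at h

theorem WR_searchProg {p : Prog} {j x : ℕ} (h : (searchProg p j).WR x) :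
    p.WR x ∨ (20 ≤ x ∧ x < 20 + j) := by
  induction j with
  | zero => exact Or.inl h
  | succ j ih =>
    rcases Prog.WR_forLoop.1 h with h | h
    · exact Or.inr (by omega)
    · rcases ih h with h | h
      exacts [Or.inl h, Or.inr (by omega)]

theorem WA_searchProg {p : Prog} {j x : ℕ} (h : (searchProg p j).WA x) : p.WA x := by
  induction j with
  | zero => exact h
  | succ j ih => exact ih (Prog.WA_forLoop.1 h)

section
variable {K : Type} [Field K] [LinearOrder K] {M : Meter K} {D : Data K} {m L : ℕ} {s : Store K}
  {g : Goal} {e : ℕ → ℕ} {ψ : Fm (Var m)}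

/-- The store is ready for the search. -/
structure Ready (D : Data K) (g : Goal) (m : ℕ) (s : Store K) : Prop where
  input : Input D s
  params : Params D m s
  table : ∀ j < m, Table D g j s
  size : 0 < m → s.reg 13 = D.blk g D.n

/-- The search may write flags, loop counters, the squared radii (arrays 23 modulo 32) and scratch
scalars (positive multiples of 8; array `0` holds the candidates). None of these belongs to the
precomputed data. -/
theorem Ready.of_same {s' : Store K} (h : Ready D g m s) {p : Prog} (hs : Same p s s')
    (hr : ∀ x, p.WR x → x = 7 ∨ x = 14 ∨ x = 15 ∨ 20 ≤ x)
    (ha : ∀ x, p.WA x → x % 32 = 23 ∨ x % 8 = 0 ∧ 0 < x) : Ready D g m s' where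
  input := h.input.of_same hs ⟨fun r h => by have := hr r h; omega, fun a h => by
    have := ha a h; omega⟩
  params := h.params.of_same hs fun v hv => by have := ha _ hv; omega
  table j hj t ht hM := by
    rw [hs.2 (8 * j + 5) fun h => by have := ha _ h; omega,
      hs.2 (8 * j + 6) fun h => by have := ha _ h; omega]
    exact h.table j hj t ht hM
  size hm := by
    rw [hs.1 13 fun h => by have := hr _ h; omega]; exact h.size hm

/-- The registers describe the scenario where voter `j` puts the target candidate on the marked
rank `e j`. -/
def Scenario (D : Data K) (g : Goal) (m : ℕ) (e : ℕ → ℕ) (s : Store K) : Prop :=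
  ∀ j < m, s.reg (20 + j) = D.blk g (e j) ∧ e j < D.n ∧ D.Mark g (e j)

theorem Fits.ht_virt (hF : Fits M D m L) (j t i : ℕ) : M.ht (D.virt j t i) ≤ L := by
  rw [Data.virt]
  split_ifs <;> exact hF.score _

theorem Fits.ht_virt_sum (hF : Fits M D m L) (e : ℕ → ℕ) (i c : ℕ) :
    M.ht (∑ j ∈ Finset.range c, D.virt j (e j) i) ≤ c * (L + 1) + 1 := by
  induction c with
  | zero => simpa using M.ht_int 0
  | succ c ih =>
    rw [Finset.sum_range_succ]
    have h := M.ht_op .add (∑ j ∈ Finset.range c, D.virt j (e j) i) (D.virt c (e c) i)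
    have h1 := hF.ht_virt c (e c) i
    simp only [ArithOp.eval] at h
    rw [Nat.succ_mul]
    omega

theorem runs_sumProg (hF : Fits M D m L) (h3 : s.reg 3 = 0) (hT : ∀ j < m, Table D g j s)
    (hE : Scenario D g m e s) {c i : ℕ} (a : ℕ) (hc : s.reg c = i) (hi : i < D.n) :
    Runs M (sumProg m c a) (m + 2) s fun s' =>
      s'.mem (8 * a + 8) 0 0 = ∑ j ∈ Finset.range m, D.virt j (e j) i := by
  refine (runs_seq (N := 1) (N' := m * 1 + 1) (runs_const (by simpa using hF.one_le)
    fun hs0 => ?_)).weaken (by omega)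
  refine runs_unroll (fun k s' => s'.mem (8 * a + 8) 0 0 =
    ∑ j ∈ Finset.range k, D.virt j (e j) i) (by simp [Store.set, tmpCell, h3])
    (fun k hk s' hs hk' => ?_) (fun _ _ h => h)
  have hr : s'.reg = s.reg := funext fun r => by rw [hs.1 r (by simp)]; rfl
  have hm : s'.mem (8 * k + 5) = s.mem (8 * k + 5) := by
    rw [hs.2 _ (by simp [tmpCell]; omega), hs0.2 _ (by simp [tmpCell]; omega)]
  obtain ⟨h1, h2, hM⟩ := hE k hk
  have hg : s'.get ⟨8 * k + 5, 20 + k, c⟩ = D.virt k (e k) i := by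
    simp [Store.get, hr, hm, h1, hc, (hT k hk _ h2 hM).1 i hi]
  have hg' : s'.get (tmpCell a) = ∑ j ∈ Finset.range k, D.virt j (e j) i := by
    simp [Store.get, tmpCell, hr, h3, hk']
  have hv : ArithOp.eval .add (s'.get (tmpCell a)) (s'.get ⟨8 * k + 5, 20 + k, c⟩) =
      ∑ j ∈ Finset.range (k + 1), D.virt j (e j) i := by
    rw [hg, hg', Finset.sum_range_succ]; rfl
  have hle : (k + 1) * (L + 1) ≤ m * (L + 1) := Nat.mul_le_mul_right _ hk
  refine runs_arith ?_ fun _ => ?_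
  · rw [hv]
    have := hF.ht_virt_sum e i (k + 1)
    have := hF.sum
    omega
  · rw [hv]
    simp [Store.set, tmpCell, hr, h3]

theorem runs_electProg (hF : Fits M D m L) (hI : Input D s) (hT : ∀ j < m, Table D g j s)
    (hE : Scenario D g m e s) (hn : 0 < D.n) :
    Runs M (electProg g m) (D.n * (m + 9) + m + 7) s fun s' =>
      s'.reg 14 ≤ 1 ∧ (s'.reg 14 = 1 ↔ D.Elected g m e) := by
  have h3 := hI.zero
  have hR := hF.reg
  have step : ∀ s1 s2 : Store K, Same (sumProg m 3 0) s s1 → s2.mem = s1.mem →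
      (∀ r, r ≠ 14 → s2.reg r = s1.reg r) → ∀ s3, (∀ r, r ≠ 7 → r ≠ 14 → s3.reg r = s2.reg r) →
      (∀ a, a ≠ 16 → s3.mem a = s2.mem a) →
      s3.reg 3 = 0 ∧ (∀ j < m, Table D g j s3) ∧ Scenario D g m e s3 := by
    intro s1 s2 hs1 hm2 hr2 s3 hr3 hm3
    have hr : ∀ r, r ≠ 7 → r ≠ 14 → s3.reg r = s.reg r := fun r h1 h2 => by
      rw [hr3 r h1 h2, hr2 r h2, hs1.1 r (by simp)]
    have hm : ∀ a, a ≠ 8 → a ≠ 16 → s3.mem a = s.mem a := fun a h1 h2 => by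
      rw [hm3 a h2, hm2, hs1.2 a fun h => h1 (WA_sumProg h)]
    refine ⟨by rw [hr 3 (by simp) (by simp), h3], fun j hj t ht hM => ?_, fun j hj => ?_⟩
    · rw [hm _ (by omega) (by omega), hm _ (by omega) (by omega)]
      exact hT j hj t ht hM
    · rw [hr _ (by omega) (by omega)]
      exact hE j hj
  -- The common loop of both goals: `I i` is the verdict on the first `i` candidates, and `p`
  -- updates the flag after comparing one total with that of the target.
  have loop : ∀ (p : Prog) (I : ℕ → Prop) (c : ℕ) (s1 s2 : Store K), Same (sumProg m 3 0) s s1 →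
      s1.mem 8 0 0 = ∑ j ∈ Finset.range m, D.virt j (e j) 0 → s2.mem = s1.mem →
      (∀ r, r ≠ 14 → s2.reg r = s1.reg r) → s2.reg 14 ≤ 1 → (s2.reg 14 = 1 ↔ I 0) →
      (∀ x, p.WR x → x = 14) → (∀ x, ¬ p.WA x) →
      (∀ i < D.n, ∀ s3 : Store K, s3.reg 3 = 0 → s3.reg 7 = i → s3.reg 14 ≤ 1 →
        (s3.reg 14 = 1 ↔ I i) →
        s3.get (tmpCell 0) = ∑ j ∈ Finset.range m, D.virt j (e j) 0 →
        s3.get (tmpCell 1) = ∑ j ∈ Finset.range m, D.virt j (e j) i →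
        Runs M p 5 s3 fun s4 => s4.reg 14 ≤ 1 ∧ (s4.reg 14 = 1 ↔ I (i + 1))) →
      (I D.n ↔ D.Elected g m e) →
      Runs M (.forLoop 7 0 (.seq (sumProg m 7 1) p)) (D.n * (m + 9) + 2) s2 fun s' =>
        s'.reg 14 ≤ 1 ∧ (s'.reg 14 = 1 ↔ D.Elected g m e) := by
    intro p I c s1 s2 hs1 h8 hm2 hr2 h14 h14' hwr hwa hp hfin
    have hnw : ∀ x, x ≠ 14 → ¬ p.WR x := fun x hx h => hx (hwr x h)
    refine runs_forLoop (N := m + 2 + 5) (fun i s' => s'.reg 14 ≤ 1 ∧ (s'.reg 14 = 1 ↔ I i))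
      (by rw [hr2 0 (by simp), hs1.1 0 (by simp), hI.n]) (by simp [hnw]) (by simp [hnw]) (by simp)
      (by simpa [Store.setReg] using ⟨h14, h14'⟩) (fun i hi s3 hs3 h7 hI3 => ?_)
      (fun _ _ _ h => ⟨h.1, h.2.trans hfin⟩)
    have hr3 : ∀ r, r ≠ 7 → r ≠ 14 → s3.reg r = s2.reg r := fun r h1 h2 =>
      hs3.1 r (by simp [h1, hnw r h2])
    have hm3 : ∀ a, a ≠ 16 → s3.mem a = s2.mem a := fun a ha => hs3.2 a (by
      simp only [Prog.WA_forLoop, Prog.WA, hwa, or_false]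
      exact fun h => ha (WA_sumProg h))
    obtain ⟨k3, kT, kE⟩ := step s1 s2 hs1 hm2 hr2 s3 hr3 hm3
    refine runs_seq ((runs_sumProg hF k3 kT kE 1 h7 hi).mono le_rfl fun s4 hs4 h16 _ => ?_)
    have hr4 : s4.reg = s3.reg := funext fun r => hs4.1 r (by simp)
    have hm4 : s4.mem 8 = s3.mem 8 := hs4.2 8 fun h => by have := WA_sumProg h; omega
    refine (hp i hi s4 (by rw [hr4, k3]) (by rw [hr4, h7]) (by rw [hr4]; exact hI3.1)
      (by rw [hr4]; exact hI3.2) ?_ ?_).mono le_rfl fun s5 _ h5 _ => by simpa [Store.setReg] using h5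
    · simp [Store.get, tmpCell, hr4, k3, hm4, hm3 8 (by simp), hm2, h8]
    · simpa [Store.get, tmpCell, hr4, k3] using h16
  refine (runs_seq (N := m + 2) (N' := D.n * (m + 9) + 5)
    ((runs_sumProg hF h3 hT hE 0 h3 hn).mono le_rfl fun s1 hs1 h8 _ => ?_)).weaken (by omega)
  simp only [Nat.mul_zero, Nat.zero_add] at h8
  cases g
  · refine (runs_seq (N := 3) (N' := D.n * (m + 9) + 2) (runs_load (by omega)
      fun s2 hs2 h14 hm2 _ => ?_)).weaken (by omega)
    refine loop (.ifLe (tmpCell 1) (tmpCell 0) .skip (.clear 14))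
      (fun i => ∀ i' < i, ∑ j ∈ Finset.range m, D.virt j (e j) i' ≤
        ∑ j ∈ Finset.range m, D.virt j (e j) 0) 0 s1 s2 hs1 h8 hm2
      (fun r hr => hs2.1 r (by simpa using hr)) h14.le (by simp [h14]) (by simp) (by simp)
      (fun i hi s3 k3 k7 k14 k14' kt0 kt1 => ?_) Iff.rfl
    refine (runs_ifLe (N := 1) (fun h => runs_skip ?_) fun h => runs_clear ?_).weaken (by omega)
    · rw [kt0, kt1] at h
      refine ⟨k14, k14'.trans ⟨fun h' i' hi' => ?_, fun h' i' hi' => h' i' (by omega)⟩⟩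
      rcases Nat.lt_succ_iff_lt_or_eq.1 hi' with h1 | rfl
      exacts [h' i' h1, h]
    · rw [kt0, kt1] at h
      simp only [Store.setReg, Function.update_self, zero_le, true_and]
      exact ⟨fun h' => by omega, fun h' => absurd (h' i (by omega)) h⟩
  · refine (runs_seq (N := 1) (N' := D.n * (m + 9) + 2) (runs_clear fun hs2 => ?_)).weaken
      (by omega)
    refine loop (.ifIdx 3 7 (.ifLe (tmpCell 0) (tmpCell 1) (.load 14 1) .skip) .skip)
      (fun i => ∃ i' < i, 0 < i' ∧ ∑ j ∈ Finset.range m, D.virt j (e j) 0 ≤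
        ∑ j ∈ Finset.range m, D.virt j (e j) i') 0 s1 _ hs1 h8 rfl
      (fun r hr => hs2.1 r (by simpa using hr)) (by simp [Store.setReg]) (by simp [Store.setReg])
      (by simp) (by simp) (fun i hi s3 k3 k7 k14 k14' kt0 kt1 => ?_) Iff.rfl
    have hskip : ¬ (0 < i ∧ ∑ j ∈ Finset.range m, D.virt j (e j) 0 ≤
        ∑ j ∈ Finset.range m, D.virt j (e j) i) → (s3.reg 14 = 1 ↔ ∃ i' < i + 1, 0 < i' ∧
        ∑ j ∈ Finset.range m, D.virt j (e j) 0 ≤ ∑ j ∈ Finset.range m, D.virt j (e j) i') := by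
      intro h
      refine k14'.trans ⟨fun ⟨i', h1, h2⟩ => ⟨i', by omega, h2⟩, fun ⟨i', h1, h2⟩ => ?_⟩
      rcases Nat.lt_succ_iff_lt_or_eq.1 h1 with h1 | rfl
      exacts [⟨i', h1, h2⟩, absurd h2 h]
    refine runs_ifIdx (N := 4) (fun h => runs_ifLe (N := 3) (fun h' => runs_load (by omega)
      fun s4 _ k _ => ⟨k.le, ?_⟩) fun h' => (runs_skip ⟨k14, hskip fun h'' => ?_⟩).weaken (by omega))
      fun h => (runs_skip ⟨k14, hskip fun h'' => ?_⟩).weaken (by omega)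
    · rw [kt0, kt1] at h'
      rw [k3, k7] at h
      exact iff_of_true k ⟨i, by omega, h, h'⟩
    · rw [kt0, kt1] at h'
      exact h' h''.2
    · rw [k3, k7] at h
      exact h h''.1

theorem Fits.ht_rad (hF : Fits M D m L) (hT : D.NoTies m) {j : ℕ} (hj : j < m) (t : ℕ) :
    M.ht (D.rad g j t) ≤ D.height L := by
  by_cases h : ∃ i < D.n, 0 < i ∧ Data.Bounds g (D.pos j i) t
  · obtain ⟨i, hi, hi0, hB⟩ := h
    rw [Data.rad_eq_dist hT hj hi hi0 hB]
    exact hF.ht_dist j i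
  · push Not at h
    rw [Data.rad_eq_dflt h]
    exact hF.ht_dflt g j

theorem Fits.ht_env (hF : Fits M D m L) (hT : D.NoTies m) (v : Var m) :
    M.ht (D.env m (fun j => D.rad g j (e j)) v) ≤ D.height L := by
  rcases v with (_ | _) | j | ⟨j, l⟩ | ⟨j, k⟩
  · have := hF.ht_sq
    simp only [Data.env, Data.height]; omega
  · have := M.ht_nat_le D.d
    simp only [Data.env, Data.height]; omega
  · exact hF.ht_rad hT j.2 _
  · have := hF.ht_dot j l 0
    simp only [Data.env, Data.height]; omega
  · have := hF.ht_diff j 0 k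
    simp only [Data.env, Data.height]; omega

/-- A pair of voter indices is stored at `j * m + l`; quotient and remainder by `m` recover the
pair. -/
theorem Params.hasEnv (hP : Params D m s) (h3 : s.reg 3 = 0) {ρ : ℕ → K}
    (hρ : ∀ j < m, s.mem (8 * (4 * j + 2) + 7) 0 0 = ρ j) :
    HasEnv (encVar m) (D.env m ρ) s := by
  have hdm : ∀ j l : Fin m, ((j : ℕ) * m + l) < m * m ∧ ((j : ℕ) * m + l) / m = j ∧
      ((j : ℕ) * m + l) % m = l := fun j l => by
    have hm : 0 < m := by have := j.2; omega
    refine ⟨?_, ?_, ?_⟩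
    · have h : ((j : ℕ) + 1) * m ≤ m * m := Nat.mul_le_mul_right _ j.2
      rw [Nat.succ_mul] at h
      have := l.2
      omega
    · rw [Nat.add_comm, Nat.add_mul_div_right _ _ hm, Nat.div_eq_of_lt l.2, Nat.zero_add]
    · rw [Nat.add_comm, Nat.add_mul_mod_self_right, Nat.mod_eq_of_lt l.2]
  refine ⟨h3, fun v => ?_⟩
  rcases v with (_ | _) | j | ⟨j, l⟩ | ⟨j, k⟩
  · exact hP.sq
  · exact hP.dim
  · exact hρ j j.2
  · obtain ⟨h1, h2, h4⟩ := hdm j l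
    have := hP.gram _ h1
    rw [h2, h4] at this
    exact this
  · obtain ⟨h1, h2, h4⟩ := hdm j k
    have := hP.coord _ h1
    rw [h2, h4] at this
    exact this

/-- The scenario answers the question affirmatively. -/
def Good (D : Data K) (g : Goal) (m : ℕ) (ψ : Fm (Var m)) (e : ℕ → ℕ) : Prop :=
  D.Elected g m e ∧ ψ.Holds (D.env m fun j => D.rad g j (e j))

/-- The formula is evaluated only if the scenario reaches the goal. Register `15` can be raised but
is never lowered, so it accumulates the disjunction over all scenarios. -/
theorem runs_scenarioProg (hF : Fits M D m L) (hψ : ψ.size * (D.height L + 1) ≤ M.H)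
    (hT : D.NoTies m) (hn : 0 < D.n) (hs : Ready D g m s) (hE : Scenario D g m e s)
    (h15 : s.reg 15 ≤ 1) :
    Runs M (scenarioProg g m ψ) (D.n * (m + 9) + 2 * m + ψ.size + 12) s fun s' =>
      s'.reg 15 ≤ 1 ∧ (s'.reg 15 = 1 ↔ s.reg 15 = 1 ∨ Good D g m ψ e) := by
  have hR := hF.reg
  refine (runs_seq (N := m * 1 + 1) (N' := (D.n * (m + 9) + m + 7) + ((ψ.size + 3) + 1))
    ((runs_unroll_posts (fun j s' => s'.mem (8 * (4 * j + 2) + 7) 0 0 = D.rad g j (e j))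
      (fun i _ i' _ hne s1 s2 hs12 h => ?_) fun j hj s' hs' => runs_move ?_).mono le_rfl
      fun s1 hs1 h1 _ => ?_)).weaken (by omega)
  · rw [hs12.2 _ (by simp [varCell]; omega)]; exact h
  · have hr : s'.reg = s.reg := funext fun r => hs'.1 r (by simp)
    have hm : s'.mem (8 * j + 6) = s.mem (8 * j + 6) := hs'.2 _ (by simp [varCell]; omega)
    obtain ⟨e1, e2, hM⟩ := hE j hj
    simp [Store.set, Store.get, varCell, hr, hm, hs.input.zero, e1, (hs.table j hj _ e2 hM).2]
  have hr1 : s1.reg = s.reg := funext fun r => hs1.1 r (by simp)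
  have hready1 : Ready D g m s1 := hs.of_same hs1 (by simp) (fun x hx => by
    simp [varCell] at hx; omega)
  have hE1 : Scenario D g m e s1 := fun j hj => by rw [hr1]; exact hE j hj
  refine runs_seq ((runs_electProg hF hready1.input hready1.table hE1 hn).mono le_rfl
    fun s2 hs2 h2 _ => ?_)
  have h15' : s2.reg 15 = s.reg 15 := by
    rw [hs2.1 15 fun h => by have := WR_electProg h; omega, hr1]
  have hready2 : Ready D g m s2 := hready1.of_same hs2
    (fun x hx => by have := WR_electProg hx; omega) (fun x hx => by
      have := WA_electProg hx; omega)
  have henv : HasEnv (encVar m) (D.env m fun j => D.rad g j (e j)) s2 :=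
    hready2.params.hasEnv hready2.input.zero fun j hj => by
      rw [hs2.2 _ fun h => by have := WA_electProg h; omega, h1 j hj]
  have hskip : ¬ Good D g m ψ e → ∀ s3 : Store K, s3.reg = s2.reg →
      s3.reg 15 ≤ 1 ∧ (s3.reg 15 = 1 ↔ s.reg 15 = 1 ∨ Good D g m ψ e) := fun h s3 h3 => by
    rw [h3, h15']
    exact ⟨h15, by simp [h]⟩
  refine runs_ifIdx (fun h => ?_) fun h => ?_
  · rw [hready2.input.zero] at h
    have hel : D.Elected g m e := h2.2.1 (by omega)
    refine Fm.runs_compile (hF.ht_env hT) ψ hψ henv (fun hH s3 hs3 => ?_) fun hH s3 hs3 => ?_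
    · exact runs_load (by omega) fun s4 _ k _ => ⟨k.le, iff_of_true k (Or.inr ⟨hel, hH⟩)⟩
    · exact (runs_skip (hskip (fun hg => hH hg.2) s3 hs3.1)).weaken (by omega)
  · rw [hready2.input.zero] at h
    refine (runs_skip (hskip (fun hg => h ?_) s2 rfl)).weaken (by omega)
    have := h2.2.2 hg.1
    omega

/-- The time of the search. -/
def searchCost (u N : ℕ) : ℕ → ℕ
  | 0 => N
  | j + 1 => u * (searchCost u N j + 2) + 2

/-- The recursion adds `2 * u + 2` to the nested cost times `u`; with `X` the bound for the inner
loops, this is at most `4 * u * X`, whence the factor 5 per level. -/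
theorem searchCost_le {u N : ℕ} (hu : 1 ≤ u) (hN : 1 ≤ N) (j : ℕ) :
    searchCost u N j ≤ 5 ^ j * u ^ j * N := by
  induction j with
  | zero => simp [searchCost]
  | succ j ih =>
    have h1 : 1 ≤ 5 ^ j * u ^ j * N := Nat.one_le_iff_ne_zero.2 (by positivity)
    have h2 : u * searchCost u N j ≤ u * (5 ^ j * u ^ j * N) := Nat.mul_le_mul_left _ ih
    have h3 : u ≤ u * (5 ^ j * u ^ j * N) := Nat.le_mul_of_pos_right _ h1
    have h4 : 5 ^ (j + 1) * u ^ (j + 1) * N = 5 * (u * (5 ^ j * u ^ j * N)) := by ring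
    simp only [searchCost, Nat.mul_add]
    omega

/-- Ranks of the voters from `j` on are fixed by the enclosing loops and described by `e`; the
search supplies the ranks of the voters before `j`. -/
theorem runs_searchProg (hF : Fits M D m L) (hψ : ψ.size * (D.height L + 1) ≤ M.H)
    (hT : D.NoTies m) (hn : 0 < D.n) {j : ℕ} (hj : j ≤ m) (hs : Ready D g m s)
    (hE : ∀ l, j ≤ l → l < m → s.reg (20 + l) = D.blk g (e l) ∧ e l < D.n ∧ D.Mark g (e l))
    (h15 : s.reg 15 ≤ 1) :
    Runs M (searchProg (scenarioProg g m ψ) j)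
      (searchCost (D.blk g D.n) (D.n * (m + 9) + 2 * m + ψ.size + 12) j) s fun s' =>
      s'.reg 15 ≤ 1 ∧ (s'.reg 15 = 1 ↔ s.reg 15 = 1 ∨ ∃ e', (∀ l, j ≤ l → l < m → e' l = e l) ∧
        (∀ l < j, e' l < D.n ∧ D.Mark g (e' l)) ∧ Good D g m ψ e') := by
  classical
  -- Only the ranks of the first `m` voters matter, which frees the arbitrary values of `e`
  -- elsewhere.
  have hgood : ∀ e', (∀ l < m, e' l = e l) → (Good D g m ψ e' ↔ Good D g m ψ e) := fun e' h => by
    have h1 : ∀ i, ∑ l ∈ Finset.range m, D.virt l (e' l) i =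
        ∑ l ∈ Finset.range m, D.virt l (e l) i := fun i =>
      Finset.sum_congr rfl fun l hl => by rw [h l (Finset.mem_range.1 hl)]
    have h2 : (D.env m fun j => D.rad g j (e' j)) = D.env m fun j => D.rad g j (e j) := by
      funext v
      rcases v with (_ | _) | l | ⟨_, _⟩ | ⟨_, _⟩ <;> simp [Data.env, h]
    cases g <;> simp only [Good, Data.Elected, h1, h2]
  induction j generalizing s e with
  | zero =>
    refine (runs_scenarioProg hF hψ hT hn hs (fun l hl => hE l (Nat.zero_le _) hl) h15).mono le_rfl
      fun s' _ h => ⟨h.1, h.2.trans (or_congr Iff.rfl ⟨fun h => ⟨e, by simp, by simp, h⟩, ?_⟩)⟩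
    rintro ⟨e', h1, -, h2⟩
    exact (hgood e' fun l hl => h1 l (Nat.zero_le _) hl).1 h2
  | succ j ih =>
    have hwr : ∀ x, (searchProg (scenarioProg g m ψ) j).WR x →
        x = 7 ∨ x = 14 ∨ x = 15 ∨ (20 ≤ x ∧ x < 20 + j) := fun x hx => by
      rcases WR_searchProg hx with h | h
      · have := WR_scenarioProg h; omega
      · omega
    have hwa : ∀ x, (searchProg (scenarioProg g m ψ) j).WA x → x % 32 = 23 ∨ x % 8 = 0 ∧ 0 < x :=
      fun x hx => by
        have h1 := WA_scenarioProg (WA_searchProg hx)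
        have h2 : x ≠ 0 := by
          rintro rfl
          have h := WA_searchProg hx
          simp only [scenarioProg, Prog.WA, Prog.WA_unroll, or_false] at h
          rcases h with ⟨j, -, h⟩ | h | h
          · simp only [varCell] at h; omega
          · have := WA_electProg h; omega
          · obtain ⟨b, hb⟩ | h | h := ψ.WA_compile h
            · omega
            · simp at h
            · simp at h
        omega
    have hne : 15 ≠ 20 + j := by omega
    refine runs_forLoop (fun k s' => s'.reg 15 ≤ 1 ∧ (s'.reg 15 = 1 ↔ s.reg 15 = 1 ∨
      ∃ e', (∀ l, j + 1 ≤ l → l < m → e' l = e l) ∧ (∀ l < j + 1, e' l < D.n ∧ D.Mark g (e' l)) ∧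
        D.blk g (e' j) < k ∧ Good D g m ψ e')) (hs.size (by omega)) (fun h => ?_) (fun h => ?_)
      (by omega) ?_ (fun k hk s1 hs1 hkr hk1 => ?_) fun s1 _ _ h => ⟨h.1, h.2.trans (or_congr Iff.rfl
        (exists_congr fun e' => and_congr Iff.rfl (and_congr_right fun h' => ?_)))⟩
    · have := hwr _ h; omega
    · have := hwr _ h; omega
    · simpa [Store.setReg, hne] using h15
    · have hready : Ready D g m s1 := hs.of_same hs1
        (fun x hx => by
          rcases Prog.WR_forLoop.1 hx with h | h
          · omega
          · have := hwr x h; omega)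
        (fun x hx => hwa x (Prog.WA_forLoop.1 hx))
      -- The counter runs over row numbers; each one is `blk` of a marked rank `t`, and the round
      -- extends the scenario by `t` for voter `j`.
      obtain ⟨t, ht, hM, rfl⟩ := Data.exists_blk_eq hk
      have hE1 : ∀ l, j ≤ l → l < m → s1.reg (20 + l) = D.blk g (Function.update e j t l) ∧
          Function.update e j t l < D.n ∧ D.Mark g (Function.update e j t l) := by
        intro l hl hlm
        rcases Nat.eq_or_lt_of_le hl with rfl | hlt
        · simp [hkr, ht, hM]
        · rw [Function.update_of_ne (by omega), hs1.1 _ fun h => ?_]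
          · exact hE l hlt hlm
          · rcases Prog.WR_forLoop.1 h with h | h
            · omega
            · have := hwr _ h; omega
      have hupd : ∀ e' : ℕ → ℕ, (∀ l, j ≤ l → l < m → e' l = Function.update e j t l) ↔
          e' j = t ∧ ∀ l, j + 1 ≤ l → l < m → e' l = e l := fun e' => by
        constructor
        · intro h
          refine ⟨by simpa using h j le_rfl (by omega), fun l hl hlm => ?_⟩
          rw [h l (by omega) hlm, Function.update_of_ne (by omega)]
        · rintro ⟨h1, h2⟩ l hl hlm
          rcases Nat.eq_or_lt_of_le hl with rfl | hlt
          · simp [h1]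
          · rw [Function.update_of_ne (by omega), h2 l hlt hlm]
      refine (ih (by omega) hready hE1 hk1.1 (fun e' h => ?_)).mono le_rfl fun s2 _ h2 _ => ?_
      · have h1 : ∀ i, ∑ l ∈ Finset.range m, D.virt l (e' l) i =
            ∑ l ∈ Finset.range m, D.virt l (Function.update e j t l) i := fun i =>
          Finset.sum_congr rfl fun l hl => by rw [h l (Finset.mem_range.1 hl)]
        have h2 : (D.env m fun l => D.rad g l (e' l)) =
            D.env m fun l => D.rad g l (Function.update e j t l) := by
          funext v
          rcases v with (_ | _) | l | ⟨_, _⟩ | ⟨_, _⟩ <;> simp [Data.env, h]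
        clear hk1 hgood hE1 hE hs hready
        cases g <;> simp only [Good, Data.Elected, h1, h2]
      refine ⟨by simpa [Store.setReg, hne] using h2.1, ?_⟩
      have h15' : (s2.setReg (20 + j) (D.blk g t + 1)).reg 15 = s2.reg 15 := by
        simp [Store.setReg, hne]
      rw [h15', h2.2, hk1.2, or_assoc]
      refine or_congr Iff.rfl ⟨?_, ?_⟩
      · rintro (⟨e', h1, h3, h4, h5⟩ | ⟨e', h1, h3, h5⟩)
        · exact ⟨e', h1, h3, by omega, h5⟩
        · obtain ⟨h6, h7⟩ := (hupd e').1 h1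
          refine ⟨e', h7, fun l hl => ?_, by rw [h6]; omega, h5⟩
          rcases Nat.lt_succ_iff_lt_or_eq.1 hl with h | rfl
          · exact h3 l h
          · rw [h6]; exact ⟨ht, hM⟩
      · rintro ⟨e', h1, h3, h4, h5⟩
        rcases Nat.lt_succ_iff_lt_or_eq.1 h4 with h | h
        · exact Or.inl ⟨e', h1, h3, h, h5⟩
        · have h6 := Data.blk_inj (h3 j (by omega)).2 hM h
          exact Or.inr ⟨e', (hupd e').2 ⟨h6, h1⟩, fun l hl => h3 l (by omega), h5⟩
    -- After the last round the restriction on the row number is void, since every marked rank has a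
    -- smaller row than their total number.
    · refine and_iff_right ?_
      exact Data.blk_lt_blk (h' j (by omega)).2 (h' j (by omega)).1

end

/-! ### The program -/

/-- Computes everything that the search looks up. -/
def setupProg (g : Goal) (m : ℕ) : Prog :=
  .seq (paramProg m) (.seq (.unroll distProg m) (.unroll (tableProg g) m))

/-- The program that answers the question. -/
def mainProg (g : Goal) (m : ℕ) (ψ : Fm (Var m)) : Prog :=
  .seq (setupProg g m) (.seq (searchProg (scenarioProg g m ψ) m) (.copy 0 15))

/-- The time of the setup. -/
def setupCost (m n d : ℕ) : ℕ :=
  (m * m * (d * 6 + 4 * m + 13) + d * 3 + 7) +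
    ((m * (n * (d * 6 + 6) + m + 4) + 1) + (m * (n * (n * 19 + 11) + 5) + 1))

/-- The time of the program with a formula of size `z` and `u` ranks of distinct scores. -/
def mainCost (m z u n d : ℕ) : ℕ :=
  setupCost m n d + (searchCost u (n * (m + 9) + 2 * m + z + 12) m + 1)

/-- The constant in the bound on the time. -/
def mainConst (m z : ℕ) : ℕ :=
  (m * m * 6 + 3 + 6 * m) + (m * m * (4 * m + 13) + 7 + (6 * m + m * (m + 4) + 1) +
    (35 * m + 1) + 1) + 5 ^ m * (3 * m + z + 21)

/-- The setup is linear in `n * d + n ^ 2` and the search in `u ^ m * n`, with constants depending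
on `m` and `z`; `d ^ 3` is added for free. -/
theorem mainCost_le {m z u n d : ℕ} (hn : 1 ≤ n) (hu : 1 ≤ u) :
    mainCost m z u n d ≤ mainConst m z * (n * d + n ^ 2 + u ^ m * (d ^ 3 + n)) := by
  have hd : d ≤ n * d := Nat.le_mul_of_pos_left _ hn
  have hn2 : n ≤ n ^ 2 := Nat.le_self_pow two_ne_zero n
  have h1 : 1 ≤ n ^ 2 := hn.trans hn2
  have hs : setupCost m n d ≤ (m * m * 6 + 3 + 6 * m) * (n * d) +
      (m * m * (4 * m + 13) + 7 + (6 * m + m * (m + 4) + 1) + (35 * m + 1)) * n ^ 2 := by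
    calc setupCost m n d = (m * m * 6 + 3) * d + 6 * m * (n * d) +
        ((m * m * (4 * m + 13) + 7 + m * (m + 4) + 1 + 5 * m + 1) * 1 + (17 * m) * n +
          19 * m * n ^ 2) := by simp only [setupCost]; ring
      _ ≤ (m * m * 6 + 3) * (n * d) + 6 * m * (n * d) +
        ((m * m * (4 * m + 13) + 7 + m * (m + 4) + 1 + 5 * m + 1) * n ^ 2 + (17 * m) * n ^ 2 +
          19 * m * n ^ 2) := by gcongr
      _ = _ := by ring
  have hc : searchCost u (n * (m + 9) + 2 * m + z + 12) m ≤
      5 ^ m * (3 * m + z + 21) * (u ^ m * n) := by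
    calc _ ≤ 5 ^ m * u ^ m * (n * (m + 9) + 2 * m * 1 + z * 1 + 12 * 1) := by
          simpa using searchCost_le hu (by omega) m
      _ ≤ 5 ^ m * u ^ m * (n * (m + 9) + 2 * m * n + z * n + 12 * n) := by gcongr
      _ = _ := by ring
  have hz : u ^ m * n ≤ u ^ m * (d ^ 3 + n) := Nat.mul_le_mul_left _ (by omega)
  simp only [mainCost, mainConst]
  generalize u ^ m * (d ^ 3 + n) = Z at hz ⊢
  generalize 5 ^ m * (3 * m + z + 21) = c at hc ⊢
  generalize m * m * 6 + 3 + 6 * m = a at hs ⊢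
  generalize m * m * (4 * m + 13) + 7 + (6 * m + m * (m + 4) + 1) + (35 * m + 1) = b at hs ⊢
  calc _ ≤ (a * (n * d) + b * n ^ 2) + (c * Z + n ^ 2) :=
        Nat.add_le_add hs (Nat.add_le_add (hc.trans (Nat.mul_le_mul_left _ hz)) h1)
    -- The added summand consists of the cross terms missing from the expanded product of the
    -- constant and the sum.
    _ ≤ (a * (n * d) + b * n ^ 2) + (c * Z + n ^ 2) + (a * (n ^ 2 + Z) + b * (n * d + Z) +
        (n * d + Z) + c * (n * d + n ^ 2)) := Nat.le_add_right _ _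
    _ = _ := by ring

theorem WR_paramProg {m x : ℕ} (h : (paramProg m).WR x) : 4 ≤ x ∧ x ≤ 6 := by
  simp only [paramProg, Prog.WR, Prog.WR_unroll] at h
  rcases h with h | h | ⟨_, _, h⟩ | ⟨_, _, h⟩
  · simp [sqProg] at h
  · simp [dimProg] at h; omega
  · simp [gramProg] at h; omega
  · simp [coordProg] at h; omega

theorem WA_paramProg {m x : ℕ} (h : (paramProg m).WA x) : 4 ≤ x := by
  simp only [paramProg, Prog.WA, Prog.WA_unroll] at h
  rcases h with h | h | ⟨_, _, h⟩ | ⟨_, _, h⟩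
  · simp [sqProg, varCell] at h; omega
  · simp [dimProg, varCell, tmpCell] at h; omega
  · simp [gramProg, varCell] at h; omega
  · simp [coordProg, varCell] at h; omega

theorem keepsInput_distProg (m : ℕ) : (Prog.unroll distProg m).KeepsInput := by
  constructor
  · intro r; simp [distProg]; omega
  · intro a; simp [distProg]; omega

section
variable {K : Type} [Field K] [LinearOrder K] {M : Meter K} {D : Data K} {m L : ℕ} {s : Store K}
  {g : Goal} {ψ : Fm (Var m)}

theorem runs_setupProg (hF : Fits M D m L) (hI : Input D s) (hT : D.NoTies m) (hn : 0 < D.n) :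
    Runs M (setupProg g m) (setupCost m D.n D.d) s (Ready D g m) := by
  refine runs_seq ((runs_paramProg hF hI).mono le_rfl fun s1 hs1 hP1 _ => ?_)
  have hI1 : Input D s1 := hI.of_same hs1
    ⟨fun r h => by have := WR_paramProg h; omega, fun a => WA_paramProg⟩
  refine runs_seq ((runs_unroll_posts (fun j s' => ∀ i < D.n, s'.mem (8 * j + 4) 0 i = D.dist j i)
    (fun j _ j' _ hne s2 s3 hs h i hi => ?_) fun j hj s' hs' =>
      runs_distProg hF (hI1.of_same hs' (keepsInput_distProg m)) hj).mono le_rfl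
    fun s2 hs2 hd _ => ?_)
  · rw [hs.2 _ (by simp [distProg]; omega)]; exact h i hi
  have hI2 : Input D s2 := hI1.of_same hs2 (keepsInput_distProg m)
  have hP2 : Params D m s2 := hP1.of_same hs2 fun v => by simp [distProg]; omega
  have hw : ∀ x, (Prog.unroll (tableProg g) m).WR x → x = 4 ∨ (7 ≤ x ∧ x ≤ 13) := fun x hx => by
    obtain ⟨j, -, h⟩ := Prog.WR_unroll.1 hx
    exact WR_tableProg h
  have hk : (Prog.unroll (tableProg g) m).KeepsInput :=
    ⟨fun r h => by have := hw r h; omega, fun a => by simp; omega⟩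
  have hp : ∀ v, (Prog.unroll (tableProg g) m).WA (8 * v + 7) → v % 4 = 2 := fun v => by
    simp; omega
  refine runs_unroll (fun j s' => (∀ j' < j, Table D g j' s') ∧ (0 < j → s'.reg 13 = D.blk g D.n))
    (by simp) (fun j hj s3 hs3 hI3 => ?_) fun s3 hs3 h =>
      ⟨hI2.of_same hs3 hk, hP2.of_same hs3 hp, h.1, h.2⟩
  refine (runs_tableProg hF (hI2.of_same hs3 hk) hT hj hn (fun i hi => ?_)
    (hP2.of_same hs3 hp).sq).mono le_rfl fun s4 hs4 h4 _ => ⟨fun j' hj' => ?_, fun _ => h4.2⟩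
  · rw [hs3.2 _ (by simp; omega)]; exact hd j hj i hi
  · rcases Nat.lt_succ_iff_lt_or_eq.1 hj' with h | rfl
    · intro t ht hM
      rw [hs4.2 _ (by simp; omega), hs4.2 _ (by simp; omega)]
      exact hI3.1 j' h t ht hM
    · exact h4.1

theorem WR_setupProg {x : ℕ} (h : (setupProg g m).WR x) : x ≤ 13 := by
  simp only [setupProg, Prog.WR, Prog.WR_unroll] at h
  rcases h with h | ⟨j, -, h⟩ | ⟨j, -, h⟩
  · have := WR_paramProg h; omega
  · simp [distProg] at h; omega
  · have := WR_tableProg h; omega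

theorem runs_mainProg (hF : Fits M D m L) (hψ : ψ.size * (D.height L + 1) ≤ M.H)
    (hI : Input D s) (hT : D.NoTies m) (hn : 0 < D.n) (h15 : s.reg 15 = 0) :
    Runs M (mainProg g m ψ) (mainCost m ψ.size (D.blk g D.n) D.n D.d) s fun s' =>
      s'.reg 0 ≤ 1 ∧ (s'.reg 0 = 1 ↔
        ∃ e, (∀ j < m, e j < D.n ∧ D.Mark g (e j)) ∧ Good D g m ψ e) := by
  refine runs_seq ((runs_setupProg hF hI hT hn).mono le_rfl fun s1 hs1 hr _ => ?_)
  have h15' : s1.reg 15 = 0 := by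
    rw [hs1.1 15 fun h => by have := WR_setupProg h; omega, h15]
  refine runs_seq ((runs_searchProg (e := fun _ => 0) hF hψ hT hn le_rfl hr
    (fun l h h' => by omega) (by omega)).mono le_rfl fun s2 hs2 h2 _ => runs_copy ?_)
  simp only [Store.setReg, Function.update_self]
  refine ⟨h2.1, h2.2.trans ?_⟩
  rw [h15', or_iff_right (by omega)]
  exact exists_congr fun e => ⟨fun h => h.2, fun h => ⟨fun l h1 h2 => by omega, h⟩⟩

theorem Instance.input_data {n d : ℕ} (I : Instance K n d m) : Input I.data I.input where
  n := rfl
  d := rfl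
  zero := rfl
  cand := rfl
  voter := rfl
  score k := by simp [Instance.input, Instance.data]
  budget := rfl

theorem Fits.ok {n d : ℕ} {I : Instance K n d m} (hF : Fits M I.data m L) : M.Ok I.input := by
  have h0 : M.ht 0 ≤ M.H := by simpa using (M.ht_int 0).trans hF.one_le
  have hL : L ≤ M.H := by
    have := hF.height
    simp only [Data.height] at this; omega
  have hR := hF.reg
  simp only [Instance.data] at hR
  constructor
  · intro r
    simp only [Instance.input]
    split <;> omega
  · intro a i k
    simp only [Instance.input]
    split
    · exact (hF.cand i k).trans hL
    · exact (hF.voter i k).trans hL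
    · split_ifs with h
      · have := hF.score k
        simp only [Instance.data, h.2, dif_pos] at this
        exact this.trans hL
      · exact h0
    · split_ifs
      · exact hF.budget.trans hL
      · exact h0
    · exact h0

/-- Field and meter are still arbitrary here; both cost bounds are instances. -/
theorem decidesWithin_mainProg {φ : K →+* ℝ} (hφ : StrictMono φ) {n d : ℕ} [NeZero n]
    {I : Instance K n d m} (hI : (I.map φ).Valid) (hF : Fits M I.data m L)
    (hψ : ∀ (D : Data ℝ) (ρ : ℕ → ℝ), ψ.Holds (D.env m ρ) ↔ D.Feasible g m ρ)
    (hH : ψ.size * (I.data.height L + 1) ≤ M.H) {T : ℕ}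
    (hTime : mainCost m ψ.size (I.data.blk g n) n d * M.unit ≤ T) :
    DecidesWithin M.cost (mainProg g m ψ) I.input ((I.map φ).Manipulable g) T := by
  have hT : I.data.NoTies m := by
    rw [← Data.noTies_map _ hφ, ← Instance.data_map]
    exact hI.noTies
  obtain ⟨s', t, he, ht, -, h1, h2⟩ := runs_mainProg (g := g) hF hH I.input_data hT
    (Nat.pos_of_neZero n) rfl hF.ok
  refine ⟨s', t, he, ht.trans hTime, ?_⟩
  have h3 := h2.trans (manipulable_iff_exists hφ hI g hψ).symm
  by_cases h : s'.reg 0 = 1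
  · exact Or.inl ⟨h3.1 h, h⟩
  · exact Or.inr ⟨fun h' => h (h3.2 h'), by omega⟩

/-- The last rank is marked in the constructive case and the first one in the destructive case, as
there is no neighbour to compare with. -/
theorem Data.one_le_blk (hn : 0 < D.n) : 1 ≤ D.blk g D.n := by
  classical
  refine Finset.card_pos.2 ?_
  cases g
  · exact ⟨D.n - 1, Finset.mem_filter.2 ⟨Finset.mem_range.2 (by omega), fun h => by omega⟩⟩
  · exact ⟨0, Finset.mem_filter.2 ⟨Finset.mem_range.2 hn, fun h => absurd h (lt_irrefl 0)⟩⟩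

end

/-! ### Unit cost -/

/-- Counts instructions. -/
def realMeter (R H : ℕ) : Meter ℝ where
  cost := unitCost ℝ
  ht _ := 0
  R := R
  H := H
  w := 0
  idx_le _ _ := le_rfl
  num_le _ _ := le_rfl
  ht_op _ _ _ := Nat.zero_le _
  ht_int _ := Nat.zero_le _

theorem decidesWithin_unitCost {m : ℕ} {g : Goal} {ψ : Fm (Var m)}
    (hψ : ∀ (D : Data ℝ) (ρ : ℕ → ℝ), ψ.Holds (D.env m ρ) ↔ D.Feasible g m ρ) {n d : ℕ} [NeZero n]
    {I : Instance ℝ n d m} (hI : I.Valid) :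
    DecidesWithin (unitCost ℝ) (mainProg g m ψ) I.input (I.Manipulable g)
      (mainConst m ψ.size * (n * d + n ^ 2 + I.numScores ^ m * (d ^ 3 + n))) := by
  have hn := Nat.pos_of_neZero n
  -- Real numbers have height zero; the capacity `H` only has to meet the formal requirements and
  -- does not enter the charge.
  have hF : Fits (realMeter (n + d + m + 2) ((ψ.size + m + 1) * (I.data.height 0 + 1))) I.data m 0 :=
    { cand := fun _ _ => le_rfl
      voter := fun _ _ => le_rfl
      score := fun _ => le_rfl
      budget := le_rfl
      height := by simp only [realMeter]; nlinarith
      sum := by simp only [realMeter]; nlinarith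
      reg := le_rfl }
  have hblk : I.data.blk g n ≤ I.numScores := by
    refine (Data.blk_le hI.score_anti g).trans_eq ?_
    have : (fun t : Fin n => I.data.score t) = I.score := by
      funext t
      simp [Instance.data]
    exact congrArg (fun f => (Set.range f).ncard) this
  refine decidesWithin_mainProg (φ := RingHom.id ℝ) strictMono_id hI hF hψ
    (by simp only [realMeter]; gcongr; omega) ?_
  simp only [Meter.unit, realMeter, Nat.mul_zero, Nat.add_zero, Nat.mul_one]
  refine (mainCost_le hn (Data.one_le_blk hn)).trans ?_
  gcongr
  exact hblk

/-! ### Bit cost -/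

/-- The larger one of numerator and denominator. -/
def ratMax (q : ℚ) : ℕ := max q.num.natAbs q.den

theorem ratMax_pos (q : ℚ) : 0 < ratMax q := lt_max_of_lt_right q.den_pos

theorem ratMax_div_le {a b : ℤ} {B : ℕ} (hb : b ≠ 0) (haB : a.natAbs ≤ B) (hbB : b.natAbs ≤ B) :
    ratMax ((a : ℚ) / b) ≤ B := by
  rw [← Rat.divInt_eq_div]
  refine max_le ?_ ?_
  · rcases eq_or_ne a 0 with rfl | ha
    · simp
    · exact (Nat.le_of_dvd (by omega) (Int.natAbs_dvd_natAbs.2 (Rat.num_dvd a hb))).trans haB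
  · have h := Int.natAbs_dvd_natAbs.2 (Rat.den_dvd a b)
    exact (Nat.le_of_dvd (by omega) h).trans hbB

/-- Each result is a quotient of integers bounded by the products of numerators and denominators,
with a factor 2 for sums, and reduction to lowest terms only shrinks both. -/
theorem ratMax_eval_le (o : ArithOp) (x y : ℚ) :
    ratMax (o.eval x y) ≤ 2 * (ratMax x * ratMax y) := by
  have hx1 : x.num.natAbs ≤ ratMax x := le_max_left _ _
  have hx2 : (x.den : ℤ).natAbs ≤ ratMax x := le_max_right _ _
  have hy1 : y.num.natAbs ≤ ratMax y := le_max_left _ _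
  have hy2 : (y.den : ℤ).natAbs ≤ ratMax y := le_max_right _ _
  have hxd : (x.den : ℤ) ≠ 0 := by exact_mod_cast x.den_ne_zero
  have hyd : (y.den : ℤ) ≠ 0 := by exact_mod_cast y.den_ne_zero
  have hxd' : (x.den : ℚ) ≠ 0 := by exact_mod_cast x.den_ne_zero
  have hyd' : (y.den : ℚ) ≠ 0 := by exact_mod_cast y.den_ne_zero
  have hx := Rat.num_div_den x
  have hy := Rat.num_div_den y
  have hden : ((x.den : ℤ) * y.den).natAbs ≤ 2 * (ratMax x * ratMax y) := by
    rw [Int.natAbs_mul]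
    exact (Nat.mul_le_mul hx2 hy2).trans (by omega)
  have h1 : (x.num * y.den).natAbs ≤ ratMax x * ratMax y := by
    rw [Int.natAbs_mul]; exact Nat.mul_le_mul hx1 hy2
  have h2 : (y.num * x.den).natAbs ≤ ratMax x * ratMax y := by
    rw [Int.natAbs_mul, Nat.mul_comm]; exact Nat.mul_le_mul hx2 hy1
  cases o
  · have : ArithOp.eval .add x y = ((x.num * y.den + y.num * x.den : ℤ) : ℚ) /
        ((x.den * y.den : ℤ) : ℚ) := by
      conv_lhs => rw [← hx, ← hy]
      simp only [ArithOp.eval]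
      push_cast
      field_simp
    rw [this]
    exact ratMax_div_le (mul_ne_zero hxd hyd) (by omega) hden
  · have : ArithOp.eval .sub x y = ((x.num * y.den - y.num * x.den : ℤ) : ℚ) /
        ((x.den * y.den : ℤ) : ℚ) := by
      conv_lhs => rw [← hx, ← hy]
      simp only [ArithOp.eval]
      push_cast
      field_simp
    rw [this]
    exact ratMax_div_le (mul_ne_zero hxd hyd) (by omega) hden
  · have : ArithOp.eval .mul x y = ((x.num * y.num : ℤ) : ℚ) / ((x.den * y.den : ℤ) : ℚ) := by
      conv_lhs => rw [← hx, ← hy]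
      simp only [ArithOp.eval]
      push_cast
      field_simp
    rw [this]
    refine ratMax_div_le (mul_ne_zero hxd hyd) ?_ hden
    rw [Int.natAbs_mul]
    exact (Nat.mul_le_mul hx1 hy1).trans (by omega)
  · rcases eq_or_ne y 0 with rfl | hy0
    · have := Nat.mul_pos (ratMax_pos x) (ratMax_pos 0)
      simp only [ArithOp.eval, div_zero]
      exact (show ratMax 0 ≤ 1 by simp [ratMax]).trans (by omega)
    have hyn : y.num ≠ 0 := Rat.num_ne_zero.2 hy0
    have hyn' : (y.num : ℚ) ≠ 0 := by exact_mod_cast hyn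
    have : ArithOp.eval .div x y = ((x.num * y.den : ℤ) : ℚ) / ((y.num * x.den : ℤ) : ℚ) := by
      conv_lhs => rw [← hx, ← hy]
      simp only [ArithOp.eval]
      push_cast
      field_simp
    rw [this]
    exact ratMax_div_le (mul_ne_zero hyn hxd) (by omega) (by omega)

theorem size_le_self (k : ℕ) : Nat.size k ≤ k := Nat.size_le.2 k.lt_two_pow_self

theorem size_ratMax_le (q : ℚ) : Nat.size (ratMax q) ≤ ratBits q := by
  simp only [ratMax, ratBits]
  rcases max_choice q.num.natAbs q.den with h | h <;> rw [h] <;> omega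

theorem ratBits_le (q : ℚ) : ratBits q ≤ 2 * Nat.size (ratMax q) := by
  have h1 := Nat.size_le_size (le_max_left q.num.natAbs q.den)
  have h2 := Nat.size_le_size (le_max_right q.num.natAbs q.den)
  simp only [ratMax, ratBits]
  omega

theorem one_le_ratBits (q : ℚ) : 1 ≤ ratBits q := by
  have := Nat.size_pos.2 q.den_pos
  simp only [ratBits]
  omega

/-- Counts bits. -/
def ratMeter (R H : ℕ) : Meter ℚ where
  cost := bitCost
  ht q := Nat.size (ratMax q)
  R := R
  H := H
  w := R + 2 * H
  idx_le i hi := (size_le_self i).trans (by omega)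
  num_le q hq := (ratBits_le q).trans (by omega)
  ht_op o x y := by
    have hx := Nat.lt_size_self (ratMax x)
    have hy := Nat.lt_size_self (ratMax y)
    -- Both factors are strictly below the power of two given by their size; the factor 2 costs one
    -- more bit.
    refine Nat.size_le.2 ((ratMax_eval_le o x y).trans_lt ?_)
    rw [pow_succ, pow_add, Nat.mul_comm]
    exact Nat.mul_lt_mul_of_pos_right (Nat.mul_lt_mul'' hx hy) two_pos
  ht_int z := (size_le_self _).trans (by simp [ratMax])

section
variable {n d m : ℕ} (I : Instance ℚ n d m)

theorem Instance.one_le_bits : 1 ≤ I.bits := by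
  have := one_le_ratBits I.budget
  simp only [Instance.bits]
  omega

theorem Instance.ratBits_budget_le : ratBits I.budget ≤ I.bits := Nat.le_add_left _ _

theorem Instance.ratBits_score_le (t : Fin n) : ratBits (I.score t) ≤ I.bits := by
  have := Finset.single_le_sum (f := fun t => ratBits (I.score t)) (fun _ _ => Nat.zero_le _)
    (Finset.mem_univ t)
  simp only [Instance.bits]
  omega

theorem Instance.ratBits_voter_le (j : Fin m) (k : Fin d) : ratBits (I.voter j k) ≤ I.bits := by
  have h1 := Finset.single_le_sum (f := fun k => ratBits (I.voter j k)) (fun _ _ => Nat.zero_le _)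
    (Finset.mem_univ k)
  have h2 := Finset.single_le_sum (f := fun j => ∑ k, ratBits (I.voter j k))
    (fun _ _ => Nat.zero_le _) (Finset.mem_univ j)
  simp only [Instance.bits]
  omega

theorem Instance.ratBits_cand_le (i : Fin n) (k : Fin d) : ratBits (I.cand i k) ≤ I.bits := by
  have h1 := Finset.single_le_sum (f := fun k => ratBits (I.cand i k)) (fun _ _ => Nat.zero_le _)
    (Finset.mem_univ k)
  have h2 := Finset.single_le_sum (f := fun i => ∑ k, ratBits (I.cand i k))
    (fun _ _ => Nat.zero_le _) (Finset.mem_univ i)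
  simp only [Instance.bits]
  omega

/-- Every score contributes at least one bit, that of its denominator. -/
theorem Instance.candidates_le_bits : n ≤ I.bits := by
  have h := Finset.sum_le_sum fun t (_ : t ∈ Finset.univ) => one_le_ratBits (I.score t)
  simp only [Finset.sum_const, Finset.card_univ, Fintype.card_fin, smul_eq_mul, mul_one] at h
  simp only [Instance.bits]
  omega

/-- The coordinates of a single candidate already contribute one bit each. -/
theorem Instance.issues_le_bits [NeZero n] : d ≤ I.bits := by
  have h := Finset.sum_le_sum fun k (_ : k ∈ Finset.univ) => one_le_ratBits (I.cand 0 k)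
  simp only [Finset.sum_const, Finset.card_univ, Fintype.card_fin, smul_eq_mul, mul_one] at h
  have h2 := Finset.single_le_sum (f := fun i => ∑ k, ratBits (I.cand i k))
    (fun _ _ => Nat.zero_le _) (Finset.mem_univ 0)
  simp only [Instance.bits]
  omega

end

theorem Fits.of_bits {n d m R H : ℕ} [NeZero n] {I : Instance ℚ n d m}
    (height : I.data.height I.bits ≤ H) (sum : m * (I.bits + 1) + 1 ≤ H)
    (reg : n + d + m + 2 ≤ R) : Fits (ratMeter R H) I.data m I.bits := by
  have h0 : Nat.size (ratMax 0) ≤ I.bits := by simpa [ratMax] using I.one_le_bits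
  refine ⟨fun i k => ?_, fun j k => ?_, fun k => ?_,
    (size_ratMax_le _).trans I.ratBits_budget_le, height, sum, reg⟩ <;>
  simp only [ratMeter, Instance.data] <;> split_ifs
  exacts [(size_ratMax_le _).trans (I.ratBits_cand_le _ _), h0,
    (size_ratMax_le _).trans (I.ratBits_voter_le _ _), h0,
    (size_ratMax_le _).trans (I.ratBits_score_le _), h0]

open Polynomial in
/-- A bound on the sizes of the numbers in terms of the length of the instance. -/
noncomputable def heightPoly (m z : ℕ) : ℕ[X] :=
  C (z + m + 1) * (2 * (X * (4 * X + 4) + 1) + 4 * X + X + 7)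

open Polynomial in
/-- A bound on the time in terms of the length of the instance. -/
noncomputable def timePoly (m z : ℕ) : ℕ[X] :=
  C (mainConst m z) * (X * X + X ^ 2 + X ^ m * (X ^ 3 + X)) *
    (1 + 9 * (X + X + C m + 2 + 2 * heightPoly m z))

/-- The number of instructions and the height bound are polynomial in `n`, `d` and the bit length,
and `n` and `d` are at most the bit length. The charge per instruction is linear in the height and
register bounds. -/
theorem decidesWithin_bitCost {m : ℕ} {g : Goal} {ψ : Fm (Var m)}
    (hψ : ∀ (D : Data ℝ) (ρ : ℕ → ℝ), ψ.Holds (D.env m ρ) ↔ D.Feasible g m ρ) {n d : ℕ} [NeZero n]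
    {I : Instance ℚ n d m} (hI : I.toReal.Valid) :
    DecidesWithin bitCost (mainProg g m ψ) I.input (I.toReal.Manipulable g)
      ((timePoly m ψ.size).eval I.bits) := by
  have hn := Nat.pos_of_neZero n
  have hnb := I.candidates_le_bits
  have hdb := I.issues_le_bits
  set H := (heightPoly m ψ.size).eval I.bits with hH
  have hh : I.data.height I.bits + 1 ≤
      2 * (I.bits * (4 * I.bits + 4) + 1) + 4 * I.bits + I.bits + 7 := by
    simp only [Data.height, Instance.data]
    have := Nat.mul_le_mul_right (4 * I.bits + 4) hdb
    omega
  have hH' : H = (ψ.size + m + 1) *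
      (2 * (I.bits * (4 * I.bits + 4) + 1) + 4 * I.bits + I.bits + 7) := by
    simp [hH, heightPoly]
  generalize 2 * (I.bits * (4 * I.bits + 4) + 1) + 4 * I.bits + I.bits + 7 = B at hh hH'
  have hB : I.bits + 1 ≤ B := by
    simp only [Data.height] at hh
    omega
  have h1 : ψ.size * (I.data.height I.bits + 1) ≤ ψ.size * B := Nat.mul_le_mul_left _ hh
  have h2 : m * (I.bits + 1) ≤ m * B := Nat.mul_le_mul_left _ hB
  rw [Nat.add_mul, Nat.add_mul, Nat.one_mul] at hH'
  have hF := Fits.of_bits (I := I) (R := n + d + m + 2) (H := H) (by omega) (by omega) le_rfl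
  refine decidesWithin_mainProg (φ := Rat.castHom ℝ) Rat.cast_strictMono hI hF hψ
    (h1.trans (by simp only [ratMeter]; omega)) ?_
  have hblk : I.data.blk g n ≤ I.bits := (Data.blk_le_self n).trans hnb
  have hle := (mainCost_le (m := m) (z := ψ.size) (d := d) hn (Data.one_le_blk (D := I.data)
    (g := g) hn))
  have : (timePoly m ψ.size).eval I.bits = mainConst m ψ.size *
      (I.bits * I.bits + I.bits ^ 2 + I.bits ^ m * (I.bits ^ 3 + I.bits)) *
      (1 + 9 * (I.bits + I.bits + m + 2 + 2 * H)) := by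
    simp [timePoly, hH]
  rw [this]
  refine Nat.mul_le_mul (hle.trans ?_) ?_
  · change mainConst m ψ.size * (n * d + n ^ 2 + I.data.blk g n ^ m * (d ^ 3 + n)) ≤ _
    gcongr
  · simp only [Meter.unit, ratMeter]
    omega

end RVPM

theorem mainTheorem11 (m : ℕ) (g : RVPM.Goal) :
    ∃ P : RVPM.Prog,
      (∃ C : ℕ, ∀ (n d : ℕ) [NeZero n] (I : RVPM.Instance ℝ n d m), I.Valid →
        RVPM.DecidesWithin (RVPM.unitCost ℝ) P I.input (I.Manipulable g)
          (C * (n * d + n ^ 2 + I.numScores ^ m * (d ^ 3 + n)))) ∧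
      (∃ p : Polynomial ℕ, ∀ (n d : ℕ) [NeZero n] (I : RVPM.Instance ℚ n d m), I.toReal.Valid →
        RVPM.DecidesWithin RVPM.bitCost P I.input (I.toReal.Manipulable g)
          (p.eval I.bits)) := by
  obtain ⟨ψ, hψ⟩ := RVPM.exists_formula m g
  exact ⟨RVPM.mainProg g m ψ,
    ⟨_, fun _ _ _ _ hI => RVPM.decidesWithin_unitCost hψ hI⟩,
    ⟨_, fun _ _ _ _ hI => RVPM.decidesWithin_bitCost hψ hI⟩⟩
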